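/- **Theorem 3.4 ($O(2)$ symmetric case, reduction in transverse modes).** *Setting.* Let $\mathbb{T}=\mathbb{R}/2\pi\mathbb{Z}$, $\Omega=\mathbb{R}\times\mathbb{T}$, let $f^{(1)},f^{(2)}\in C^2(\mathbb{R}^n;\mathbb{R}^n)$ (the bifurcation parameter $\varepsilon$ is held fixed and suppressed), and let $\bar u\in C^2(\mathbb{R};\mathbb{R}^n)$ be the profile of a viscous shock wave $\bar u(x-ct)$ of $u_t+f^{(1)}(u)_x+f^{(2)}(u)_y=\Delta u$, i.e. $(f^{(1)}(\bar u)-c\bar u)'=\bar u''$ and $\bar u$ has limits at $\pm\infty$. Put $A(x)=Df^{(1)}(\bar u(x))-cI$, $B(x)=Df^{(2)}(\bar u(x))$, and, for $k\in\mathbb{Z}$, $$\mathcal{L}_k[v]=(Av)'+ikBv+k^2v-v'' ,\qquad \mathcal{L}_k:H^2(\mathbb{R};\mathbb{C}^n)\to L^2(\mathbb{R};\mathbb{C}^n),$$ $$\Pi_k[u](x)=\frac1{2\pi}\int_0^{2\pi}u(x,y)e^{-iky}\,dy,\qquad \mathcal{N}_k[u]=\Pi_k\mathcal{N}[u],$$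 $$\mathcal{N}[u]=-\partial_x\mathcal{R}^{(1)}[u]-\partial_y\mathcal{R}^{(2)}[u],\qquad \mathcal{R}^{(i)}[u]=f^{(i)}(u+\bar u)-f^{(i)}(\bar u)-Df^{(i)}(\bar u)u .$$ Let $k^*\in\mathbb{Z}\setminus\{0\}$, $\mathbb{Z}^*=\mathbb{Z}\setminus\{0,\pm k^*\}$, and assume that $\mathcal{L}_k$ is invertible for every $k\in\mathbb{Z}^*$. The equation to be solved is $\mathcal{L}_k[\Pi_k u]=\mathcal{N}_k[u]$ (equation (1.11) in the $O(2)$ symmetric case, where the speed of the frame in the $y$-direction is $0$). Let $M$ be the real Hilbert space of sequences $w=(w_k)_{k\in\mathbb{Z}}$ in $H^2(\mathbb{R};\mathbb{C}^n)$ with $w_{-k}=\overline{w_k}$ and $$\|w\|_M^2=\sum_{k\in\mathbb{Z}}\left\{\max(k^4,1)\|w_k\|_{L^2}^2+\max(k^2,1)\|w_k'\|_{L^2}^2+\|w_k''\|_{L^2}^2\right\}<\infty ,$$ and $M_{(0,\pm k^*)}=\{w\in M: w_0=w_{k^*}=w_{-k^*}=0\}$. For $w\in M_{(0,\pm k^*)}$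 and $u_0,u_{\pm k^*}\in H^2(\mathbb{R};\mathbb{C}^n)$ with $u_0=\overline{u_0}$ and $u_{-k^*}=\overline{u_{k^*}}$, let $u_0\oplus u_{\pm k^*}\oplus w$ be the real-valued $u\in H^2(\Omega;\mathbb{R}^n)$ with $\Pi_0u=u_0$, $\Pi_{\pm k^*}u=u_{\pm k^*}$ and $\Pi_ku=w_k$ for $k\in\mathbb{Z}^*$. *Claim.* There are $R_0>0$ and $\theta\in[0,1)$ such that for every $R\in(0,R_0]$ there is a $\delta>0$ with the following property. For all $u_0,u_{\pm k^*}\in H^2(\mathbb{R};\mathbb{C}^n)$ with $u_0=\overline{u_0}$, $u_{-k^*}=\overline{u_{k^*}}$ and $\|u_0\|_{H^2}^2+\|u_{k^*}\|_{H^2}^2+\|u_{-k^*}\|_{H^2}^2\le\delta$: 1. the map $T(w)=\big((\mathcal{L}_k)^{-1}\mathcal{N}_k[u_0\oplus u_{\pm k^*}\oplus w]\big)_{k\in\mathbb{Z}^*}$ is well defined from $M_{(0,\pm k^*)}$ to itself; 2. $T$ maps the ball $\{\|w\|_M\le R\}$ of $M_{(0,\pm k^*)}$ into itself, and $\|T(w)-T(v)\|_M\le\theta\|w-v\|_M$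 for all $v,w$ in this ball; 3. there is exactly one $u\in H^2(\Omega;\mathbb{R}^n)$ that solves $\mathcal{L}_k[\Pi_ku]=\mathcal{N}_k[u]$ for all $k\in\mathbb{Z}^*$, with $\Pi_0u=u_0$, $\Pi_{\pm k^*}u=u_{\pm k^*}$, and whose transverse modes $w=(\Pi_ku)_{k\in\mathbb{Z}^*}$ lie in $M_{(0,\pm k^*)}$ with $\|w\|_M\le R$; for this $u$ one has $T(w)=w$. -/

import Mathlib

open MeasureTheory Filter Topology
open scoped ContDiff

noncomputable section

/-- Real vectors `ℝⁿ` with the Euclidean norm. -/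
abbrev RVec (n : ℕ) : Type := EuclideanSpace ℝ (Fin n)

/-- Complex vectors `ℂⁿ` with the Hermitian norm. -/
abbrev CVec (n : ℕ) : Type := EuclideanSpace ℂ (Fin n)

/-- The circle `𝕋 = ℝ / 2πℤ`. -/
abbrev Circ : Type := AddCircle (2 * Real.pi)

instance fact_two_pi_pos : Fact (0 < 2 * Real.pi) := ⟨Real.two_pi_pos⟩

/-- The strip `Ω = ℝ × 𝕋`, with Lebesgue measure `dx dy`. -/
abbrev Strip : Type := ℝ × Circ

/-- The inclusion `ℝⁿ ⊆ ℂⁿ`. -/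
def toC {n : ℕ} (v : RVec n) : CVec n := WithLp.toLp 2 fun i => (v i : ℂ)

/-- Componentwise real part. -/
def reV {n : ℕ} (z : CVec n) : RVec n := WithLp.toLp 2 fun i => (z i).re

/-- Componentwise imaginary part. -/
def imV {n : ℕ} (z : CVec n) : RVec n := WithLp.toLp 2 fun i => (z i).im

/-- Componentwise complex conjugation. -/
def conjV {n : ℕ} (z : CVec n) : CVec n := WithLp.toLp 2 fun i => starRingEnd ℂ (z i)

/-- A real matrix (as a linear map of `ℝⁿ`) acting on `ℂⁿ`. -/
def complexAct {n : ℕ} (L : RVec n →L[ℝ] RVec n) (z : CVec n) : CVec n :=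
  toC (L (reV z)) + Complex.I • toC (L (imV z))

/-! ### The Sobolev space `H²(ℝ; ℂⁿ)` -/

/-- `g` is the weak derivative of `u` on `ℝ`. -/
def HasWeakDeriv {F : Type*} [NormedAddCommGroup F] [NormedSpace ℝ F] (u g : ℝ → F) : Prop :=
  LocallyIntegrable u ∧ LocallyIntegrable g ∧
    ∀ φ : ℝ → ℝ, ContDiff ℝ ∞ φ → HasCompactSupport φ →
      ∫ x, deriv φ x • u x = - ∫ x, φ x • g x

/-- `L²(ℝ; ℂⁿ)`. -/
abbrev L2Line (n : ℕ) : Type := Lp (CVec n) 2 (volume : Measure ℝ)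

theorem HasWeakDeriv.congr {F : Type*} [NormedAddCommGroup F] [NormedSpace ℝ F]
    {u g u₁ g₁ : ℝ → F} (h : HasWeakDeriv u g) (hu : u =ᵐ[volume] u₁) (hg : g =ᵐ[volume] g₁) :
    HasWeakDeriv u₁ g₁ := by
  refine ⟨h.1.congr hu, h.2.1.congr hg, fun φ h1 h2 => ?_⟩
  have e1 : (fun x => deriv φ x • u x) =ᵐ[volume] fun x => deriv φ x • u₁ x := by
    filter_upwards [hu] with x hx
    rw [hx]
  have e2 : (fun x => φ x • g x) =ᵐ[volume] fun x => φ x • g₁ x := by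
    filter_upwards [hg] with x hx
    rw [hx]
  rw [← integral_congr_ae e1, ← integral_congr_ae e2]
  exact h.2.2 φ h1 h2

theorem HasWeakDeriv.add {F : Type*} [NormedAddCommGroup F] [NormedSpace ℝ F]
    {u g u₁ g₁ : ℝ → F} (h : HasWeakDeriv u g) (h₁ : HasWeakDeriv u₁ g₁) :
    HasWeakDeriv (u + u₁) (g + g₁) := by
  refine ⟨h.1.add h₁.1, h.2.1.add h₁.2.1, fun φ h1 h2 => ?_⟩
  have c1 : Continuous (deriv φ) := h1.continuous_deriv (by simp)
  simp only [Pi.add_apply, smul_add]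
  rw [integral_add (h.1.integrable_smul_left_of_hasCompactSupport c1 h2.deriv)
      (h₁.1.integrable_smul_left_of_hasCompactSupport c1 h2.deriv),
    integral_add (h.2.1.integrable_smul_left_of_hasCompactSupport h1.continuous h2)
      (h₁.2.1.integrable_smul_left_of_hasCompactSupport h1.continuous h2),
    h.2.2 φ h1 h2, h₁.2.2 φ h1 h2, neg_add]

theorem HasWeakDeriv.smul {n : ℕ} {u g : ℝ → CVec n} (h : HasWeakDeriv u g) (a : ℂ) :
    HasWeakDeriv (a • u) (a • g) := by
  refine ⟨h.1.smul a, h.2.1.smul a, fun φ h1 h2 => ?_⟩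
  simp only [Pi.smul_apply, smul_comm _ a]
  rw [integral_smul, integral_smul, h.2.2 φ h1 h2, smul_neg]

theorem HasWeakDeriv.zero {F : Type*} [NormedAddCommGroup F] [NormedSpace ℝ F] :
    HasWeakDeriv (0 : ℝ → F) 0 :=
  ⟨locallyIntegrable_zero, locallyIntegrable_zero, fun φ _ _ => by simp⟩

/-- `H²(ℝ; ℂⁿ)`: an element is the triple `(u, u', u'')` formed by a function `u ∈ L²` and its
(uniquely determined) weak derivatives `u', u'' ∈ L²`. The inherited norm is the Sobolev norm
`‖u‖² = ‖u‖²_{L²} + ‖u'‖²_{L²} + ‖u''‖²_{L²}`. -/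
def H2LineSub (n : ℕ) : Submodule ℂ (PiLp 2 fun _ : Fin 3 => L2Line n) where
  carrier := {U | HasWeakDeriv (U 0 : ℝ → CVec n) (U 1) ∧ HasWeakDeriv (U 1 : ℝ → CVec n) (U 2)}
  add_mem' hU hV :=
    ⟨(hU.1.add hV.1).congr (Lp.coeFn_add _ _).symm (Lp.coeFn_add _ _).symm,
      (hU.2.add hV.2).congr (Lp.coeFn_add _ _).symm (Lp.coeFn_add _ _).symm⟩
  zero_mem' :=
    ⟨HasWeakDeriv.zero.congr (Lp.coeFn_zero _ _ _).symm (Lp.coeFn_zero _ _ _).symm,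
      HasWeakDeriv.zero.congr (Lp.coeFn_zero _ _ _).symm (Lp.coeFn_zero _ _ _).symm⟩
  smul_mem' a _ hU :=
    ⟨(hU.1.smul a).congr (Lp.coeFn_smul _ _).symm (Lp.coeFn_smul _ _).symm,
      (hU.2.smul a).congr (Lp.coeFn_smul _ _).symm (Lp.coeFn_smul _ _).symm⟩

/-- `H²(ℝ; ℂⁿ)` as a normed space. -/
abbrev H2Line (n : ℕ) : Type := H2LineSub n

/-- The function `u` underlying an element of `H²(ℝ; ℂⁿ)`. -/
def H2Line.fn {n : ℕ} (U : H2Line n) : L2Line n := U.1 0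

/-- The first weak derivative `u'`. -/
def H2Line.d1 {n : ℕ} (U : H2Line n) : L2Line n := U.1 1

/-- The second weak derivative `u''`. -/
def H2Line.d2 {n : ℕ} (U : H2Line n) : L2Line n := U.1 2

/-- `V` is the complex conjugate of `U`. -/
def H2Line.IsConj {n : ℕ} (U V : H2Line n) : Prop :=
  ∀ᵐ x : ℝ, V.fn x = conjV (U.fn x)

/-! ### The Sobolev space `H²(Ω; ℝⁿ)` -/

/-- Test functions on the strip: smooth (as `2π`-periodic functions of `y`), compactly supported. -/
def IsTestFun (φ : Strip → ℝ) : Prop :=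
  ContDiff ℝ ∞ (fun p : ℝ × ℝ => φ (p.1, (p.2 : Circ))) ∧ HasCompactSupport φ

/-- The classical partial derivative `∂ₓ φ`. -/
def partialX (φ : Strip → ℝ) (p : Strip) : ℝ := deriv (fun s : ℝ => φ (s, p.2)) p.1

/-- The classical partial derivative `∂_y φ`. -/
def partialY (φ : Strip → ℝ) (p : Strip) : ℝ := deriv (fun t : ℝ => φ (p.1, p.2 + (t : Circ))) 0

/-- `g = ∂ₓ u` weakly on the strip. -/
def HasWeakDerivX {n : ℕ} (u g : Strip → RVec n) : Prop :=
  LocallyIntegrable u ∧ LocallyIntegrable g ∧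
    ∀ φ : Strip → ℝ, IsTestFun φ → ∫ p, partialX φ p • u p = - ∫ p, φ p • g p

/-- `g = ∂_y u` weakly on the strip. -/
def HasWeakDerivY {n : ℕ} (u g : Strip → RVec n) : Prop :=
  LocallyIntegrable u ∧ LocallyIntegrable g ∧
    ∀ φ : Strip → ℝ, IsTestFun φ → ∫ p, partialY φ p • u p = - ∫ p, φ p • g p

/-- `L²(Ω; ℝⁿ)`. -/
abbrev L2Strip (n : ℕ) : Type := Lp (RVec n) 2 (volume : Measure Strip)

/-- `u ∈ H²(Ω; ℝⁿ)`: all weak derivatives of order at most two exist and lie in `L²`. -/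
def MemH2Strip {n : ℕ} (u : L2Strip n) : Prop :=
  ∃ ux uy uxx uxy uyy : L2Strip n,
    HasWeakDerivX (u : Strip → RVec n) ux ∧ HasWeakDerivY (u : Strip → RVec n) uy ∧
    HasWeakDerivX (ux : Strip → RVec n) uxx ∧ HasWeakDerivY (ux : Strip → RVec n) uxy ∧
    HasWeakDerivY (uy : Strip → RVec n) uyy

/-- The Fourier mode `Π_k u (x) = (1/2π) ∫₀^{2π} u(x, y) e^{-iky} dy`. -/
def modeFn {n : ℕ} (k : ℤ) (u : L2Strip n) : ℝ → CVec n :=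
  fun x => fourierCoeff (fun y : Circ => toC (u (x, y))) k

/-- `S[u] = (w_k)_k`, i.e. `Π_k u = w_k` for every `k ∈ ℤ`. -/
def HasModes {n : ℕ} (u : L2Strip n) (w : ℤ → H2Line n) : Prop :=
  ∀ k : ℤ, modeFn k u =ᵐ[volume] (w k).fn

/-! ### The sequence space `M` -/

/-- The `k`-th summand of `‖w‖_M²`. -/
def mTerm {n : ℕ} (w : ℤ → H2Line n) (k : ℤ) : ℝ :=
  max ((k : ℝ) ^ 4) 1 * ‖(w k).fn‖ ^ 2 + max ((k : ℝ) ^ 2) 1 * ‖(w k).d1‖ ^ 2 + ‖(w k).d2‖ ^ 2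

theorem mTerm_nonneg {n : ℕ} (w : ℤ → H2Line n) (k : ℤ) : 0 ≤ mTerm w k := by
  unfold mTerm; positivity

theorem sq_norm_add_le {V : Type*} [SeminormedAddCommGroup V] (a b : V) :
    ‖a + b‖ ^ 2 ≤ 2 * ‖a‖ ^ 2 + 2 * ‖b‖ ^ 2 := by
  nlinarith [norm_add_le a b, norm_nonneg (a + b), sq_nonneg (‖a‖ - ‖b‖), norm_nonneg a,
    norm_nonneg b]

theorem mTerm_add_le {n : ℕ} (v w : ℤ → H2Line n) (k : ℤ) :
    mTerm (v + w) k ≤ 2 * mTerm v k + 2 * mTerm w k := by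
  have h0 := mul_le_mul_of_nonneg_left (sq_norm_add_le (v k).fn (w k).fn)
    (by positivity : 0 ≤ max ((k : ℝ) ^ 4) 1)
  have h1 := mul_le_mul_of_nonneg_left (sq_norm_add_le (v k).d1 (w k).d1)
    (by positivity : 0 ≤ max ((k : ℝ) ^ 2) 1)
  have h2 := sq_norm_add_le (v k).d2 (w k).d2
  have e0 : ((v + w) k).fn = (v k).fn + (w k).fn := rfl
  have e1 : ((v + w) k).d1 = (v k).d1 + (w k).d1 := rfl
  have e2 : ((v + w) k).d2 = (v k).d2 + (w k).d2 := rfl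
  unfold mTerm
  rw [e0, e1, e2]
  linarith

theorem mTerm_smul {n : ℕ} (a : ℝ) (w : ℤ → H2Line n) (k : ℤ) :
    mTerm (a • w) k = a ^ 2 * mTerm w k := by
  have e0 : ((a • w) k).fn = a • (w k).fn := rfl
  have e1 : ((a • w) k).d1 = a • (w k).d1 := rfl
  have e2 : ((a • w) k).d2 = a • (w k).d2 := rfl
  unfold mTerm
  rw [e0, e1, e2, norm_smul, norm_smul, norm_smul]
  simp only [mul_pow, Real.norm_eq_abs, sq_abs]
  ring

/-- The space `M` of sequences `(w_k)_{k ∈ ℤ}` in `H²(ℝ; ℂⁿ)` with `‖w‖_M < ∞` that are the modes of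
real-valued functions, i.e. `w_{-k}` is the complex conjugate of `w_k`. -/
def MSpace (n : ℕ) : Submodule ℝ (ℤ → H2Line n) where
  carrier := {w | Summable (mTerm w) ∧ ∀ k, (w k).IsConj (w (-k))}
  add_mem' {v w} hv hw := by
    refine ⟨Summable.of_nonneg_of_le (mTerm_nonneg _) (mTerm_add_le v w)
      ((hv.1.mul_left 2).add (hw.1.mul_left 2)), fun k => ?_⟩
    filter_upwards [hv.2 k, hw.2 k, Lp.coeFn_add (v k).fn (w k).fn,
      Lp.coeFn_add (v (-k)).fn (w (-k)).fn] with x h1 h2 h3 h4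
    change ((v (-k)).fn + (w (-k)).fn : L2Line n) x = conjV (((v k).fn + (w k).fn : L2Line n) x)
    rw [h3, h4, Pi.add_apply, Pi.add_apply, h1, h2]
    ext i
    simp [conjV]
  zero_mem' := by
    refine ⟨?_, fun k => ?_⟩
    · have : mTerm (0 : ℤ → H2Line n) = 0 := by
        funext k
        have e0 : ((0 : ℤ → H2Line n) k).fn = 0 := rfl
        have e1 : ((0 : ℤ → H2Line n) k).d1 = 0 := rfl
        have e2 : ((0 : ℤ → H2Line n) k).d2 = 0 := rfl
        unfold mTerm
        rw [e0, e1, e2]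
        simp
      rw [this]
      exact summable_zero
    · filter_upwards [Lp.coeFn_zero (CVec n) 2 (volume : Measure ℝ)] with x h1
      change (0 : L2Line n) x = conjV ((0 : L2Line n) x)
      rw [h1]
      ext i
      simp [conjV]
  smul_mem' a {w} hw := by
    refine ⟨?_, fun k => ?_⟩
    · have : mTerm (a • w) = fun k => a ^ 2 * mTerm w k := funext (mTerm_smul a w)
      rw [this]
      exact hw.1.mul_left _
    · filter_upwards [hw.2 k, Lp.coeFn_smul a (w k).fn, Lp.coeFn_smul a (w (-k)).fn] with x h1 h3 h4
      change (a • (w (-k)).fn : L2Line n) x = conjV ((a • (w k).fn : L2Line n) x)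
      rw [h3, h4, Pi.smul_apply, Pi.smul_apply, h1]
      ext i
      simp [conjV]

/-- The transverse modes `ℤ* = ℤ ∖ {0, k*, -k*}`. -/
def IsTransverse (kstar k : ℤ) : Prop := k ≠ 0 ∧ k ≠ kstar ∧ k ≠ -kstar

/-- `M_{(0, ±k*)}`: the elements of `M` whose modes `0, k*, -k*` vanish. -/
def MTrans (n : ℕ) (kstar : ℤ) : Submodule ℝ (ℤ → H2Line n) where
  carrier := {w | w ∈ MSpace n ∧ ∀ k, ¬ IsTransverse kstar k → w k = 0}
  add_mem' {v w} hv hw := ⟨add_mem hv.1 hw.1, fun k hk => by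
    rw [Pi.add_apply, hv.2 k hk, hw.2 k hk, add_zero]⟩
  zero_mem' := ⟨zero_mem _, fun _ _ => rfl⟩
  smul_mem' a {w} hw := ⟨Submodule.smul_mem _ a hw.1, fun k hk => by
    rw [Pi.smul_apply, hw.2 k hk, smul_zero]⟩

/-- The norm of `M`, on `M_{(0, ±k*)}`. -/
def mNorm {n : ℕ} {kstar : ℤ} (w : MTrans n kstar) : ℝ := Real.sqrt (∑' k, mTerm w.1 k)

/-- `u₀ ⊕ u_{±k*} ⊕ w`. -/
def assemble {n : ℕ} {kstar : ℤ} (u₀ um up : H2Line n) (w : MTrans n kstar) : ℤ → H2Line n :=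
  fun k => if k = 0 then u₀ else if k = kstar then up else if k = -kstar then um else w.1 k

/-! ### The equation -/

/-- `ū` is the profile of a viscous shock wave `ū(x - ct)` of
`u_t + f₁(u)_x + f₂(u)_y = Δu`: a `C²` solution of `(f₁(ū) - cū)' = ū''` with limits at `±∞`. -/
structure IsShockProfile {n : ℕ} (f₁ : RVec n → RVec n) (c : ℝ) (ubar : ℝ → RVec n) : Prop where
  contDiff : ContDiff ℝ 2 ubar
  profile : ∀ x, deriv (fun s => f₁ (ubar s) - c • ubar s) x = deriv (deriv ubar) x
  limit_top : ∃ uplus, Tendsto ubar atTop (𝓝 uplus)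
  limit_bot : ∃ uminus, Tendsto ubar atBot (𝓝 uminus)

/-- The Taylor remainder `R[v] = f(v + ū) - f(ū) - Df(ū) v`. -/
def remainderFn {n : ℕ} (f : RVec n → RVec n) (ubar : ℝ → RVec n) (v : L2Strip n) :
    Strip → RVec n :=
  fun p => f (v p + ubar p.1) - f (ubar p.1) - fderiv ℝ f (ubar p.1) (v p)

/-- `𝒩[v] = F`, where `𝒩[v] = -∂ₓ R₁[v] - ∂_y R₂[v]` (weak derivatives in `L²(Ω; ℝⁿ)`). -/
def IsNonlin {n : ℕ} (f₁ f₂ : RVec n → RVec n) (ubar : ℝ → RVec n) (v F : L2Strip n) : Prop :=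
  ∃ G₁ G₂ : L2Strip n, HasWeakDerivX (remainderFn f₁ ubar v) G₁ ∧
    HasWeakDerivY (remainderFn f₂ ubar v) G₂ ∧ F = -G₁ - G₂

/-- `A(x) = Df₁(ū(x)) - cI`. -/
def coefA {n : ℕ} (f₁ : RVec n → RVec n) (c : ℝ) (ubar : ℝ → RVec n) (x : ℝ) :
    RVec n →L[ℝ] RVec n :=
  fderiv ℝ f₁ (ubar x) - c • ContinuousLinearMap.id ℝ (RVec n)

/-- `B(x) = Df₂(ū(x))`. -/
def coefB {n : ℕ} (f₂ : RVec n → RVec n) (ubar : ℝ → RVec n) (x : ℝ) : RVec n →L[ℝ] RVec n :=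
  fderiv ℝ f₂ (ubar x)

/-- The graph of `ℒ_k : H²(ℝ; ℂⁿ) → L²(ℝ; ℂⁿ)`: `ℒ_k U = h`, where
`ℒ_k U = (A U)' + i k B U + k² U - U''`. -/
def IsLk {n : ℕ} (f₁ f₂ : RVec n → RVec n) (c : ℝ) (ubar : ℝ → RVec n) (k : ℤ)
    (U : H2Line n) (h : ℝ → CVec n) : Prop :=
  ∃ g : L2Line n, HasWeakDeriv (fun x => complexAct (coefA f₁ c ubar x) (U.fn x)) g ∧
    ∀ᵐ x : ℝ, h x = g x + (Complex.I * (k : ℂ)) • complexAct (coefB f₂ ubar x) (U.fn x) +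
      ((k : ℂ) ^ 2) • U.fn x - U.d2 x

/-- `ℒ_k : H²(ℝ; ℂⁿ) → L²(ℝ; ℂⁿ)` is invertible. -/
def LkInvertible {n : ℕ} (f₁ f₂ : RVec n → RVec n) (c : ℝ) (ubar : ℝ → RVec n) (k : ℤ) : Prop :=
  ∀ h : L2Line n, ∃! U : H2Line n, IsLk f₁ f₂ c ubar k U h

/-- The graph of the map `T`: `w' = (ℒ_k⁻¹ 𝒩_k[u₀ ⊕ u_{±k*} ⊕ w])_{k ∈ ℤ*}`, where
`𝒩_k[u₀ ⊕ u_{±k*} ⊕ w] = Π_k 𝒩[u]` for the `u ∈ H²(Ω; ℝⁿ)` whose modes are `u₀ ⊕ u_{±k*} ⊕ w`. -/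
def IsTImage {n : ℕ} (f₁ f₂ : RVec n → RVec n) (c : ℝ) (ubar : ℝ → RVec n) (kstar : ℤ)
    (u₀ um up : H2Line n) (w w' : MTrans n kstar) : Prop :=
  ∃ u F : L2Strip n, MemH2Strip u ∧ HasModes u (assemble u₀ um up w) ∧
    IsNonlin f₁ f₂ ubar u F ∧
    ∀ k, IsTransverse kstar k → IsLk f₁ f₂ c ubar k (w'.1 k) (modeFn k F)

/-- `u` solves `ℒ_k[Π_k u] = 𝒩_k[u]` for all transverse modes `k`. -/
def SolvesTransverse {n : ℕ} (f₁ f₂ : RVec n → RVec n) (c : ℝ) (ubar : ℝ → RVec n) (kstar : ℤ)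
    (u : L2Strip n) : Prop :=
  ∃ F : L2Strip n, IsNonlin f₁ f₂ ubar u F ∧
    ∀ k, IsTransverse kstar k →
      ∃ U : H2Line n, modeFn k u =ᵐ[volume] U.fn ∧ IsLk f₁ f₂ c ubar k U (modeFn k F)

/-- `S_{(0, ±k*)}[u] = w`, i.e. `Π_k u = w_k` for all transverse modes `k`. -/
def HasTransverseModes {n : ℕ} {kstar : ℤ} (u : L2Strip n) (w : MTrans n kstar) : Prop :=
  ∀ k, IsTransverse kstar k → modeFn k u =ᵐ[volume] (w.1 k).fn

end

/-!
The theorem is an application of the contraction principle; the work lies in showing that the two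
halves of `T = ℒ⁻¹ ∘ 𝒩` compose in the right spaces.

*Linear part.* `ℒ_k` is the constant coefficient operator `k² - ∂ₓ²` plus the first order part
`(A v)' + ikBv` with bounded coefficients. The energy identity
`‖k²u - u''‖² = k⁴‖u‖² + 2k²‖u'‖² + ‖u''‖²` (`H2Line.norm_sq_smul_fn_sub_d2`) controls exactly the
`k`-th summand of the norm of `M`, and for large `|k|` it absorbs the first order part. For the
remaining finitely many transverse modes the open mapping theorem bounds `ℒ_k⁻¹`. Hence the inverses
are bounded uniformly in `k` (`IsCoefBound.exists_uniform_bound`), and by Parseval's identity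
`F ↦ (ℒ_k⁻¹ Π_k F)_k` is bounded from `L²(Ω)` to `M`
(`IsCoefBound.summable_mTerm_and_mNormSq_le`). As the coefficients are real, it maps real functions
to sequences with `w_{-k} = \overline{w_k}` (`IsCoefBound.op_neg_conj`).

*Nonlinear part.* A sequence in `M` is the sequence of modes of a function `u ∈ H²(Ω)`
(`exists_isSynth`), which is bounded: `|w_k| ≤ ‖w_k‖ + ‖w_k'‖` on the line, and these numbers are
summable over `k` by the Cauchy-Schwarz inequality (`tsum_supBound_le`, `IsSynth.ae_norm_le`). The
chain rule for the Taylor remainder holds for the partial sums of the Fourier series, which are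
classically differentiable, and passes to the limit since they converge uniformly with first
derivatives in `L²` (`weakD_taylorRem_of_tendsto`). The derivatives of the remainders involve only
`u`, `∇u`, and differences of `Df` and of `D²f` that are small for small `u`, so `𝒩` maps `M` to
`L²(Ω)` with an arbitrarily small Lipschitz constant on small balls (`exists_nonlin_lipschitz`).
For `f` merely `C²` this uses the uniform continuity of `D²f` on compact sets in place of a bound
for a third derivative (`exists_taylorBound_small`).

Together, `T` is a contraction of a small ball of `M`, which it maps to itself when the modes
`0, ±k*` are small, because `𝒩[0] = 0`. The fixed point is found for the map `F ↦ 𝒩[ℒ⁻¹ F]` on a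
ball of the complete space `L²(Ω)` (`exists_fixedPoint`).
-/

noncomputable section

variable {n : ℕ}

/-! ### Weak derivatives on the line -/

section WeakDerivLine

variable {F G : Type*} [NormedAddCommGroup F] [NormedSpace ℝ F] [NormedAddCommGroup G]
  [NormedSpace ℝ G]

theorem HasWeakDeriv.neg {u g : ℝ → F} (h : HasWeakDeriv u g) : HasWeakDeriv (-u) (-g) := by
  refine ⟨h.1.neg, h.2.1.neg, fun φ h1 h2 => ?_⟩
  simp only [Pi.neg_apply, smul_neg, integral_neg, h.2.2 φ h1 h2]

theorem HasWeakDeriv.sub {u g v h : ℝ → F} (hu : HasWeakDeriv u g) (hv : HasWeakDeriv v h) :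
    HasWeakDeriv (u - v) (g - h) := by
  simpa only [sub_eq_add_neg] using hu.add hv.neg

theorem HasWeakDeriv.clm_comp [CompleteSpace F] [CompleteSpace G] (L : F →L[ℝ] G) {u g : ℝ → F}
    (h : HasWeakDeriv u g) : HasWeakDeriv (fun x => L (u x)) (fun x => L (g x)) := by
  have hl : ∀ v : ℝ → F, LocallyIntegrable v → LocallyIntegrable fun x => L (v x) := by
    intro v hv x
    obtain ⟨s, hs, hi⟩ := hv x
    exact ⟨s, hs, L.integrable_comp hi⟩
  refine ⟨hl u h.1, hl g h.2.1, fun φ h1 h2 => ?_⟩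
  have c1 : Continuous (deriv φ) := h1.continuous_deriv (by simp)
  have i1 := h.1.integrable_smul_left_of_hasCompactSupport c1 h2.deriv
  have i2 := h.2.1.integrable_smul_left_of_hasCompactSupport h1.continuous h2
  have e1 := L.integral_comp_comm i1
  have e2 := L.integral_comp_comm i2
  simp only [map_smul] at e1 e2
  rw [e1, e2, h.2.2 φ h1 h2, map_neg]

theorem HasWeakDeriv.unique [CompleteSpace F] {u g h : ℝ → F} (hg : HasWeakDeriv u g)
    (hh : HasWeakDeriv u h) : g =ᵐ[volume] h := by
  have := ae_eq_zero_of_integral_contDiff_smul_eq_zero (hg.sub hh).2.1 (fun φ h1 h2 => by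
    have := (hg.sub hh).2.2 φ h1 h2
    simpa using this.symm)
  filter_upwards [this] with x hx
  exact sub_eq_zero.1 hx

theorem MeasureTheory.LocallyIntegrable.intervalIntegrable' {E : Type*}
    [NormedAddCommGroup E] {g : ℝ → E} (hg : LocallyIntegrable g) (a b : ℝ) :
    IntervalIntegrable g volume a b :=
  (hg.integrableOn_isCompact isCompact_uIcc).intervalIntegrable

theorem absolutelyContinuousOnInterval_primitive {g : ℝ → ℝ} (hg : LocallyIntegrable g)
    (C : ℝ) (a b : ℝ) :
    AbsolutelyContinuousOnInterval (fun x => C + ∫ t in (0 : ℝ)..x, g t) a b := by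
  have h1 : AbsolutelyContinuousOnInterval (fun x => ∫ t in (a : ℝ)..x, g t) a b :=
    (hg.intervalIntegrable' a b).absolutelyContinuousOnInterval_intervalIntegral (by simp)
  have h2 : AbsolutelyContinuousOnInterval (fun _ : ℝ => C + ∫ t in (0 : ℝ)..a, g t) a b :=
    contDiff_const.contDiffOn.absolutelyContinuousOnInterval
  have := h2.add h1
  convert! this using 1
  funext x
  simp only [Pi.add_apply]
  rw [add_assoc, intervalIntegral.integral_add_adjacent_intervals (hg.intervalIntegrable' _ _)
    (hg.intervalIntegrable' _ _)]

theorem ae_deriv_primitive {g : ℝ → ℝ} (hg : LocallyIntegrable g) (C : ℝ) :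
    ∀ᵐ x, deriv (fun x => C + ∫ t in (0 : ℝ)..x, g t) x = g x := by
  filter_upwards [_root_.LocallyIntegrable.ae_hasDerivAt_integral hg] with x hx
  exact ((hx 0).const_add C).deriv

/-- Fundamental theorem of calculus for a product of two primitives. -/
theorem integral_mul_primitive {g h : ℝ → ℝ} (hg : LocallyIntegrable g) (hh : LocallyIntegrable h)
    (C D a b : ℝ) :
    ∫ x in a..b, (g x * (D + ∫ t in (0 : ℝ)..x, h t) + (C + ∫ t in (0 : ℝ)..x, g t) * h x)
      = (C + ∫ t in (0 : ℝ)..b, g t) * (D + ∫ t in (0 : ℝ)..b, h t)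
        - (C + ∫ t in (0 : ℝ)..a, g t) * (D + ∫ t in (0 : ℝ)..a, h t) := by
  rw [← (absolutelyContinuousOnInterval_primitive hg C a b).integral_deriv_mul_eq_sub
    (absolutelyContinuousOnInterval_primitive hh D a b)]
  refine intervalIntegral.integral_congr_ae ?_
  filter_upwards [ae_deriv_primitive hg C, ae_deriv_primitive hh D] with x h1 h2 _
  rw [h1, h2]

theorem continuous_primitive' {g : ℝ → F} (hg : LocallyIntegrable g) (C : F) :
    Continuous fun x => C + ∫ t in (0 : ℝ)..x, g t :=
  continuous_const.add
    (intervalIntegral.continuous_primitive (fun a b => hg.intervalIntegrable' a b) 0)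

theorem HasCompactSupport.exists_Icc {E : Type*} [NormedAddCommGroup E] {φ : ℝ → E}
    (h : HasCompactSupport φ) :
    ∃ N : ℝ, 0 < N ∧ ∀ x, N ≤ |x| → φ x = 0 := by
  obtain ⟨N, hN⟩ := h.isCompact.isBounded.subset_closedBall 0
  refine ⟨max N 0 + 1, by positivity, fun x hx => ?_⟩
  by_contra hne
  have := hN (subset_tsupport _ hne)
  rw [Metric.mem_closedBall, dist_zero_right, Real.norm_eq_abs] at this
  linarith [le_max_left N 0]

theorem integral_eq_intervalIntegral_of_eq_zero {f : ℝ → F} {N : ℝ} (hN : 0 < N)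
    (hf : ∀ x, N ≤ |x| → f x = 0) : ∫ x, f x = ∫ x in (-N)..N, f x := by
  rw [intervalIntegral.integral_of_le (by linarith),
    setIntegral_eq_integral_of_forall_compl_eq_zero]
  intro x hx
  apply hf
  by_contra! h
  exact hx ⟨(abs_lt.1 h).1, (abs_lt.1 h).2.le⟩

/-- A primitive of a locally integrable function has that function as its weak derivative. -/
theorem hasWeakDeriv_primitive [CompleteSpace F] {g : ℝ → F} (hg : LocallyIntegrable g) (C : F) :
    HasWeakDeriv (fun x => C + ∫ t in (0 : ℝ)..x, g t) g := by
  refine ⟨(continuous_primitive' hg C).locallyIntegrable, hg, fun φ h1 h2 => ?_⟩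
  have c1 : Continuous (deriv φ) := h1.continuous_deriv (by simp)
  have i0 := (continuous_primitive' hg C).locallyIntegrable (μ := volume)
  have i1 := i0.integrable_smul_left_of_hasCompactSupport c1 h2.deriv
  have i2 := hg.integrable_smul_left_of_hasCompactSupport h1.continuous h2
  rw [SeparatingDual.eq_iff_forall_dual_eq (R := ℝ)]
  intro L
  rw [map_neg, ← L.integral_comp_comm i1, ← L.integral_comp_comm i2]
  simp only [map_smul, map_add, smul_eq_mul]
  have hL : LocallyIntegrable fun x => L (g x) := fun x => by
    obtain ⟨s, hs, hi⟩ := hg x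
    exact ⟨s, hs, L.integrable_comp hi⟩
  have e : ∀ x, L (∫ t in (0 : ℝ)..x, g t) = ∫ t in (0 : ℝ)..x, L (g t) := fun x =>
    (L.intervalIntegral_comp_comm (hg.intervalIntegrable' _ _)).symm
  simp only [e]
  obtain ⟨N, hN, hφ⟩ := h2.exists_Icc
  obtain ⟨M, hM, hφ'⟩ := h2.deriv.exists_Icc
  have a1 : AbsolutelyContinuousOnInterval φ (-max N M) (max N M) :=
    (h1.of_le (by simp)).contDiffOn.absolutelyContinuousOnInterval
  have key := a1.integral_deriv_mul_eq_sub
    (absolutelyContinuousOnInterval_primitive hL (L C) (-max N M) (max N M))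
  have hpos : 0 < max N M := lt_max_of_lt_left hN
  rw [hφ (max N M) (by rw [abs_of_pos hpos]; exact le_max_left _ _),
    hφ (-max N M) (by rw [abs_neg, abs_of_pos hpos]; exact le_max_left _ _)] at key
  have j1 := L.integrable_comp i1
  have j2 := L.integrable_comp i2
  simp only [map_smul, map_add, smul_eq_mul, e] at j1 j2
  have key2 : ∫ x in (-max N M)..(max N M), deriv φ x * (L C + ∫ t in (0 : ℝ)..x, L (g t))
      + φ x * L (g x) = 0 := by
    have : (0 : ℝ) = 0 * (L C + ∫ t in (0 : ℝ)..(max N M), L (g t))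
        - 0 * (L C + ∫ t in (0 : ℝ)..(-max N M), L (g t)) := by simp
    refine Eq.trans ?_ (key.trans this.symm)
    refine intervalIntegral.integral_congr_ae ?_
    filter_upwards [ae_deriv_primitive hL (L C)] with x hx _
    rw [hx]
  rw [intervalIntegral.integral_add j1.intervalIntegrable j2.intervalIntegrable] at key2
  rw [integral_eq_intervalIntegral_of_eq_zero (N := max N M) hpos,
    integral_eq_intervalIntegral_of_eq_zero (f := fun x => φ x * L (g x)) (N := max N M) hpos]
  · linarith
  · intro x hx
    rw [hφ x ((le_max_left _ _).trans hx), zero_mul]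
  · intro x hx
    rw [hφ' x ((le_max_right _ _).trans hx), zero_mul]

/-- A smooth compactly supported function of integral zero is the derivative of another one. -/
theorem exists_primitive_hasCompactSupport {φ : ℝ → ℝ} (h1 : ContDiff ℝ ∞ φ)
    (h2 : HasCompactSupport φ) (h3 : ∫ x, φ x = 0) :
    ∃ χ : ℝ → ℝ, ContDiff ℝ ∞ χ ∧ HasCompactSupport χ ∧ deriv χ = φ := by
  obtain ⟨N, hN, hφ⟩ := h2.exists_Icc
  have hd : ∀ x, HasDerivAt (fun x => ∫ t in (-N)..x, φ t) (φ x) x := fun x =>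
    intervalIntegral.integral_hasDerivAt_right (h1.continuous.intervalIntegrable _ _)
      (h1.continuous.stronglyMeasurableAtFilter _ _) h1.continuous.continuousAt
  have hd' : deriv (fun x => ∫ t in (-N)..x, φ t) = φ := funext fun x => (hd x).deriv
  refine ⟨fun x => ∫ t in (-N)..x, φ t, ?_, ?_, hd'⟩
  · rw [contDiff_infty_iff_deriv, hd']
    exact ⟨fun x => (hd x).differentiableAt, h1⟩
  · refine HasCompactSupport.of_support_subset_isCompact (isCompact_Icc (a := -N) (b := N)) ?_
    intro x hx
    by_contra hx'
    apply hx
    rw [Set.mem_Icc, not_and_or, not_le, not_le] at hx'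
    rcases hx' with hx' | hx'
    · refine intervalIntegral.integral_zero_ae (ae_of_all _ fun t ht => hφ t ?_)
      rw [Set.uIoc_of_ge hx'.le] at ht
      rw [abs_of_neg (by linarith [ht.2])]
      linarith [ht.2]
    · have e : ∫ t in (-N)..N, φ t = 0 := by
        rw [← integral_eq_intervalIntegral_of_eq_zero hN hφ, h3]
      have e2 : ∫ t in N..x, φ t = 0 := by
        refine intervalIntegral.integral_zero_ae (ae_of_all _ fun t ht => hφ t ?_)
        rw [Set.uIoc_of_le hx'.le] at ht
        exact ht.1.le.trans (le_abs_self t)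
      change ∫ t in (-N)..x, φ t = 0
      rw [← intervalIntegral.integral_add_adjacent_intervals
        (h1.continuous.intervalIntegrable (-N) N) (h1.continuous.intervalIntegrable N x), e, e2,
        add_zero]

/-- A function with weak derivative zero is constant, up to a null set. -/
theorem HasWeakDeriv.ae_const [CompleteSpace F] {u : ℝ → F} (h : HasWeakDeriv u 0) :
    ∃ C : F, u =ᵐ[volume] fun _ => C := by
  -- Subtracting a multiple of the bump function `b` from a test function makes its integral vanish.
  let b : ContDiffBump (0 : ℝ) := ⟨1, 2, one_pos, one_lt_two⟩
  have hb1 : ContDiff ℝ ∞ (b.normed volume) := b.contDiff_normed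
  have hb2 : HasCompactSupport (b.normed volume) := b.hasCompactSupport_normed
  have hb3 : ∫ x, b.normed volume x = 1 := b.integral_normed
  set C := ∫ x, b.normed volume x • u x with hC
  refine ⟨C, ?_⟩
  have hint : ∀ {φ : ℝ → ℝ}, Continuous φ → HasCompactSupport φ → Integrable fun x => φ x • u x :=
    fun h1 h2 => h.1.integrable_smul_left_of_hasCompactSupport h1 h2
  have := ae_eq_zero_of_integral_contDiff_smul_eq_zero
    (h.1.sub (locallyIntegrable_const (μ := volume) C)) (fun φ h1 h2 => by
    obtain ⟨χ, k1, k2, k3⟩ := exists_primitive_hasCompactSupport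
      (φ := fun x => φ x - (∫ t, φ t) * b.normed volume x) (h1.sub (contDiff_const.mul hb1))
      (h2.sub hb2.mul_left) (by
        rw [integral_sub (h1.continuous.integrable_of_hasCompactSupport h2)
          ((hb1.continuous.integrable_of_hasCompactSupport hb2).const_mul _), integral_const_mul,
          hb3, mul_one, sub_self])
    have key := h.2.2 χ k1 k2
    rw [k3] at key
    simp only [Pi.zero_apply, smul_zero, integral_zero, neg_zero, sub_smul, mul_smul] at key
    rw [integral_sub (hint h1.continuous h2) ((hint hb1.continuous hb2).fun_smul _),
      integral_smul, ← hC] at key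
    simp only [Pi.sub_apply, smul_sub]
    rw [integral_sub (hint h1.continuous h2)
      ((h1.continuous.integrable_of_hasCompactSupport h2).smul_const C), integral_smul_const, key])
  filter_upwards [this] with x hx
  exact sub_eq_zero.1 hx

/-- A weakly differentiable function on the line is, up to a null set, a primitive of its weak
derivative. -/
theorem HasWeakDeriv.ae_eq_primitive [CompleteSpace F] {u g : ℝ → F} (h : HasWeakDeriv u g) :
    ∃ C : F, u =ᵐ[volume] fun x => C + ∫ t in (0 : ℝ)..x, g t := by
  have h1 := h.sub (hasWeakDeriv_primitive h.2.1 0)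
  rw [sub_self] at h1
  obtain ⟨C, hC⟩ := h1.ae_const
  refine ⟨C, ?_⟩
  filter_upwards [hC] with x hx
  simp only [Pi.sub_apply, zero_add] at hx
  rw [← hx]
  abel

theorem hasWeakDeriv_of_hasDerivAt [CompleteSpace F] {u g : ℝ → F} (h : ∀ x, HasDerivAt u (g x) x)
    (hg : Continuous g) : HasWeakDeriv u g := by
  have : u = fun x => u 0 + ∫ t in (0 : ℝ)..x, g t := by
    funext x
    rw [intervalIntegral.integral_eq_sub_of_hasDerivAt (fun t _ => h t)
      (hg.intervalIntegrable _ _)]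
    abel
  rw [this]
  exact hasWeakDeriv_primitive hg.locallyIntegrable _

/-- Integration by parts for square-integrable weakly differentiable functions. -/
theorem integral_mul_weakDeriv {u g v h : ℝ → ℝ} (hu : MemLp u 2) (hg : MemLp g 2)
    (hv : MemLp v 2) (hh : MemLp h 2) (hug : HasWeakDeriv u g) (hvh : HasWeakDeriv v h) :
    ∫ x, u x * h x = - ∫ x, g x * v x := by
  obtain ⟨C, hC⟩ := hug.ae_eq_primitive
  obtain ⟨D, hD⟩ := hvh.ae_eq_primitive
  set U : ℝ → ℝ := fun x => C + ∫ t in (0 : ℝ)..x, g t with hU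
  set V : ℝ → ℝ := fun x => D + ∫ t in (0 : ℝ)..x, h t with hV
  have hU2 : MemLp U 2 := (memLp_congr_ae hC).1 hu
  have hV2 : MemLp V 2 := (memLp_congr_ae hD).1 hv
  have i1 : Integrable fun x => g x * V x := hg.integrable_mul hV2
  have i2 : Integrable fun x => U x * h x := hU2.integrable_mul hh
  have i3 : Integrable fun x => U x * V x := hU2.integrable_mul hV2
  have ftc : ∀ a b, ∫ x in a..b, (g x * V x + U x * h x) = U b * V b - U a * V a :=
    fun a b => integral_mul_primitive hug.2.1 hvh.2.1 C D a b
  have t1 : Tendsto (fun x => U x * V x) atTop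
      (𝓝 (U 0 * V 0 + ∫ x in Set.Ioi 0, (g x * V x + U x * h x))) := by
    have := (intervalIntegral_tendsto_integral_Ioi 0 (i1.add i2).integrableOn
      tendsto_id).const_add (U 0 * V 0)
    refine this.congr fun b => ?_
    simp only [Pi.add_apply, id, ftc]
    ring
  have t2 : Tendsto (fun x => U x * V x) atBot
      (𝓝 (U 0 * V 0 - ∫ x in Set.Iic 0, (g x * V x + U x * h x))) := by
    have := (intervalIntegral_tendsto_integral_Iic 0 (i1.add i2).integrableOn
      tendsto_id).const_sub (U 0 * V 0)
    refine this.congr fun b => ?_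
    simp only [Pi.add_apply, id, ftc]
    ring
  have z1 := (i3.integrableAtFilter atTop).eq_zero_of_tendsto (fun s hs => by
    obtain ⟨a, ha⟩ := mem_atTop_sets.1 hs
    exact measure_mono_top (s₁ := Set.Ici a) ha Real.volume_Ici) t1
  have z2 := (i3.integrableAtFilter atBot).eq_zero_of_tendsto (fun s hs => by
    obtain ⟨a, ha⟩ := mem_atBot_sets.1 hs
    exact measure_mono_top (s₁ := Set.Iic a) ha Real.volume_Iic) t2
  have split : ∫ x, (g x * V x + U x * h x) = 0 := by
    have := intervalIntegral.integral_Iic_add_Ioi (b := 0) (i1.add i2).integrableOn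
      (i1.add i2).integrableOn
    simp only [Pi.add_apply] at this
    linarith
  rw [integral_add i1 i2] at split
  have e1 : ∫ x, u x * h x = ∫ x, U x * h x := by
    refine integral_congr_ae ?_
    filter_upwards [hC] with x hx
    rw [hx]
  have e2 : ∫ x, g x * v x = ∫ x, g x * V x := by
    refine integral_congr_ae ?_
    filter_upwards [hD] with x hx
    rw [hx]
  rw [e1, e2]
  linarith

/-- Local `L¹` norms on intervals of length one are bounded by the `L²` norm. -/
theorem integral_Ioc_norm_le {E : Type*} [NormedAddCommGroup E]
    (f : Lp E 2 (volume : Measure ℝ)) (x : ℝ) :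
    ∫ t in Set.Ioc x (x + 1), ‖f t‖ ≤ ‖f‖ := by
  have : IsProbabilityMeasure (volume.restrict (Set.Ioc x (x + 1))) := ⟨by simp⟩
  have hf := Lp.memLp f
  have h1 := eLpNorm_le_eLpNorm_of_exponent_le (μ := volume.restrict (Set.Ioc x (x + 1)))
    (p := 1) (q := 2) (by norm_num) hf.1.restrict
  have h2 := eLpNorm_mono_measure f (Measure.restrict_le_self (μ := volume)
    (s := Set.Ioc x (x + 1))) (p := 2)
  have h3 := ENNReal.toReal_mono hf.2.ne (h1.trans h2)
  rw [← Lp.norm_def] at h3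
  refine le_trans (le_of_eq ?_) h3
  rw [integral_norm_eq_lintegral_enorm hf.1.restrict, eLpNorm_one_eq_lintegral_enorm]

/-- The Sobolev bound `sup |u| ≤ ‖u‖_{L²} + ‖u'‖_{L²}`, for the continuous representative of `u`. -/
theorem norm_primitive_le [CompleteSpace F] {u g : Lp F 2 (volume : Measure ℝ)} {C : F}
    (hC : (u : ℝ → F) =ᵐ[volume] fun x => C + ∫ t in (0 : ℝ)..x, g t) (x : ℝ) :
    ‖C + ∫ t in (0 : ℝ)..x, g t‖ ≤ ‖u‖ + ‖g‖ := by
  have hg : LocallyIntegrable (g : ℝ → F) := (Lp.memLp g).locallyIntegrable (by norm_num)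
  have hu : LocallyIntegrable (u : ℝ → F) := (Lp.memLp u).locallyIntegrable (by norm_num)
  set U : ℝ → F := fun x => C + ∫ t in (0 : ℝ)..x, g t with hU
  have hcont : Continuous U := continuous_primitive' hg C
  have hgI : IntegrableOn (fun t => ‖g t‖) (Set.Ioc x (x + 1)) :=
    ((hg.integrableOn_isCompact isCompact_Icc).mono_set Set.Ioc_subset_Icc_self).norm
  have key : ∀ y ∈ Set.Ioc x (x + 1), ‖U x‖ ≤ ‖U y‖ + ‖g‖ := by
    intro y hy
    have e : U x = U y - ∫ t in x..y, g t := by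
      simp only [hU]
      rw [← intervalIntegral.integral_add_adjacent_intervals (hg.intervalIntegrable' 0 x)
        (hg.intervalIntegrable' x y)]
      abel
    rw [e]
    refine (norm_sub_le _ _).trans (add_le_add_right ?_ _)
    refine (intervalIntegral.norm_integral_le_integral_norm hy.1.le).trans ?_
    rw [intervalIntegral.integral_of_le hy.1.le]
    refine le_trans ?_ (integral_Ioc_norm_le g x)
    exact setIntegral_mono_set hgI (ae_of_all _ fun _ => norm_nonneg _)
      (Set.Ioc_subset_Ioc_right hy.2).eventuallyLE
  have hUI : IntegrableOn (fun t => ‖U t‖) (Set.Ioc x (x + 1)) :=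
    (hcont.norm.continuousOn.integrableOn_Icc).mono_set Set.Ioc_subset_Icc_self
  have h1 : ∫ _ in Set.Ioc x (x + 1), ‖U x‖ ≤ ∫ y in Set.Ioc x (x + 1), (‖U y‖ + ‖g‖) :=
    setIntegral_mono_on (by simp) (hUI.add (by simp)) measurableSet_Ioc key
  rw [integral_add hUI (by simp)] at h1
  simp only [integral_const, MeasurableSet.univ, measureReal_restrict_apply, Set.univ_inter,
    Real.volume_real_Ioc, add_sub_cancel_left, zero_le_one, sup_of_le_left, one_smul] at h1
  refine h1.trans (add_le_add_left (le_trans (le_of_eq ?_) (integral_Ioc_norm_le u x)) _)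
  refine setIntegral_congr_ae measurableSet_Ioc ?_
  filter_upwards [hC] with y hy _
  rw [hy]

end WeakDerivLine

/-! ### Real and complex vectors -/

theorem norm_toC (v : RVec n) : ‖toC v‖ = ‖v‖ := by
  simp [toC, EuclideanSpace.norm_eq]

theorem norm_conjV (z : CVec n) : ‖conjV z‖ = ‖z‖ := by
  simp [conjV, EuclideanSpace.norm_eq]

theorem norm_reV_le (z : CVec n) : ‖reV z‖ ≤ ‖z‖ := by
  simp only [reV, EuclideanSpace.norm_eq]
  gcongr with i
  exact Complex.abs_re_le_norm _

theorem norm_imV_le (z : CVec n) : ‖imV z‖ ≤ ‖z‖ := by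
  simp only [imV, EuclideanSpace.norm_eq]
  gcongr with i
  exact Complex.abs_im_le_norm _

/-- `toC` as a continuous linear map. -/
def toCL (n : ℕ) : RVec n →L[ℝ] CVec n :=
  LinearMap.mkContinuous
    { toFun := toC
      map_add' := fun x y => by ext i; simp [toC]
      map_smul' := fun a x => by ext i; simp [toC] } 1 fun x => by
    simpa using (norm_toC x).le

/-- `reV` as a continuous linear map. -/
def reVL (n : ℕ) : CVec n →L[ℝ] RVec n :=
  LinearMap.mkContinuous
    { toFun := reV
      map_add' := fun x y => by ext i; simp [reV]
      map_smul' := fun a x => by ext i; simp [reV] } 1 fun x => by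
    simpa using norm_reV_le x

/-- `imV` as a continuous linear map. -/
def imVL (n : ℕ) : CVec n →L[ℝ] RVec n :=
  LinearMap.mkContinuous
    { toFun := imV
      map_add' := fun x y => by ext i; simp [imV]
      map_smul' := fun a x => by ext i; simp [imV] } 1 fun x => by
    simpa using norm_imV_le x

/-- `conjV` as a continuous real-linear map. -/
def conjVL (n : ℕ) : CVec n →L[ℝ] CVec n :=
  LinearMap.mkContinuous
    { toFun := conjV
      map_add' := fun x y => by ext i; simp [conjV]
      map_smul' := fun a x => by ext i; simp [conjV] } 1 fun x => by
    simpa using (norm_conjV x).le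

theorem toCL_apply (v : RVec n) : toCL n v = toC v := rfl

theorem conjVL_apply (z : CVec n) : conjVL n z = conjV z := rfl

theorem conjV_conjV (z : CVec n) : conjV (conjV z) = z := by
  ext i; simp [conjV]

theorem conjV_smul (a : ℂ) (z : CVec n) : conjV (a • z) = starRingEnd ℂ a • conjV z := by
  ext i; simp [conjV]

theorem conjV_toC (v : RVec n) : conjV (toC v) = toC v := by
  ext i; simp [conjV, toC]

theorem norm_complexAct_le (L : RVec n →L[ℝ] RVec n) (z : CVec n) :
    ‖complexAct L z‖ ≤ 2 * ‖L‖ * ‖z‖ := by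
  refine (norm_add_le _ _).trans ?_
  rw [norm_smul, norm_toC, norm_toC, Complex.norm_I, one_mul]
  have h1 := (L.le_opNorm (reV z)).trans
    (mul_le_mul_of_nonneg_left (norm_reV_le z) (norm_nonneg L))
  have h2 := (L.le_opNorm (imV z)).trans
    (mul_le_mul_of_nonneg_left (norm_imV_le z) (norm_nonneg L))
  linarith

/-- The action of real matrices on `ℂⁿ`, as a continuous bilinear map. -/
def complexActL (n : ℕ) : (RVec n →L[ℝ] RVec n) →L[ℝ] CVec n →L[ℝ] CVec n :=
  LinearMap.mkContinuous₂
    (LinearMap.mk₂ ℝ complexAct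
      (fun L M z => by ext i; simp [complexAct, toC]; ring)
      (fun a L z => by ext i; simp [complexAct, toC]; ring)
      (fun L z w => by
        have e1 : reV (z + w) = reV z + reV w := (reVL n).map_add z w
        have e2 : imV (z + w) = imV z + imV w := (imVL n).map_add z w
        ext i; simp [complexAct, toC, e1, e2]; ring)
      (fun a L z => by
        have e1 : reV (a • z) = a • reV z := (reVL n).map_smul a z
        have e2 : imV (a • z) = a • imV z := (imVL n).map_smul a z
        ext i; simp [complexAct, toC, e1, e2]; ring)) 2 fun L z => by
    exact norm_complexAct_le L z

theorem conjV_complexAct (L : RVec n →L[ℝ] RVec n) (z : CVec n) :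
    conjV (complexAct L z) = complexAct L (conjV z) := by
  have e1 : reV (conjV z) = reV z := by ext i; simp [reV, conjV]
  have e2 : imV (conjV z) = - imV z := by ext i; simp [imV, conjV]
  unfold complexAct
  rw [e1, e2, map_neg]
  ext i
  simp [conjV, toC]

/-! ### Pairing square-integrable functions with test functions -/

section Pairing

variable {α F : Type*} [MeasurableSpace α] {μ : Measure α} [NormedAddCommGroup F] [NormedSpace ℝ F]
  [CompleteSpace F]

/-- The `F`-valued map `f ↦ ∫ ψ f` on `L²`, for a square-integrable `ψ`. -/
def pairL2 {ψ : α → ℝ} (hψ : MemLp ψ 2 μ) : Lp F 2 μ →L[ℝ] F :=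
  (ContinuousLinearMap.lsmul ℝ ℝ).lpPairing μ 2 2 (hψ.toLp ψ)

theorem pairL2_apply {ψ : α → ℝ} (hψ : MemLp ψ 2 μ) (f : Lp F 2 μ) :
    pairL2 hψ f = ∫ x, ψ x • f x ∂μ := by
  rw [pairL2, ContinuousLinearMap.lpPairing_eq_integral]
  refine integral_congr_ae ?_
  filter_upwards [hψ.coeFn_toLp] with x hx
  rw [hx]
  rfl

end Pairing

theorem hasWeakDeriv_lp_iff {F : Type*} [NormedAddCommGroup F] [NormedSpace ℝ F] [CompleteSpace F]
    {u g : Lp F 2 (volume : Measure ℝ)} : HasWeakDeriv (u : ℝ → F) g ↔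
      ∀ φ : ℝ → ℝ, ContDiff ℝ ∞ φ → HasCompactSupport φ →
        ∫ x, deriv φ x • u x = - ∫ x, φ x • g x :=
  ⟨fun h => h.2.2, fun h => ⟨(Lp.memLp u).locallyIntegrable (by norm_num),
    (Lp.memLp g).locallyIntegrable (by norm_num), h⟩⟩

/-- Weak differentiability on the line is preserved by convergence in `L²`. -/
theorem isClosed_hasWeakDeriv {F : Type*} [NormedAddCommGroup F] [NormedSpace ℝ F]
    [CompleteSpace F] :
    IsClosed {p : Lp F 2 (volume : Measure ℝ) × Lp F 2 (volume : Measure ℝ) |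
      HasWeakDeriv (p.1 : ℝ → F) p.2} := by
  have : {p : Lp F 2 (volume : Measure ℝ) × Lp F 2 (volume : Measure ℝ) |
      HasWeakDeriv (p.1 : ℝ → F) p.2} = ⋂ (φ : ℝ → ℝ) (_ : ContDiff ℝ ∞ φ)
        (_ : HasCompactSupport φ), {p | ∫ x, deriv φ x • p.1 x = - ∫ x, φ x • p.2 x} := by
    ext p
    simp [hasWeakDeriv_lp_iff]
  rw [this]
  refine isClosed_iInter fun φ => isClosed_iInter fun h1 => isClosed_iInter fun h2 => ?_
  have m1 : MemLp (deriv φ) 2 (volume : Measure ℝ) :=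
    (h1.continuous_deriv (by simp)).memLp_of_hasCompactSupport h2.deriv
  have m2 : MemLp φ 2 (volume : Measure ℝ) := h1.continuous.memLp_of_hasCompactSupport h2
  simp only [← pairL2_apply m1, ← pairL2_apply m2]
  exact isClosed_eq ((pairL2 m1).continuous.comp continuous_fst)
    ((pairL2 m2).continuous.comp continuous_snd).neg

/-! ### The space `H²(ℝ; ℂⁿ)` -/

theorem isClosed_H2LineSub (n : ℕ) :
    IsClosed (H2LineSub n : Set (PiLp 2 fun _ : Fin 3 => L2Line n)) := by
  have h : ∀ i j : Fin 3, IsClosed {U : PiLp 2 fun _ : Fin 3 => L2Line n |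
      HasWeakDeriv (U i : ℝ → CVec n) (U j)} := fun i j =>
    isClosed_hasWeakDeriv.preimage
      ((PiLp.continuous_apply 2 (fun _ : Fin 3 => L2Line n) i).prodMk
        (PiLp.continuous_apply 2 (fun _ : Fin 3 => L2Line n) j))
  exact (h 0 1).inter (h 1 2)

instance completeSpace_H2Line (n : ℕ) : CompleteSpace (H2Line n) :=
  (isClosed_H2LineSub n).completeSpace_coe

namespace H2Line

theorem hasWeakDeriv_fn (U : H2Line n) : HasWeakDeriv (U.fn : ℝ → CVec n) U.d1 := U.2.1

theorem hasWeakDeriv_d1 (U : H2Line n) : HasWeakDeriv (U.d1 : ℝ → CVec n) U.d2 := U.2.2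

theorem norm_sq_eq (U : H2Line n) : ‖U‖ ^ 2 = ‖U.fn‖ ^ 2 + ‖U.d1‖ ^ 2 + ‖U.d2‖ ^ 2 := by
  change ‖U.1‖ ^ 2 = _
  rw [PiLp.norm_sq_eq_of_L2, Fin.sum_univ_three]
  rfl

/-- An element of `H²` built from three `L²` functions. -/
def mk' (u u' u'' : L2Line n) (h1 : HasWeakDeriv (u : ℝ → CVec n) u')
    (h2 : HasWeakDeriv (u' : ℝ → CVec n) u'') : H2Line n :=
  ⟨WithLp.toLp 2 ![u, u', u''], h1, h2⟩

theorem ext_fn {U V : H2Line n} (h : U.fn = V.fn) : U = V := by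
  have h1 : U.d1 = V.d1 := by
    have := V.hasWeakDeriv_fn
    rw [← h] at this
    exact Lp.ext (U.hasWeakDeriv_fn.unique this)
  have h2 : U.d2 = V.d2 := by
    have := V.hasWeakDeriv_d1
    rw [← h1] at this
    exact Lp.ext (U.hasWeakDeriv_d1.unique this)
  refine Subtype.ext (PiLp.ext fun i => ?_)
  fin_cases i
  exacts [h, h1, h2]

/-- The function, its first and its second derivative, for `i = 0, 1, 2`, as continuous linear maps
on `H²`. -/
def component (n : ℕ) (i : Fin 3) : H2Line n →L[ℝ] L2Line n :=
  ((PiLp.proj 2 (fun _ : Fin 3 => L2Line n) i).comp (H2LineSub n).subtypeL).restrictScalars ℝ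

/-- Elements of `H²(ℝ)` have a `C¹` representative, bounded by the `H¹` norm. -/
theorem exists_rep (U : H2Line n) : ∃ u u' : ℝ → CVec n, Continuous u' ∧
    (∀ x, HasDerivAt u (u' x) x) ∧ (U.fn : ℝ → CVec n) =ᵐ[volume] u ∧
    (U.d1 : ℝ → CVec n) =ᵐ[volume] u' ∧ ∀ x, ‖u x‖ ≤ ‖U.fn‖ + ‖U.d1‖ := by
  obtain ⟨C, hC⟩ := U.hasWeakDeriv_fn.ae_eq_primitive
  obtain ⟨D, hD⟩ := U.hasWeakDeriv_d1.ae_eq_primitive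
  have hc := continuous_primitive' U.hasWeakDeriv_d1.2.1 D
  refine ⟨_, _, hc, fun x => ?_, hC, hD, norm_primitive_le hC⟩
  have e : (fun x => C + ∫ t in (0 : ℝ)..x, U.d1 t) =
      fun x => C + ∫ t in (0 : ℝ)..x, (D + ∫ s in (0 : ℝ)..t, U.d2 s) := by
    funext y
    congr 1
    refine intervalIntegral.integral_congr_ae ?_
    filter_upwards [hD] with t ht _
    exact ht
  rw [e]
  exact (intervalIntegral.integral_hasDerivAt_right (hc.intervalIntegrable _ _)
    (hc.stronglyMeasurableAtFilter _ _) hc.continuousAt).const_add C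

/-- The continuously differentiable representative of an `H²` function. -/
def rep (U : H2Line n) : ℝ → CVec n := U.exists_rep.choose

/-- The continuous representative of the derivative of an `H²` function. -/
def rep' (U : H2Line n) : ℝ → CVec n := U.exists_rep.choose_spec.choose

theorem continuous_rep' (U : H2Line n) : Continuous U.rep' :=
  U.exists_rep.choose_spec.choose_spec.1

theorem hasDerivAt_rep (U : H2Line n) (x : ℝ) : HasDerivAt U.rep (U.rep' x) x :=
  U.exists_rep.choose_spec.choose_spec.2.1 x

theorem continuous_rep (U : H2Line n) : Continuous U.rep :=
  continuous_iff_continuousAt.2 fun x => (U.hasDerivAt_rep x).continuousAt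

theorem fn_ae_eq (U : H2Line n) : (U.fn : ℝ → CVec n) =ᵐ[volume] U.rep :=
  U.exists_rep.choose_spec.choose_spec.2.2.1

theorem d1_ae_eq (U : H2Line n) : (U.d1 : ℝ → CVec n) =ᵐ[volume] U.rep' :=
  U.exists_rep.choose_spec.choose_spec.2.2.2.1

theorem norm_rep_le (U : H2Line n) (x : ℝ) : ‖U.rep x‖ ≤ ‖U.fn‖ + ‖U.d1‖ :=
  U.exists_rep.choose_spec.choose_spec.2.2.2.2 x

/-- Integration by parts: `Re ⟨u, u''⟩ = -‖u'‖²`. -/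
theorem re_inner_fn_d2 (U : H2Line n) :
    RCLike.re (inner ℂ U.fn U.d2) = - ‖U.d1‖ ^ 2 := by
  let reC : Fin n → CVec n →L[ℝ] ℝ := fun i =>
    Complex.reCLM.comp ((EuclideanSpace.proj i : CVec n →L[ℂ] ℂ).restrictScalars ℝ)
  let imC : Fin n → CVec n →L[ℝ] ℝ := fun i =>
    Complex.imCLM.comp ((EuclideanSpace.proj i : CVec n →L[ℂ] ℂ).restrictScalars ℝ)
  have mem : ∀ (L : CVec n →L[ℝ] ℝ) (V : L2Line n), MemLp (fun x => L (V x)) 2 volume :=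
    fun L V => L.comp_memLp' (Lp.memLp V)
  have hcomp : ∀ V W : L2Line n, RCLike.re (inner ℂ V W) =
      ∑ i : Fin n, ((∫ x, reC i (V x) * reC i (W x)) + ∫ x, imC i (V x) * imC i (W x)) := by
    intro V W
    rw [L2.inner_def, ← integral_re (L2.integrable_inner V W)]
    have : ∀ x, RCLike.re (inner ℂ (V x) (W x)) = ∑ i : Fin n, (reC i (V x) * reC i (W x)
        + imC i (V x) * imC i (W x)) := by
      intro x
      rw [PiLp.inner_apply, map_sum]
      refine Finset.sum_congr rfl fun i _ => ?_
      simp [reC, imC]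
      ring
    simp only [this]
    rw [integral_finsetSum]
    · refine Finset.sum_congr rfl fun i _ => ?_
      rw [integral_add]
      · exact (mem (reC i) V).integrable_mul (mem (reC i) W)
      · exact (mem (imC i) V).integrable_mul (mem (imC i) W)
    · intro i _
      exact ((mem (reC i) V).integrable_mul (mem (reC i) W)).add
        ((mem (imC i) V).integrable_mul (mem (imC i) W))
  have ibp : ∀ L : CVec n →L[ℝ] ℝ, ∫ x, L (U.fn x) * L (U.d2 x) = - ∫ x, L (U.d1 x) * L (U.d1 x) :=
    fun L => integral_mul_weakDeriv (mem L _) (mem L _) (mem L _) (mem L _)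
      (U.hasWeakDeriv_fn.clm_comp L) (U.hasWeakDeriv_d1.clm_comp L)
  rw [← inner_self_eq_norm_sq (𝕜 := ℂ), hcomp, hcomp, ← Finset.sum_neg_distrib]
  refine Finset.sum_congr rfl fun i _ => ?_
  rw [ibp, ibp]
  ring

/-- The energy identity `‖k²u - u''‖² = k⁴‖u‖² + 2k²‖u'‖² + ‖u''‖²`. -/
theorem norm_sq_smul_fn_sub_d2 (U : H2Line n) (k : ℝ) :
    ‖((k : ℂ) ^ 2) • U.fn - U.d2‖ ^ 2 =
      k ^ 4 * ‖U.fn‖ ^ 2 + 2 * k ^ 2 * ‖U.d1‖ ^ 2 + ‖U.d2‖ ^ 2 := by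
  rw [norm_sub_sq (𝕜 := ℂ), inner_smul_left, norm_smul]
  have : starRingEnd ℂ ((k : ℂ) ^ 2) = ((k ^ 2 : ℝ) : ℂ) := by simp
  rw [this]
  have h2 : RCLike.re (((k ^ 2 : ℝ) : ℂ) * inner ℂ U.fn U.d2)
      = k ^ 2 * RCLike.re (inner ℂ U.fn U.d2) := by
    exact Complex.re_ofReal_mul _ _
  rw [h2, re_inner_fn_d2]
  have : ‖(k : ℂ) ^ 2‖ = k ^ 2 := by simp
  rw [this]
  ring

end H2Line

/-! ### Multiplication operators -/

/-- Multiplication of `L²` functions by a bounded continuous matrix-valued function. -/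
def mulOp (M : C(ℝ, RVec n →L[ℝ] RVec n)) {a : ℝ} (ha : ∀ x, ‖M x‖ ≤ a) :
    L2Line n →L[ℝ] L2Line n :=
  (complexActL n).holderL volume ⊤ 2 2
    ((memLp_top_of_bound M.continuous.aestronglyMeasurable a (ae_of_all _ ha)).toLp M)

theorem coeFn_mulOp (M : C(ℝ, RVec n →L[ℝ] RVec n)) {a : ℝ} (ha : ∀ x, ‖M x‖ ≤ a)
    (u : L2Line n) : mulOp M ha u =ᵐ[volume] fun x => complexAct (M x) (u x) := by
  rw [mulOp, ContinuousLinearMap.holderL_apply_apply]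
  have hm := (memLp_top_of_bound (μ := volume) M.continuous.aestronglyMeasurable a (ae_of_all _ ha))
  filter_upwards [(complexActL n).coeFn_holder (r := 2) (hm.toLp M) u, hm.coeFn_toLp] with x h1 h2
  rw [h1, h2]
  rfl

theorem norm_mulOp_le (M : C(ℝ, RVec n →L[ℝ] RVec n)) {a : ℝ} (ha : ∀ x, ‖M x‖ ≤ a)
    (u : L2Line n) : ‖mulOp M ha u‖ ≤ 2 * a * ‖u‖ := by
  refine Lp.norm_le_mul_norm_of_ae_le_mul ?_
  filter_upwards [coeFn_mulOp M ha u] with x hx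
  rw [hx]
  refine (norm_complexAct_le _ _).trans ?_
  have := ha x
  gcongr

/-! ### The operators `ℒ_k` -/

/-- Coefficients of the operators `ℒ_k`: matrix functions `A ∈ C¹` and `B ∈ C⁰`, with `A`, `A'` and
`B` bounded by `a`. -/
structure IsCoefBound (A A' B : C(ℝ, RVec n →L[ℝ] RVec n)) (a : ℝ) : Prop where
  hasDerivAt : ∀ x, HasDerivAt A (A' x) x
  bound : ∀ x, ‖A x‖ ≤ a
  bound' : ∀ x, ‖A' x‖ ≤ a
  boundB : ∀ x, ‖B x‖ ≤ a

/-- The `k`-th summand of the norm of `M`, for a single `H²` function. -/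
def modeNormSq (k : ℤ) (U : H2Line n) : ℝ :=
  max ((k : ℝ) ^ 4) 1 * ‖U.fn‖ ^ 2 + max ((k : ℝ) ^ 2) 1 * ‖U.d1‖ ^ 2 + ‖U.d2‖ ^ 2

theorem mTerm_eq (w : ℤ → H2Line n) (k : ℤ) : mTerm w k = modeNormSq k (w k) := rfl

theorem max_sq_le_max_pow_four (k : ℝ) : max (k ^ 2) 1 ≤ max (k ^ 4) 1 := by
  refine max_le ?_ (le_max_right _ _)
  rcases le_total (k ^ 2) 1 with h | h
  · exact h.trans (le_max_right _ _)
  · exact le_trans (by nlinarith) (le_max_left _ _)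

theorem modeNormSq_le (k : ℤ) (U : H2Line n) :
    modeNormSq k U ≤ max ((k : ℝ) ^ 4) 1 * ‖U‖ ^ 2 := by
  rw [U.norm_sq_eq, modeNormSq]
  have h1 := mul_le_mul_of_nonneg_right (max_sq_le_max_pow_four k) (sq_nonneg ‖U.d1‖)
  have h2 := mul_le_mul_of_nonneg_right (le_max_right ((k : ℝ) ^ 4) 1) (sq_nonneg ‖U.d2‖)
  linarith

/-- Absorption of the first order terms: here `x`, `y`, `z` stand for the norms of `u`, `u'`, `u''`,
`t` for `|k|`, `m` for the norm of the first order part and `H` for that of `ℒ_k u`. -/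
theorem energy_aux {x y z m a t H : ℝ} (hm : 0 ≤ m) (ht : 1 ≤ t ^ 2)
    (hta : 144 * a ^ 2 ≤ t ^ 2) (h1 : m ≤ 2 * a * (x + y + t * x))
    (h2 : t ^ 4 * x ^ 2 + 2 * t ^ 2 * y ^ 2 + z ^ 2 ≤ 2 * H ^ 2 + 2 * m ^ 2) :
    t ^ 4 * x ^ 2 + t ^ 2 * y ^ 2 + z ^ 2 ≤ 4 * H ^ 2 := by
  have k1 : m ^ 2 ≤ (2 * a * (x + y + t * x)) ^ 2 := pow_le_pow_left₀ hm h1 2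
  have k2 : (x + y + t * x) ^ 2 ≤ 3 * (x ^ 2 + y ^ 2 + t ^ 2 * x ^ 2) := by
    linarith [sq_nonneg (x - y), sq_nonneg (x - t * x), sq_nonneg (y - t * x)]
  have k3 : m ^ 2 ≤ 12 * a ^ 2 * (x ^ 2 + y ^ 2 + t ^ 2 * x ^ 2) := by
    refine k1.trans ?_
    have := mul_le_mul_of_nonneg_left k2 (sq_nonneg (2 * a))
    linarith
  have k4 := mul_le_mul_of_nonneg_right hta (by positivity : 0 ≤ x ^ 2 + y ^ 2 + t ^ 2 * x ^ 2)
  have k5 : 0 ≤ (t ^ 2 - 1) * (t ^ 2 * x ^ 2) :=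
    mul_nonneg (by linarith) (by positivity)
  have k6 : 0 ≤ t ^ 2 * y ^ 2 := by positivity
  have k7 : 0 ≤ z ^ 2 := sq_nonneg z
  have k8 : 0 ≤ t ^ 4 * x ^ 2 := by positivity
  linarith

namespace IsCoefBound

variable {A A' B : C(ℝ, RVec n →L[ℝ] RVec n)} {a : ℝ}

theorem nonneg (hc : IsCoefBound A A' B a) : 0 ≤ a := (norm_nonneg _).trans (hc.bound 0)

/-- The first order part `(A U)' + i k B U` of `ℒ_k U`. -/
def lower (hc : IsCoefBound A A' B a) (k : ℤ) : H2Line n →L[ℝ] L2Line n :=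
  (mulOp A' hc.bound').comp (H2Line.component n 0) + (mulOp A hc.bound).comp (H2Line.component n 1)
    + (Complex.I * (k : ℂ)) • (mulOp B hc.boundB).comp (H2Line.component n 0)

/-- `ℒ_k : H²(ℝ; ℂⁿ) → L²(ℝ; ℂⁿ)` as a bounded operator. -/
def op (hc : IsCoefBound A A' B a) (k : ℤ) : H2Line n →L[ℝ] L2Line n :=
  hc.lower k + (((k : ℂ) ^ 2) • H2Line.component n 0 - H2Line.component n 2)

theorem lower_apply (hc : IsCoefBound A A' B a) (k : ℤ) (U : H2Line n) :
    hc.lower k U = mulOp A' hc.bound' U.fn + mulOp A hc.bound U.d1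
      + (Complex.I * (k : ℂ)) • mulOp B hc.boundB U.fn := rfl

theorem op_apply (hc : IsCoefBound A A' B a) (k : ℤ) (U : H2Line n) :
    hc.op k U = hc.lower k U + (((k : ℂ) ^ 2) • U.fn - U.d2) := rfl

theorem hasWeakDeriv_mul (hc : IsCoefBound A A' B a) (U : H2Line n) :
    HasWeakDeriv (fun x => complexAct (A x) (U.fn x))
      (mulOp A' hc.bound' U.fn + mulOp A hc.bound U.d1 : L2Line n) := by
  have hd : ∀ x, HasDerivAt (fun x => complexActL n (A x) (U.rep x))
      (complexActL n (A' x) (U.rep x) + complexActL n (A x) (U.rep' x)) x := fun x =>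
    ((complexActL n).hasFDerivAt.comp_hasDerivAt x (hc.hasDerivAt x)).clm_apply (U.hasDerivAt_rep x)
  have hcont : Continuous fun x =>
      complexActL n (A' x) (U.rep x) + complexActL n (A x) (U.rep' x) :=
    (((complexActL n).continuous.comp A'.continuous).clm_apply U.continuous_rep).add
      (((complexActL n).continuous.comp A.continuous).clm_apply U.continuous_rep')
  refine (hasWeakDeriv_of_hasDerivAt hd hcont).congr ?_ ?_
  · filter_upwards [U.fn_ae_eq] with x hx
    rw [hx]
    rfl
  · filter_upwards [U.fn_ae_eq, U.d1_ae_eq, Lp.coeFn_add (mulOp A' hc.bound' U.fn)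
      (mulOp A hc.bound U.d1), coeFn_mulOp A' hc.bound' U.fn, coeFn_mulOp A hc.bound U.d1]
      with x h1 h2 h3 h4 h5
    rw [h3, Pi.add_apply, h4, h5, h1, h2]
    rfl

/-- The graph `IsLk` is that of the operator `op k`, by uniqueness of weak derivatives. -/
theorem isLk_iff (hc : IsCoefBound A A' B a) {f₁ f₂ : RVec n → RVec n} {c : ℝ} {ubar : ℝ → RVec n}
    (hA : ∀ x, A x = coefA f₁ c ubar x) (hB : ∀ x, B x = coefB f₂ ubar x) (k : ℤ) (U : H2Line n)
    (h : ℝ → CVec n) :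
    IsLk f₁ f₂ c ubar k U h ↔ h =ᵐ[volume] hc.op k U := by
  have hw := hc.hasWeakDeriv_mul U
  simp only [hA] at hw
  have hop : (hc.op k U : ℝ → CVec n) =ᵐ[volume] fun x =>
      (mulOp A' hc.bound' U.fn + mulOp A hc.bound U.d1 : L2Line n) x
        + (Complex.I * (k : ℂ)) • complexAct (coefB f₂ ubar x) (U.fn x)
        + ((k : ℂ) ^ 2) • U.fn x - U.d2 x := by
    rw [op_apply, lower_apply]
    filter_upwards [Lp.coeFn_add (mulOp A' hc.bound' U.fn + mulOp A hc.bound U.d1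
      + (Complex.I * (k : ℂ)) • mulOp B hc.boundB U.fn) (((k : ℂ) ^ 2) • U.fn - U.d2),
      Lp.coeFn_add (mulOp A' hc.bound' U.fn + mulOp A hc.bound U.d1)
        ((Complex.I * (k : ℂ)) • mulOp B hc.boundB U.fn),
      Lp.coeFn_sub (((k : ℂ) ^ 2) • U.fn) U.d2, Lp.coeFn_smul ((k : ℂ) ^ 2) U.fn,
      Lp.coeFn_smul (Complex.I * (k : ℂ)) (mulOp B hc.boundB U.fn),
      coeFn_mulOp B hc.boundB U.fn] with x h1 h2 h3 h4 h5 h6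
    rw [h1, Pi.add_apply, h2, Pi.add_apply, h3, Pi.sub_apply, h4, h5, Pi.smul_apply, Pi.smul_apply,
      h6, hB]
    abel
  constructor
  · rintro ⟨g, hg, he⟩
    have hgu := hg.unique hw
    filter_upwards [he, hgu, hop] with x h1 h2 h3
    rw [h1, h3, h2]
  · intro he
    refine ⟨_, hw, ?_⟩
    filter_upwards [he, hop] with x h1 h2
    rw [h1, h2]

theorem norm_lower_le (hc : IsCoefBound A A' B a) (k : ℤ) (U : H2Line n) :
    ‖hc.lower k U‖ ≤ 2 * a * (‖U.fn‖ + ‖U.d1‖ + |(k : ℝ)| * ‖U.fn‖) := by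
  rw [lower_apply]
  refine (norm_add₃_le).trans ?_
  rw [norm_smul]
  have e : ‖Complex.I * (k : ℂ)‖ = |(k : ℝ)| := by simp
  rw [e]
  have h1 := norm_mulOp_le A' hc.bound' U.fn
  have h2 := norm_mulOp_le A hc.bound U.d1
  have h3 := mul_le_mul_of_nonneg_left (norm_mulOp_le B hc.boundB U.fn) (abs_nonneg (k : ℝ))
  linarith

/-- The energy estimate: for large `|k|`, `ℒ_k` is dominated by `k² - ∂ₓ²`. -/
theorem modeNormSq_le_of_large (hc : IsCoefBound A A' B a) (k : ℤ) (hk : 1 ≤ (k : ℝ) ^ 2)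
    (hka : 144 * a ^ 2 ≤ (k : ℝ) ^ 2) (U : H2Line n) :
    modeNormSq k U ≤ 4 * ‖hc.op k U‖ ^ 2 := by
  have e1 : ((k : ℂ) ^ 2) • U.fn - U.d2 = hc.op k U - hc.lower k U := by
    rw [op_apply]; abel
  have e2 := U.norm_sq_smul_fn_sub_d2 k
  simp only [Complex.ofReal_intCast] at e2
  rw [e1] at e2
  have h4 : 1 ≤ (k : ℝ) ^ 4 := by
    have := one_le_pow₀ hk (n := 2)
    rwa [← pow_mul] at this
  have h1 : ‖hc.op k U - hc.lower k U‖ ^ 2 ≤ 2 * ‖hc.op k U‖ ^ 2 + 2 * ‖hc.lower k U‖ ^ 2 := by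
    rw [sub_eq_add_neg, ← norm_neg (hc.lower k U)]
    exact sq_norm_add_le _ _
  have h2 := hc.norm_lower_le k U
  rw [e2] at h1
  rw [modeNormSq, max_eq_left h4, max_eq_left hk]
  rw [← sq_abs (k : ℝ)] at hk hka
  have e3 : (k : ℝ) ^ 4 = |(k : ℝ)| ^ 4 := by rw [Even.pow_abs (by decide)]
  rw [e3, ← sq_abs (k : ℝ)] at h1 ⊢
  exact energy_aux (norm_nonneg _) hk hka h2 h1

theorem op_bijective (hc : IsCoefBound A A' B a) {f₁ f₂ : RVec n → RVec n} {c : ℝ}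
    {ubar : ℝ → RVec n} (hA : ∀ x, A x = coefA f₁ c ubar x) (hB : ∀ x, B x = coefB f₂ ubar x)
    {k : ℤ} (hk : LkInvertible f₁ f₂ c ubar k) : Function.Bijective (hc.op k) := by
  rw [Function.bijective_iff_existsUnique]
  intro h
  obtain ⟨U, hU, hu⟩ := hk h
  refine ⟨U, (Lp.ext ((hc.isLk_iff hA hB k U h).1 hU)).symm, fun V hV => hu V ?_⟩
  refine (hc.isLk_iff hA hB k V h).2 ?_
  rw [show hc.op k V = h from hV]

/-- The bounded inverse theorem, for one mode. -/
theorem exists_modeNormSq_le (hc : IsCoefBound A A' B a) {k : ℤ}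
    (hk : Function.Bijective (hc.op k)) :
    ∃ C : ℝ, 0 ≤ C ∧ ∀ U, modeNormSq k U ≤ C * ‖hc.op k U‖ ^ 2 := by
  let e := ContinuousLinearEquiv.ofBijective (hc.op k) (LinearMap.ker_eq_bot.2 hk.1)
    (LinearMap.range_eq_top.2 hk.2)
  let S : L2Line n →L[ℝ] H2Line n := e.symm.toContinuousLinearMap
  refine ⟨max ((k : ℝ) ^ 4) 1 * ‖S‖ ^ 2, by positivity, fun U => (modeNormSq_le k U).trans ?_⟩
  have h1 : U = S (hc.op k U) := (e.symm_apply_apply U).symm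
  have h2 : ‖U‖ ≤ ‖S‖ * ‖hc.op k U‖ := by
    conv_lhs => rw [h1]
    exact S.le_opNorm _
  rw [mul_assoc, ← mul_pow]
  gcongr

/-- The inverses of the operators `ℒ_k`, `k ∈ s`, are uniformly bounded from `L²` to `H²` with the
`k`-dependent norm of `M`. -/
theorem exists_uniform_bound (hc : IsCoefBound A A' B a) (s : Set ℤ)
    (hs : ∀ k ∈ s, Function.Bijective (hc.op k)) :
    ∃ C : ℝ, 0 ≤ C ∧ ∀ k ∈ s, ∀ U, modeNormSq k U ≤ C * ‖hc.op k U‖ ^ 2 := by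
  have h1 : ∀ k, ∃ C : ℝ, 0 ≤ C ∧ (k ∈ s → ∀ U, modeNormSq k U ≤ C * ‖hc.op k U‖ ^ 2) := by
    intro k
    by_cases hk : k ∈ s
    · obtain ⟨C, h0, h1⟩ := hc.exists_modeNormSq_le (hs k hk)
      exact ⟨C, h0, fun _ => h1⟩
    · exact ⟨0, le_rfl, fun h => (hk h).elim⟩
  choose C hC0 hC using h1
  obtain ⟨N, hN⟩ := exists_nat_ge (12 * a + 1)
  refine ⟨∑ k ∈ Finset.Icc (-(N : ℤ)) N, C k + 4, add_nonneg (Finset.sum_nonneg fun k _ => hC0 k)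
    (by norm_num), fun k hk U => ?_⟩
  by_cases hkN : k ∈ Finset.Icc (-(N : ℤ)) N
  · refine (hC k hk U).trans (mul_le_mul_of_nonneg_right ?_ (sq_nonneg _))
    have := Finset.single_le_sum (f := C) (fun k _ => hC0 k) hkN
    linarith
  · have habs : (N : ℝ) ≤ |(k : ℝ)| := by
      rw [Finset.mem_Icc, not_and_or, not_le, not_le] at hkN
      rcases hkN with h | h
      · have : (k : ℝ) < -(N : ℝ) := by exact_mod_cast h
        linarith [neg_le_abs (k : ℝ)]
      · have : (N : ℝ) < (k : ℝ) := by exact_mod_cast h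
        linarith [le_abs_self (k : ℝ)]
    have ha := hc.nonneg
    have hk1 : 1 ≤ (k : ℝ) ^ 2 := by
      rw [← sq_abs (k : ℝ)]
      nlinarith
    have hk2 : 144 * a ^ 2 ≤ (k : ℝ) ^ 2 := by
      rw [← sq_abs (k : ℝ)]
      nlinarith
    refine (hc.modeNormSq_le_of_large k hk1 hk2 U).trans
      (mul_le_mul_of_nonneg_right ?_ (sq_nonneg _))
    linarith [Finset.sum_nonneg (s := Finset.Icc (-(N : ℤ)) N) fun k _ => hC0 k]

end IsCoefBound

/-! ### Bounds for the shock profile -/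

theorem exists_norm_le_of_tendsto {E : Type*} [NormedAddCommGroup E] {u : ℝ → E} (hu : Continuous u)
    {l r : E} (hl : Tendsto u atBot (𝓝 l)) (hr : Tendsto u atTop (𝓝 r)) :
    ∃ C : ℝ, ∀ x, ‖u x‖ ≤ C := by
  have h1 : ∀ᶠ x in atBot, ‖u x‖ < ‖l‖ + 1 := hl.norm.eventually_lt_const (by linarith)
  have h2 : ∀ᶠ x in atTop, ‖u x‖ < ‖r‖ + 1 := hr.norm.eventually_lt_const (by linarith)
  obtain ⟨a, ha⟩ := eventually_atBot.1 h1
  obtain ⟨b, hb⟩ := eventually_atTop.1 h2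
  obtain ⟨C, hC⟩ := (isCompact_Icc (a := a) (b := b)).exists_bound_of_continuousOn hu.continuousOn
  refine ⟨max C (max (‖l‖ + 1) (‖r‖ + 1)), fun x => ?_⟩
  rcases le_total x a with h | h
  · exact (ha x h).le.trans ((le_max_left _ _).trans (le_max_right _ _))
  · rcases le_total b x with h' | h'
    · exact (hb x h').le.trans ((le_max_right _ _).trans (le_max_right _ _))
    · exact (hC x ⟨h, h'⟩).trans (le_max_left _ _)

theorem exists_bound_comp {E : Type*} [NormedAddCommGroup E] {g : RVec n → E}
    (hg : Continuous g) (C : ℝ) : ∃ D : ℝ, 0 ≤ D ∧ ∀ v, ‖v‖ ≤ C → ‖g v‖ ≤ D := by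
  obtain ⟨D, hD⟩ := (isCompact_closedBall (0 : RVec n) C).exists_bound_of_continuousOn
    hg.continuousOn
  exact ⟨max D 0, le_max_right _ _, fun v hv =>
    (hD v (mem_closedBall_zero_iff.2 hv)).trans (le_max_left _ _)⟩

namespace IsShockProfile

variable {f₁ : RVec n → RVec n} {c : ℝ} {ubar : ℝ → RVec n}

/-- The profile and its derivative are bounded; the bound on the derivative comes from integrating
the profile equation once. -/
theorem exists_bound (h : IsShockProfile f₁ c ubar) (hf : ContDiff ℝ 2 f₁) :
    ∃ C : ℝ, 0 ≤ C ∧ (∀ x, ‖ubar x‖ ≤ C) ∧ ∀ x, ‖deriv ubar x‖ ≤ C := by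
  obtain ⟨r, hr⟩ := h.limit_top
  obtain ⟨l, hl⟩ := h.limit_bot
  obtain ⟨C, hC⟩ := exists_norm_le_of_tendsto h.contDiff.continuous hl hr
  obtain ⟨D, hD0, hD⟩ := exists_bound_comp hf.continuous C
  have d0 : Differentiable ℝ ubar := h.contDiff.differentiable (by norm_num)
  have d1 : Differentiable ℝ (deriv ubar) :=
    (h.contDiff.iterate_deriv' 1 1).differentiable (by norm_num)
  have d2 : Differentiable ℝ fun s => f₁ (ubar s) - c • ubar s :=
    ((hf.differentiable (by norm_num)).comp d0).sub (d0.const_smul c)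
  have hconst := is_const_of_deriv_eq_zero (f := fun s => f₁ (ubar s) - c • ubar s - deriv ubar s)
    (d2.sub d1) (fun x => by
      rw [deriv_fun_sub (d2 x) (d1 x), h.profile x, sub_self])
  have key : ∀ x, ‖deriv ubar x‖ ≤
      D + |c| * C + ‖f₁ (ubar 0) - c • ubar 0 - deriv ubar 0‖ := by
    intro x
    have e : deriv ubar x = (f₁ (ubar x) - c • ubar x) -
        (f₁ (ubar 0) - c • ubar 0 - deriv ubar 0) := by
      rw [← hconst x 0]; abel
    rw [e]
    refine (norm_sub_le _ _).trans (add_le_add_left ((norm_sub_le _ _).trans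
      (add_le_add (hD _ (hC x)) ?_)) _)
    rw [norm_smul, Real.norm_eq_abs]
    exact mul_le_mul_of_nonneg_left (hC x) (abs_nonneg c)
  refine ⟨max C (D + |c| * C + ‖f₁ (ubar 0) - c • ubar 0 - deriv ubar 0‖), ?_,
    fun x => (hC x).trans (le_max_left _ _), fun x => (key x).trans (le_max_right _ _)⟩
  exact ((norm_nonneg _).trans (hC 0)).trans (le_max_left _ _)

theorem exists_coefBound (h : IsShockProfile f₁ c ubar) (hf : ContDiff ℝ 2 f₁)
    {f₂ : RVec n → RVec n} (hf₂ : ContDiff ℝ 2 f₂) :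
    ∃ (A A' B : C(ℝ, RVec n →L[ℝ] RVec n)) (a : ℝ), IsCoefBound A A' B a ∧
      (∀ x, A x = coefA f₁ c ubar x) ∧ ∀ x, B x = coefB f₂ ubar x := by
  obtain ⟨C, hC0, hC, hC'⟩ := h.exists_bound hf
  have d0 : Differentiable ℝ ubar := h.contDiff.differentiable (by norm_num)
  have cd1 : Continuous (deriv ubar) := h.contDiff.continuous_deriv (by norm_num)
  have k1 : ContDiff ℝ 1 (fderiv ℝ f₁) := hf.fderiv_right (by norm_num)
  have k2 : ContDiff ℝ 1 (fderiv ℝ f₂) := hf₂.fderiv_right (by norm_num)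
  have k3 : Continuous (fderiv ℝ (fderiv ℝ f₁)) := k1.continuous_fderiv (by norm_num)
  obtain ⟨D1, p1, q1⟩ := exists_bound_comp
    (k1.continuous.sub (continuous_const (y := c • ContinuousLinearMap.id ℝ (RVec n)))) C
  obtain ⟨D2, p2, q2⟩ := exists_bound_comp k2.continuous C
  obtain ⟨D3, p3, q3⟩ := exists_bound_comp (E := RVec n →L[ℝ] RVec n →L[ℝ] RVec n) k3 C
  refine ⟨⟨coefA f₁ c ubar, (k1.continuous.comp d0.continuous).sub continuous_const⟩,
    ⟨fun x => fderiv ℝ (fderiv ℝ f₁) (ubar x) (deriv ubar x),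
      (k3.comp d0.continuous).clm_apply cd1⟩,
    ⟨coefB f₂ ubar, k2.continuous.comp d0.continuous⟩, max D1 (max D2 (D3 * C)),
    ⟨fun x => ?_, fun x => ?_, fun x => ?_, fun x => ?_⟩, fun _ => rfl, fun _ => rfl⟩
  · exact (((k1.differentiable (by norm_num) (ubar x)).hasFDerivAt.comp_hasDerivAt x
      (d0 x).hasDerivAt).sub_const _)
  · exact (q1 _ (hC x)).trans (le_max_left _ _)
  · refine le_trans ((ContinuousLinearMap.le_opNorm _ _).trans
      (mul_le_mul (q3 _ (hC x)) (hC' x) (norm_nonneg _) p3)) ?_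
    exact (le_max_right _ _).trans (le_max_right _ _)
  · exact (q2 _ (hC x)).trans ((le_max_left _ _).trans (le_max_right _ _))

end IsShockProfile

/-! ### Fourier modes of functions on the strip -/

/-- `L²(Ω; ℂⁿ)`. -/
abbrev L2StripC (n : ℕ) : Type := Lp (CVec n) 2 (volume : Measure Strip)

/-- The Fourier mode of a complex-valued function on the strip. -/
def modeC (k : ℤ) (F : Strip → CVec n) : ℝ → CVec n :=
  fun x => fourierCoeff (fun y : Circ => F (x, y)) k

theorem ae_haarAddCircle_eq : ae (AddCircle.haarAddCircle : Measure Circ) = ae volume := by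
  rw [AddCircle.volume_eq_smul_haarAddCircle,
    Measure.ae_ennreal_smul_measure_eq (by simpa using Real.pi_pos)]

theorem volume_circ_eq : (volume : Measure Circ) =
    ENNReal.ofReal (2 * Real.pi) • AddCircle.haarAddCircle :=
  AddCircle.volume_eq_smul_haarAddCircle

theorem memLp_haar_iff {E : Type*} [NormedAddCommGroup E] {f : Circ → E} {p : ENNReal} :
    MemLp f p AddCircle.haarAddCircle ↔ MemLp f p volume := by
  constructor
  · intro h
    rw [volume_circ_eq]
    exact h.smul_measure ENNReal.ofReal_ne_top
  · intro h
    refine h.of_measure_le_smul (c := ENNReal.ofReal (2 * Real.pi)⁻¹) ENNReal.ofReal_ne_top ?_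
    rw [volume_circ_eq, smul_smul, ← ENNReal.ofReal_mul (by positivity),
      inv_mul_cancel₀ (by positivity)]
    simp

theorem modeC_congr {F G : Strip → CVec n} (h : F =ᵐ[volume] G) (k : ℤ) :
    modeC k F =ᵐ[volume] modeC k G := by
  filter_upwards [Measure.ae_ae_of_ae_prod h] with x hx
  refine congrFun (fourierCoeff_congr_ae ?_) k
  change ∀ᵐ y ∂AddCircle.haarAddCircle, F (x, y) = G (x, y)
  rw [ae_haarAddCircle_eq]
  exact hx

theorem aestronglyMeasurable_modeC {F : Strip → CVec n} (hF : AEStronglyMeasurable F) (k : ℤ) :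
    AEStronglyMeasurable (modeC k F) := by
  have h1 : AEStronglyMeasurable (fun p : ℝ × Circ => fourier (-k) p.2 • F p)
      ((volume : Measure ℝ).prod (volume : Measure Circ)) :=
    (((fourier (-k)).continuous.comp continuous_snd).aestronglyMeasurable).smul hF
  have h2 : AEStronglyMeasurable (fun p : ℝ × Circ => fourier (-k) p.2 • F p)
      ((volume : Measure ℝ).prod (AddCircle.haarAddCircle : Measure Circ)) := by
    refine h1.mono_ac (Measure.AbsolutelyContinuous.prod Measure.AbsolutelyContinuous.rfl ?_)
    exact Measure.ae_le_iff_absolutelyContinuous.1 ae_haarAddCircle_eq.le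
  exact h2.integral_prod_right'

/-- Slices of square-integrable functions are square-integrable. -/
theorem ae_memLp_slice {E : Type*} [NormedAddCommGroup E] {F : Strip → E} (hF : MemLp F 2) :
    ∀ᵐ x : ℝ, MemLp (fun y : Circ => F (x, y)) 2 := by
  have h1 : ∫⁻ p : Strip, ‖F p‖ₑ ^ (2 : ℝ) < ⊤ := by
    have := (eLpNorm_lt_top_iff_lintegral_rpow_enorm_lt_top (by norm_num) (by norm_num)).1 hF.2
    simpa using this
  have hm : AEMeasurable (fun p : Strip => ‖F p‖ₑ ^ (2 : ℝ))
      ((volume : Measure ℝ).prod (volume : Measure Circ)) := hF.1.enorm.pow_const _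
  change ∫⁻ p, ‖F p‖ₑ ^ (2 : ℝ) ∂((volume : Measure ℝ).prod (volume : Measure Circ)) < ⊤ at h1
  rw [lintegral_prod _ hm] at h1
  have h2 := ae_lt_top' hm.lintegral_prod_right' h1.ne
  have h3 : ∀ᵐ x : ℝ, AEStronglyMeasurable (fun y : Circ => F (x, y)) volume :=
    AEStronglyMeasurable.prodMk_left (μ := (volume : Measure ℝ)) hF.1
  filter_upwards [h2, h3] with x hx1 hx2
  refine ⟨hx2, (eLpNorm_lt_top_iff_lintegral_rpow_enorm_lt_top (by norm_num) (by norm_num)).2 ?_⟩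
  simpa using hx1

theorem fourierCoeff_apply {f : Circ → CVec n} (hf : Integrable f AddCircle.haarAddCircle) (k : ℤ)
    (i : Fin n) : fourierCoeff f k i = fourierCoeff (fun y => f y i) k := by
  have := (EuclideanSpace.proj i : CVec n →L[ℂ] ℂ).integral_comp_comm (hf.fourier_smul (-k))
  exact this.symm

/-- Parseval's identity for vector-valued functions on the circle. -/
theorem tsum_enorm_sq_fourierCoeff {f : Circ → CVec n} (hf : MemLp f 2) :
    ∑' k : ℤ, ‖fourierCoeff f k‖ₑ ^ 2 =
      ENNReal.ofReal (2 * Real.pi)⁻¹ * ∫⁻ y, ‖f y‖ₑ ^ 2 := by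
  have hf' : MemLp f 2 AddCircle.haarAddCircle := memLp_haar_iff.2 hf
  have hvec : ∀ v : CVec n, ‖v‖ₑ ^ 2 = ∑ i, ‖v i‖ₑ ^ 2 := by
    intro v
    simp only [← ofReal_norm, ← ENNReal.ofReal_pow (norm_nonneg _)]
    rw [← ENNReal.ofReal_sum_of_nonneg (fun i _ => by positivity), EuclideanSpace.norm_sq_eq]
  have hi : ∀ i, MemLp (fun y => f y i) 2 AddCircle.haarAddCircle := fun i =>
    (EuclideanSpace.proj i : CVec n →L[ℂ] ℂ).comp_memLp' hf'
  have hscal : ∀ i, ∑' k : ℤ, ‖fourierCoeff (fun y => f y i) k‖ₑ ^ 2 =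
      ∫⁻ y, ‖f y i‖ₑ ^ 2 ∂AddCircle.haarAddCircle := by
    intro i
    have h := hasSum_sq_fourierCoeff ((hi i).toLp _)
    have e1 : fourierCoeff ((hi i).toLp _ : Circ → ℂ) = fourierCoeff (fun y => f y i) :=
      fourierCoeff_congr_ae (hi i).coeFn_toLp
    have e2 : ∫ t, ‖((hi i).toLp _ : Circ → ℂ) t‖ ^ 2 ∂AddCircle.haarAddCircle
        = ∫ t, ‖f t i‖ ^ 2 ∂AddCircle.haarAddCircle := by
      refine integral_congr_ae ?_
      filter_upwards [(hi i).coeFn_toLp] with y hy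
      rw [hy]
    rw [e1, e2] at h
    have h' := congrArg ENNReal.ofReal h.tsum_eq
    rw [ENNReal.ofReal_tsum_of_nonneg (fun k => by positivity) h.summable,
      ofReal_integral_eq_lintegral_ofReal] at h'
    · simpa only [ENNReal.ofReal_pow (norm_nonneg _), ofReal_norm] using h'
    · exact (memLp_two_iff_integrable_sq_norm (hi i).1).1 (hi i)
    · exact ae_of_all _ fun y => by positivity
  have hint : Integrable f AddCircle.haarAddCircle := hf'.integrable (by norm_num)
  calc ∑' k : ℤ, ‖fourierCoeff f k‖ₑ ^ 2
      = ∑' k : ℤ, ∑ i, ‖fourierCoeff (fun y => f y i) k‖ₑ ^ 2 := by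
        refine tsum_congr fun k => ?_
        rw [hvec]
        simp only [fourierCoeff_apply hint]
    _ = ∑ i, ∑' k : ℤ, ‖fourierCoeff (fun y => f y i) k‖ₑ ^ 2 :=
        Summable.tsum_finsetSum fun _ _ => ENNReal.summable
    _ = ∑ i, ∫⁻ y, ‖f y i‖ₑ ^ 2 ∂AddCircle.haarAddCircle := Finset.sum_congr rfl fun i _ => hscal i
    _ = ∫⁻ y, ‖f y‖ₑ ^ 2 ∂AddCircle.haarAddCircle := by
        simp only [hvec]
        rw [lintegral_finsetSum']
        exact fun i _ => (hi i).1.enorm.pow_const _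
    _ = _ := by
        rw [volume_circ_eq, lintegral_smul_measure, smul_eq_mul, ← mul_assoc,
          ← ENNReal.ofReal_mul (by positivity), inv_mul_cancel₀ (by positivity)]
        simp

/-- Parseval's identity on the strip. -/
theorem tsum_lintegral_modeC {F : Strip → CVec n} (hF : MemLp F 2) :
    ∑' k : ℤ, ∫⁻ x, ‖modeC k F x‖ₑ ^ 2 =
      ENNReal.ofReal (2 * Real.pi)⁻¹ * ∫⁻ p, ‖F p‖ₑ ^ 2 := by
  rw [← lintegral_tsum fun k => (aestronglyMeasurable_modeC hF.1 k).enorm.pow_const _]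
  have h1 : ∫⁻ x, ∑' k : ℤ, ‖modeC k F x‖ₑ ^ 2 =
      ∫⁻ x, ENNReal.ofReal (2 * Real.pi)⁻¹ * ∫⁻ y : Circ, ‖F (x, y)‖ₑ ^ 2 := by
    refine lintegral_congr_ae ?_
    filter_upwards [ae_memLp_slice hF] with x hx
    exact tsum_enorm_sq_fourierCoeff hx
  have hm : AEMeasurable (fun p : Strip => ‖F p‖ₑ ^ 2)
      ((volume : Measure ℝ).prod (volume : Measure Circ)) := hF.1.enorm.pow_const _
  rw [h1, lintegral_const_mul'' _ hm.lintegral_prod_right', ← lintegral_prod _ hm]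
  rfl

theorem enorm_sq_lp {α E : Type*} [MeasurableSpace α] {μ : Measure α} [NormedAddCommGroup E]
    (f : Lp E 2 μ) : ∫⁻ x, ‖f x‖ₑ ^ 2 ∂μ = ENNReal.ofReal (‖f‖ ^ 2) := by
  rw [ENNReal.ofReal_pow (norm_nonneg _), Lp.norm_def, ENNReal.ofReal_toReal (Lp.eLpNorm_ne_top f),
    eLpNorm_eq_lintegral_rpow_enorm_toReal (by norm_num) (by norm_num)]
  simp only [ENNReal.toReal_ofNat, ENNReal.rpow_ofNat, one_div]
  rw [← ENNReal.rpow_natCast, ← ENNReal.rpow_mul]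
  norm_num

theorem memLp_modeC {F : Strip → CVec n} (hF : MemLp F 2) (k : ℤ) : MemLp (modeC k F) 2 := by
  refine ⟨aestronglyMeasurable_modeC hF.1 k, ?_⟩
  rw [eLpNorm_lt_top_iff_lintegral_rpow_enorm_lt_top (by norm_num) (by norm_num)]
  simp only [ENNReal.toReal_ofNat, ENNReal.rpow_ofNat]
  refine lt_of_le_of_lt (ENNReal.le_tsum (f := fun k => ∫⁻ x, ‖modeC k F x‖ₑ ^ 2) k) ?_
  rw [tsum_lintegral_modeC hF]
  refine ENNReal.mul_lt_top ENNReal.ofReal_lt_top ?_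
  have := (eLpNorm_lt_top_iff_lintegral_rpow_enorm_lt_top (by norm_num) (by norm_num)).1 hF.2
  simpa using this

/-- The Fourier mode of a square-integrable function on the strip, as an `L²` function. -/
def modeLp (k : ℤ) (F : L2StripC n) : L2Line n := (memLp_modeC (Lp.memLp F) k).toLp _

theorem coeFn_modeLp (k : ℤ) (F : L2StripC n) : modeLp k F =ᵐ[volume] modeC k F :=
  MemLp.coeFn_toLp _

theorem hasSum_norm_sq_modeLp (F : L2StripC n) :
    HasSum (fun k => ‖modeLp k F‖ ^ 2) ((2 * Real.pi)⁻¹ * ‖F‖ ^ 2) := by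
  have h := tsum_lintegral_modeC (Lp.memLp F)
  have e : ∀ k, ∫⁻ x, ‖modeC k F x‖ₑ ^ 2 = ENNReal.ofReal (‖modeLp k F‖ ^ 2) := by
    intro k
    rw [← enorm_sq_lp]
    refine lintegral_congr_ae ?_
    filter_upwards [coeFn_modeLp k F] with x hx
    rw [hx]
  simp only [e] at h
  rw [enorm_sq_lp, ← ENNReal.ofReal_mul (by positivity)] at h
  have hs : Summable fun k => ‖modeLp k F‖ ^ 2 := by
    have h2 := ENNReal.summable_toReal (f := fun k => ENNReal.ofReal (‖modeLp k F‖ ^ 2))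
      (by rw [h]; exact ENNReal.ofReal_ne_top)
    refine h2.congr fun k => ENNReal.toReal_ofReal (by positivity)
  rw [← ENNReal.ofReal_tsum_of_nonneg (fun k => by positivity) hs,
    ENNReal.ofReal_eq_ofReal_iff (tsum_nonneg fun k => by positivity) (by positivity)] at h
  rw [← h]
  exact hs.hasSum

theorem integrable_slice {F : Strip → CVec n} (hF : MemLp F 2) :
    ∀ᵐ x : ℝ, Integrable (fun y : Circ => F (x, y)) AddCircle.haarAddCircle := by
  filter_upwards [ae_memLp_slice hF] with x hx
  exact (memLp_haar_iff.2 hx).integrable (by norm_num)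

/-- `modeLp` as a continuous linear map. -/
def modeL (n : ℕ) (k : ℤ) : L2StripC n →L[ℂ] L2Line n :=
  LinearMap.mkContinuous
    { toFun := modeLp k
      map_add' := fun F G => by
        refine Lp.ext ?_
        filter_upwards [coeFn_modeLp k (F + G), coeFn_modeLp k F, coeFn_modeLp k G,
          Lp.coeFn_add (modeLp k F) (modeLp k G), modeC_congr (Lp.coeFn_add F G) k,
          integrable_slice (Lp.memLp F), integrable_slice (Lp.memLp G)] with x h1 h2 h3 h4 h5 h6 h7
        rw [h4, Pi.add_apply, h1, h2, h3, h5]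
        exact congrFun (fourierCoeff.add h6 h7) k
      map_smul' := fun a F => by
        refine Lp.ext ?_
        filter_upwards [coeFn_modeLp k (a • F), coeFn_modeLp k F,
          Lp.coeFn_smul a (modeLp k F), modeC_congr (Lp.coeFn_smul a F) k] with x h1 h2 h4 h5
        change modeLp k (a • F) x = (a • modeLp k F : L2Line n) x
        rw [h4, Pi.smul_apply, h1, h2, h5]
        exact fourierCoeff.const_smul _ a k } 1 fun F => by
    have h1 := (hasSum_norm_sq_modeLp F).summable.le_tsum k fun j _ => by positivity
    rw [(hasSum_norm_sq_modeLp F).tsum_eq] at h1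
    have h2 : (2 * Real.pi)⁻¹ ≤ 1 := inv_le_one_of_one_le₀ (by linarith [Real.pi_gt_three])
    rw [one_mul]
    refine (pow_le_pow_iff_left₀ (norm_nonneg _) (norm_nonneg _) two_ne_zero).1 (h1.trans ?_)
    exact mul_le_of_le_one_left (sq_nonneg _) h2

theorem modeL_apply (k : ℤ) (F : L2StripC n) : modeL n k F = modeLp k F := rfl

theorem norm_sq_eq_tsum_modeL (F : L2StripC n) :
    ‖F‖ ^ 2 = 2 * Real.pi * ∑' k, ‖modeL n k F‖ ^ 2 := by
  simp only [modeL_apply]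
  rw [(hasSum_norm_sq_modeLp F).tsum_eq, ← mul_assoc, mul_inv_cancel₀ (by positivity), one_mul]

/-- The function `a(x) e^{iky}` on the strip. -/
def tensFn (k : ℤ) (a : ℝ → CVec n) : Strip → CVec n := fun p => fourier k p.2 • a p.1

theorem norm_fourier_apply (k : ℤ) (y : Circ) : ‖fourier k y‖ = 1 := by
  rw [fourier_apply]; exact Circle.norm_coe _

theorem memLp_tensFn (k : ℤ) {a : ℝ → CVec n} (ha : MemLp a 2) : MemLp (tensFn k a) 2 := by
  have h1 : MemLp (fun p : Strip => a p.1) 2 :=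
    MemLp.comp_fst (μ := (volume : Measure ℝ)) ha (volume : Measure Circ)
  refine h1.of_le ((((fourier k).continuous.comp continuous_snd).aestronglyMeasurable).smul h1.1)
    (ae_of_all _ fun p => ?_)
  simp only [tensFn, norm_smul, norm_fourier_apply, one_mul, le_refl]

theorem modeC_tensFn (j k : ℤ) (a : ℝ → CVec n) (x : ℝ) :
    modeC j (tensFn k a) x = if j = k then a x else 0 := by
  simp only [modeC, tensFn, fourierCoeff]
  have h := congrFun (fourierCoeff_fourier (T := 2 * Real.pi) k) j
  simp only [fourierCoeff, smul_eq_mul] at h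
  simp only [smul_smul]
  rw [integral_smul_const, h, Pi.single_apply, ite_smul, one_smul, zero_smul]

/-- `a(x) e^{iky}` as an element of `L²(Ω; ℂⁿ)`. -/
def tens (k : ℤ) (a : L2Line n) : L2StripC n := (memLp_tensFn k (Lp.memLp a)).toLp _

theorem coeFn_tens (k : ℤ) (a : L2Line n) : tens k a =ᵐ[volume] tensFn k a := MemLp.coeFn_toLp _

theorem modeL_tens (j k : ℤ) (a : L2Line n) : modeL n j (tens k a) = if j = k then a else 0 := by
  refine Lp.ext ?_
  rw [modeL_apply]
  filter_upwards [coeFn_modeLp j (tens k a), modeC_congr (coeFn_tens k a) j,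
    Lp.coeFn_zero (CVec n) 2 (volume : Measure ℝ)] with x h1 h2 h3
  rw [h1, h2, modeC_tensFn]
  split_ifs
  · rfl
  · exact h3.symm

theorem norm_sq_sum_tens (s : Finset ℤ) (a : ℤ → L2Line n) :
    ‖∑ k ∈ s, tens k (a k)‖ ^ 2 = 2 * Real.pi * ∑ k ∈ s, ‖a k‖ ^ 2 := by
  rw [norm_sq_eq_tsum_modeL]
  congr 1
  have e : ∀ j, modeL n j (∑ k ∈ s, tens k (a k)) = if j ∈ s then a j else 0 := by
    intro j
    rw [map_sum]
    simp only [modeL_tens]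
    exact Finset.sum_ite_eq s j a
  simp only [e]
  rw [tsum_eq_sum (s := s) (fun k hk => by simp [hk])]
  exact Finset.sum_congr rfl fun k hk => by simp [hk]

/-- Synthesis: a square-summable sequence of `L²` functions is the sequence of modes of a function
on the strip, namely of the sum of its Fourier series. -/
theorem exists_hasSum_tens {a : ℤ → L2Line n} (ha : Summable fun k => ‖a k‖ ^ 2) :
    ∃ F : L2StripC n, HasSum (fun k => tens k (a k)) F ∧ ∀ k, modeL n k F = a k := by
  have hs : Summable fun k => tens k (a k) := by
    rw [summable_iff_vanishing_norm]
    intro ε hε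
    obtain ⟨s, hs⟩ := summable_iff_vanishing_norm.1 ha (ε ^ 2 / (2 * Real.pi)) (by positivity)
    refine ⟨s, fun t ht => ?_⟩
    have h1 := (le_abs_self _).trans_lt (hs t ht)
    rw [lt_div_iff₀' (by positivity), ← norm_sq_sum_tens] at h1
    exact lt_of_pow_lt_pow_left₀ 2 hε.le h1
  refine ⟨_, hs.hasSum, fun j => ?_⟩
  rw [(modeL n j).map_tsum hs]
  simp only [modeL_tens]
  rw [tsum_eq_single j (fun k hk => if_neg hk.symm), if_pos rfl]

/-! ### Real-valued functions on the strip -/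

/-- The inclusion `L²(Ω; ℝⁿ) ⊆ L²(Ω; ℂⁿ)`. -/
def stripToC (n : ℕ) : L2Strip n →L[ℝ] L2StripC n := (toCL n).compLpL 2 volume

/-- The real part of functions in `L²(Ω; ℂⁿ)`. -/
def stripRe (n : ℕ) : L2StripC n →L[ℝ] L2Strip n := (reVL n).compLpL 2 volume

theorem coeFn_stripToC (u : L2Strip n) : stripToC n u =ᵐ[volume] fun p => toC (u p) :=
  (toCL n).coeFn_compLpL u

theorem coeFn_stripRe (F : L2StripC n) : stripRe n F =ᵐ[volume] fun p => reV (F p) :=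
  (reVL n).coeFn_compLpL F

theorem norm_stripToC (u : L2Strip n) : ‖stripToC n u‖ = ‖u‖ := by
  refine le_antisymm (Lp.norm_le_norm_of_ae_le ?_) (Lp.norm_le_norm_of_ae_le ?_)
  all_goals
    filter_upwards [coeFn_stripToC u] with p hp
    rw [hp, norm_toC]

/-- The Fourier mode of a real-valued function on the strip, as an `L²` function. -/
def modeR (k : ℤ) : L2Strip n →L[ℝ] L2Line n := ((modeL n k).restrictScalars ℝ).comp (stripToC n)

theorem coeFn_modeR (k : ℤ) (u : L2Strip n) : modeR k u =ᵐ[volume] modeFn k u :=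
  (coeFn_modeLp k (stripToC n u)).trans (modeC_congr (coeFn_stripToC u) k)

theorem modeFn_ae_eq_iff {k : ℤ} {u : L2Strip n} {a : L2Line n} :
    modeFn k u =ᵐ[volume] a ↔ modeR k u = a :=
  ⟨fun h => Lp.ext ((coeFn_modeR k u).trans h), fun h => h ▸ (coeFn_modeR k u).symm⟩

theorem norm_sq_eq_tsum_modeR (u : L2Strip n) :
    ‖u‖ ^ 2 = 2 * Real.pi * ∑' k, ‖modeR k u‖ ^ 2 := by
  rw [← norm_stripToC, norm_sq_eq_tsum_modeL]
  rfl

theorem summable_norm_sq_modeR (u : L2Strip n) : Summable fun k => ‖modeR k u‖ ^ 2 :=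
  (hasSum_norm_sq_modeLp (stripToC n u)).summable

theorem eq_of_modeR_eq {u v : L2Strip n} (h : ∀ k, modeR k u = modeR k v) : u = v := by
  have := norm_sq_eq_tsum_modeR (u - v)
  simp only [map_sub, h, sub_self, norm_zero] at this
  simpa [sub_eq_zero] using this

theorem fourierCoeff_conjV {f : Circ → CVec n} (hf : Integrable f AddCircle.haarAddCircle) (k : ℤ) :
    fourierCoeff (fun y => conjV (f y)) k = conjV (fourierCoeff f (-k)) := by
  have h := (conjVL n).integral_comp_comm (hf.fourier_smul (- -k))
  simp only [conjVL_apply, conjV_smul, neg_neg, ← fourier_neg] at h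
  simp only [fourierCoeff, neg_neg]
  exact h

/-- The modes of a real-valued function are conjugate to each other. -/
theorem modeR_neg (k : ℤ) (u : L2Strip n) :
    ∀ᵐ x : ℝ, modeR (-k) u x = conjV (modeR k u x) := by
  filter_upwards [coeFn_modeR k u, coeFn_modeR (-k) u,
    modeC_congr (coeFn_stripToC u) k, integrable_slice (F := fun p => toC (u p))
      ((toCL n).comp_memLp' (Lp.memLp u))] with x h1 h2 _ h4
  rw [h1, h2]
  have := fourierCoeff_conjV h4 (-k)
  simp only [conjV_toC, neg_neg] at this
  exact this

/-- Taking the real part does not change the modes if these are conjugate to each other. -/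
theorem modeR_stripRe {F : L2StripC n} {a : ℤ → L2Line n} (hF : ∀ k, modeL n k F = a k)
    (hc : ∀ k, ∀ᵐ x, a (-k) x = conjV (a k x)) (k : ℤ) : modeR k (stripRe n F) = a k := by
  have e : ∀ z : CVec n, toC (reV z) = (1 / 2 : ℂ) • (z + conjV z) := by
    intro z
    ext i
    simp only [toC, reV, conjV, PiLp.smul_apply, PiLp.add_apply, smul_eq_mul]
    rw [Complex.add_conj]
    push_cast
    ring
  have h0 : (stripToC n (stripRe n F) : Strip → CVec n) =ᵐ[volume]
      fun p => (1 / 2 : ℂ) • (F p + conjV (F p)) := by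
    filter_upwards [coeFn_stripToC (stripRe n F), coeFn_stripRe F] with p h1 h2
    rw [h1, h2, e]
  refine Lp.ext ?_
  have hm : ∀ j, (a j : ℝ → CVec n) =ᵐ[volume] modeC j F := fun j => by
    rw [← hF j]; exact coeFn_modeLp j F
  filter_upwards [coeFn_modeLp k (stripToC n (stripRe n F)), modeC_congr h0 k,
    integrable_slice (Lp.memLp F), hc (-k), hm k, hm (-k)] with x h1 h2 h3 h4 h5 h6
  change modeLp k (stripToC n (stripRe n F)) x = _
  rw [h1, h2]
  have s1 : modeC k (fun p => (1 / 2 : ℂ) • (F p + conjV (F p))) x =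
      (1 / 2 : ℂ) • (fourierCoeff (fun y => F (x, y)) k
        + fourierCoeff (fun y => conjV (F (x, y))) k) := by
    have h := congrFun (fourierCoeff.add h3 ((conjVL n).integrable_comp h3)) k
    refine Eq.trans ?_ (congrArg ((1 / 2 : ℂ) • ·) h)
    exact fourierCoeff.const_smul _ _ _
  rw [s1, fourierCoeff_conjV h3]
  change (1 / 2 : ℂ) • (modeC k F x + conjV (modeC (-k) F x)) = _
  rw [← h5, ← h6, ← h4, neg_neg, ← two_smul ℂ, smul_smul]
  norm_num

/-! ### Test functions on the strip -/

theorem isQuotientMap_strip :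
    IsQuotientMap (fun p : ℝ × ℝ => ((p.1, (p.2 : Circ)) : Strip)) :=
  (IsOpenQuotientMap.id.prodMap QuotientAddGroup.isOpenQuotientMap_mk).isQuotientMap

theorem exists_coe_eq (y : Circ) : ∃ t : ℝ, (t : Circ) = y := QuotientAddGroup.mk_surjective y

namespace IsTestFun

variable {φ : Strip → ℝ}

theorem continuous (h : IsTestFun φ) : Continuous φ :=
  isQuotientMap_strip.continuous_iff.2 h.1.continuous

/-- The classical `x`-derivative of a test function. -/
theorem hasDerivAt_x (h : IsTestFun φ) (x : ℝ) (y : Circ) :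
    HasDerivAt (fun s => φ (s, y)) (partialX φ (x, y)) x := by
  obtain ⟨t, rfl⟩ := exists_coe_eq y
  have h1 : ContDiff ℝ ∞ fun s : ℝ => φ (s, (t : Circ)) :=
    h.1.comp (contDiff_id.prodMk contDiff_const)
  exact (h1.differentiable (by simp) x).hasDerivAt

theorem contDiff_slice (h : IsTestFun φ) (y : Circ) : ContDiff ℝ ∞ fun s : ℝ => φ (s, y) := by
  obtain ⟨t, rfl⟩ := exists_coe_eq y
  exact h.1.comp (contDiff_id.prodMk contDiff_const)

theorem deriv_slice (h : IsTestFun φ) (y : Circ) :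
    deriv (fun s : ℝ => φ (s, y)) = fun x => partialX φ (x, y) :=
  funext fun x => (h.hasDerivAt_x x y).deriv

/-- The classical `y`-derivative of a test function. -/
theorem hasDerivAt_y (h : IsTestFun φ) (x : ℝ) (y : Circ) :
    HasDerivAt (fun t : ℝ => φ (x, y + (t : Circ))) (partialY φ (x, y)) 0 := by
  obtain ⟨t, rfl⟩ := exists_coe_eq y
  have h1 : ContDiff ℝ ∞ fun s : ℝ => φ (x, (t : Circ) + (s : Circ)) := by
    have : ContDiff ℝ ∞ fun s : ℝ => ((x, t + s) : ℝ × ℝ) :=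
      contDiff_const.prodMk (contDiff_const.add contDiff_id)
    exact h.1.comp this
  exact (h1.differentiable (by simp) 0).hasDerivAt

theorem continuous_partialX (h : IsTestFun φ) : Continuous (partialX φ) := by
  rw [isQuotientMap_strip.continuous_iff]
  have h1 : (partialX φ ∘ fun p : ℝ × ℝ => ((p.1, (p.2 : Circ)) : Strip)) = fun p : ℝ × ℝ =>
      fderiv ℝ (fun p : ℝ × ℝ => φ (p.1, (p.2 : Circ))) p (1, 0) := by
    funext p
    have h2 := (h.1.differentiable (by simp) p).hasFDerivAt
    have h3 : HasDerivAt (fun s : ℝ => ((s, p.2) : ℝ × ℝ)) (1, 0) p.1 :=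
      (hasDerivAt_id _).prodMk (hasDerivAt_const _ _)
    have h4 := h2.comp_hasDerivAt p.1 h3
    exact (h.hasDerivAt_x p.1 p.2).unique h4
  rw [h1]
  exact (h.1.continuous_fderiv (by simp)).clm_apply continuous_const

theorem continuous_partialY (h : IsTestFun φ) : Continuous (partialY φ) := by
  rw [isQuotientMap_strip.continuous_iff]
  have h1 : (partialY φ ∘ fun p : ℝ × ℝ => ((p.1, (p.2 : Circ)) : Strip)) = fun p : ℝ × ℝ =>
      fderiv ℝ (fun p : ℝ × ℝ => φ (p.1, (p.2 : Circ))) p (0, 1) := by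
    funext p
    have h2 : HasFDerivAt (fun p : ℝ × ℝ => φ (p.1, (p.2 : Circ)))
        (fderiv ℝ (fun p : ℝ × ℝ => φ (p.1, (p.2 : Circ))) p) (p.1, p.2 + 0) := by
      rw [add_zero]; exact (h.1.differentiable (by simp) p).hasFDerivAt
    have h3 : HasDerivAt (fun s : ℝ => ((p.1, p.2 + s) : ℝ × ℝ)) (0, 1) 0 :=
      (hasDerivAt_const _ _).prodMk ((hasDerivAt_id _).const_add _)
    have h4 := h2.comp_hasDerivAt 0 h3
    exact (h.hasDerivAt_y p.1 p.2).unique h4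
  rw [h1]
  exact (h.1.continuous_fderiv (by simp)).clm_apply continuous_const

theorem hasCompactSupport_partialX (h : IsTestFun φ) : HasCompactSupport (partialX φ) := by
  refine h.2.mono' fun p hp => ?_
  by_contra hne
  apply hp
  have h1 := notMem_tsupport_iff_eventuallyEq.1 hne
  have h2 : Tendsto (fun s : ℝ => ((s, p.2) : Strip)) (𝓝 p.1) (𝓝 p) :=
    (continuous_id.prodMk continuous_const).tendsto _
  have h3 : (fun s : ℝ => φ (s, p.2)) =ᶠ[𝓝 p.1] fun _ => 0 := h2.eventually h1
  exact h3.deriv_eq.trans (deriv_const _ _)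

theorem hasCompactSupport_partialY (h : IsTestFun φ) : HasCompactSupport (partialY φ) := by
  refine h.2.mono' fun p hp => ?_
  by_contra hne
  apply hp
  have h1 := notMem_tsupport_iff_eventuallyEq.1 hne
  have h2 : Tendsto (fun t : ℝ => ((p.1, p.2 + (t : Circ)) : Strip)) (𝓝 0) (𝓝 p) := by
    have hc : Continuous fun t : ℝ => ((p.1, p.2 + (t : Circ)) : Strip) :=
      continuous_const.prodMk (continuous_const.add (AddCircle.continuous_mk' _))
    have := hc.tendsto 0
    simpa using this
  have h3 : (fun t : ℝ => φ (p.1, p.2 + (t : Circ))) =ᶠ[𝓝 0] fun _ => 0 := h2.eventually h1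
  exact h3.deriv_eq.trans (deriv_const _ _)

theorem memLp (h : IsTestFun φ) : MemLp φ 2 :=
  h.continuous.memLp_of_hasCompactSupport h.2

theorem memLp_partialX (h : IsTestFun φ) : MemLp (partialX φ) 2 :=
  h.continuous_partialX.memLp_of_hasCompactSupport h.hasCompactSupport_partialX

theorem memLp_partialY (h : IsTestFun φ) : MemLp (partialY φ) 2 :=
  h.continuous_partialY.memLp_of_hasCompactSupport h.hasCompactSupport_partialY

theorem hasCompactSupport_slice (h : IsTestFun φ) (y : Circ) :
    HasCompactSupport fun s : ℝ => φ (s, y) := by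
  refine HasCompactSupport.of_support_subset_isCompact (h.2.isCompact.image continuous_fst) ?_
  intro s hs
  exact ⟨(s, y), subset_tsupport _ hs, rfl⟩

end IsTestFun

/-! ### Weak derivatives on the strip -/

section WeakD

variable {E G : Type*} [NormedAddCommGroup E] [NormedSpace ℝ E] [NormedAddCommGroup G]
  [NormedSpace ℝ G]

/-- The integration by parts identity `∫ (D φ) u = - ∫ φ g` for all test functions `φ`, where `D`
is one of `partialX`, `partialY`. -/
def WeakD (D : (Strip → ℝ) → Strip → ℝ) (u g : Strip → E) : Prop :=
  ∀ φ : Strip → ℝ, IsTestFun φ → ∫ p, D φ p • u p = - ∫ p, φ p • g p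

theorem WeakD.congr {D : (Strip → ℝ) → Strip → ℝ} {u g u₁ g₁ : Strip → E} (h : WeakD D u g)
    (hu : u =ᵐ[volume] u₁) (hg : g =ᵐ[volume] g₁) : WeakD D u₁ g₁ := by
  intro φ hφ
  have e1 : (fun x => D φ x • u x) =ᵐ[volume] fun x => D φ x • u₁ x := by
    filter_upwards [hu] with x hx
    rw [hx]
  have e2 : (fun x => φ x • g x) =ᵐ[volume] fun x => φ x • g₁ x := by
    filter_upwards [hg] with x hx
    rw [hx]
  rw [← integral_congr_ae e1, ← integral_congr_ae e2]
  exact h φ hφ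

theorem integrable_smul_L2 {α : Type*} [MeasurableSpace α] {μ : Measure α} {ψ : α → ℝ} {u : α → E}
    (hψ : MemLp ψ 2 μ) (hu : MemLp u 2 μ) : Integrable (fun p => ψ p • u p) μ :=
  memLp_one_iff_integrable.1 (hu.smul hψ)

theorem WeakD.add {D : (Strip → ℝ) → Strip → ℝ} (hD : ∀ φ, IsTestFun φ → MemLp (D φ) 2)
    {u g v h : Strip → E} (hu : MemLp u 2) (hg : MemLp g 2) (hv : MemLp v 2) (hh : MemLp h 2)
    (h1 : WeakD D u g) (h2 : WeakD D v h) : WeakD D (u + v) (g + h) := by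
  intro φ hφ
  simp only [Pi.add_apply, smul_add]
  rw [integral_add (integrable_smul_L2 (hD φ hφ) hu) (integrable_smul_L2 (hD φ hφ) hv),
    integral_add (integrable_smul_L2 hφ.memLp hg) (integrable_smul_L2 hφ.memLp hh), h1 φ hφ,
    h2 φ hφ, neg_add]

theorem WeakD.clm_comp [CompleteSpace E] [CompleteSpace G] {D : (Strip → ℝ) → Strip → ℝ}
    (hD : ∀ φ, IsTestFun φ → MemLp (D φ) 2) (L : E →L[ℝ] G) {u g : Strip → E} (hu : MemLp u 2)
    (hg : MemLp g 2) (h1 : WeakD D u g) : WeakD D (fun p => L (u p)) fun p => L (g p) := by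
  intro φ hφ
  have e1 := L.integral_comp_comm (integrable_smul_L2 (hD φ hφ) hu)
  have e2 := L.integral_comp_comm (integrable_smul_L2 hφ.memLp hg)
  simp only [map_smul] at e1 e2
  rw [e1, e2, h1 φ hφ, map_neg]

/-- Weak differentiability is preserved by convergence in `L²`. -/
theorem isClosed_weakD [CompleteSpace E] {D : (Strip → ℝ) → Strip → ℝ}
    (hD : ∀ φ, IsTestFun φ → MemLp (D φ) 2) :
    IsClosed {p : Lp E 2 (volume : Measure Strip) × Lp E 2 (volume : Measure Strip) |
      WeakD D (p.1 : Strip → E) p.2} := by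
  have : {p : Lp E 2 (volume : Measure Strip) × Lp E 2 (volume : Measure Strip) |
      WeakD D (p.1 : Strip → E) p.2} = ⋂ (φ : Strip → ℝ) (_ : IsTestFun φ),
        {p | ∫ x, D φ x • p.1 x = - ∫ x, φ x • p.2 x} := by
    ext p
    simp [WeakD]
  rw [this]
  refine isClosed_iInter fun φ => isClosed_iInter fun h => ?_
  simp only [← pairL2_apply (hD φ h), ← pairL2_apply h.memLp]
  exact isClosed_eq ((pairL2 (hD φ h)).continuous.comp continuous_fst)
    ((pairL2 h.memLp).continuous.comp continuous_snd).neg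

/-- Weak `x`-differentiability follows from weak differentiability of the slices. -/
theorem weakD_partialX_of_slices {u g : Strip → E} (hu : MemLp u 2) (hg : MemLp g 2)
    (h : ∀ y : Circ, HasWeakDeriv (fun x => u (x, y)) fun x => g (x, y)) :
    WeakD partialX u g := by
  intro φ hφ
  have i1 := integrable_smul_L2 hφ.memLp_partialX hu
  have i2 := integrable_smul_L2 hφ.memLp hg
  have e1 : ∫ p : Strip, partialX φ p • u p = ∫ y : Circ, ∫ x : ℝ, partialX φ (x, y) • u (x, y) :=
    integral_prod_symm _ i1
  have e2 : ∫ p : Strip, φ p • g p = ∫ y : Circ, ∫ x : ℝ, φ (x, y) • g (x, y) :=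
    integral_prod_symm _ i2
  rw [e1, e2, ← integral_neg]
  refine integral_congr_ae (ae_of_all _ fun y => ?_)
  have := (h y).2.2 _ (hφ.contDiff_slice y) (hφ.hasCompactSupport_slice y)
  rw [hφ.deriv_slice y] at this
  exact this

/-- The integral of a derivative over the circle vanishes. -/
theorem integral_circ_eq_zero [CompleteSpace E] {v v' : Circ → E} (hv' : Continuous v')
    (h : ∀ y : Circ, HasDerivAt (fun t : ℝ => v (y + (t : Circ))) (v' y) 0) : ∫ y, v' y = 0 := by
  have hd : ∀ t : ℝ, HasDerivAt (fun s : ℝ => v (s : Circ)) (v' (t : Circ)) t := by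
    intro t
    have h1 := h (t : Circ)
    have h2 : HasDerivAt (fun s : ℝ => s - t) 1 t := (hasDerivAt_id t).sub_const t
    have h3 : HasDerivAt (fun τ : ℝ => v ((t : Circ) + (τ : Circ))) (v' t) (t - t) := by
      rw [sub_self]; exact h1
    have h4 := HasDerivAt.scomp (h := fun s : ℝ => s - t) t h3 h2
    rw [one_smul] at h4
    refine h4.congr_of_eventuallyEq (Eventually.of_forall fun s => ?_)
    simp only [Function.comp]
    rw [← AddCircle.coe_add, add_sub_cancel]
  rw [← AddCircle.intervalIntegral_preimage (2 * Real.pi) 0 v',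
    intervalIntegral.integral_eq_sub_of_hasDerivAt (fun t _ => hd t)
      ((hv'.comp (AddCircle.continuous_mk' _)).intervalIntegrable _ _), zero_add,
    AddCircle.coe_period]
  simp

/-- Weak `y`-differentiability follows from classical differentiability of the slices. -/
theorem weakD_partialY_of_slices [CompleteSpace E] {u g : Strip → E} (hu : MemLp u 2)
    (hg : MemLp g 2) (hc : ∀ x : ℝ, Continuous fun y : Circ => u (x, y))
    (hc' : ∀ x : ℝ, Continuous fun y : Circ => g (x, y))
    (h : ∀ p : Strip, HasDerivAt (fun t : ℝ => u (p.1, p.2 + (t : Circ))) (g p) 0) :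
    WeakD partialY u g := by
  intro φ hφ
  have i1 := integrable_smul_L2 hφ.memLp_partialY hu
  have i2 := integrable_smul_L2 hφ.memLp hg
  rw [eq_neg_iff_add_eq_zero, ← integral_add i1 i2]
  have i3 : Integrable (fun p : Strip => partialY φ p • u p + φ p • g p)
      ((volume : Measure ℝ).prod (volume : Measure Circ)) := i1.add i2
  refine (integral_prod _ i3).trans ?_
  refine integral_eq_zero_of_ae (ae_of_all _ fun x => ?_)
  have hs : ∀ f : Strip → ℝ, Continuous f → Continuous fun y : Circ => f (x, y) :=
    fun f hf => hf.comp (continuous_const.prodMk continuous_id)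
  refine integral_circ_eq_zero (v := fun y => φ (x, y) • u (x, y))
    (((hs _ hφ.continuous_partialY).smul (hc x)).add ((hs _ hφ.continuous).smul (hc' x)))
    fun y => ?_
  have := (hφ.hasDerivAt_y x y).smul (h (x, y))
  simp only [AddCircle.coe_zero, add_zero] at this
  rw [add_comm]
  exact this

end WeakD

theorem locallyIntegrable_lp {α E : Type*} [TopologicalSpace α] [MeasurableSpace α]
    [NormedAddCommGroup E] {μ : Measure α} [IsLocallyFiniteMeasure μ] (u : Lp E 2 μ) :
    LocallyIntegrable (u : α → E) μ :=
  (Lp.memLp u).locallyIntegrable (by norm_num)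

/-- A test function from a function of `x` and a trigonometric function of `y`. -/
theorem isTestFun_mul_fourier {η : ℝ → ℝ} (h1 : ContDiff ℝ ∞ η) (h2 : HasCompactSupport η) (k : ℤ)
    (L : ℂ →L[ℝ] ℝ) : IsTestFun fun p : Strip => η p.1 * L (fourier k p.2) := by
  constructor
  · simp only [fourier_coe_apply]
    refine (h1.comp contDiff_fst).mul (L.contDiff.comp ?_)
    refine ContDiff.cexp ?_
    refine ContDiff.div_const (contDiff_const.mul ?_) _
    exact Complex.ofRealCLM.contDiff.comp contDiff_snd
  · refine HasCompactSupport.of_support_subset_isCompact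
      (h2.isCompact.prod (isCompact_univ (X := Circ))) ?_
    intro p hp
    refine ⟨subset_tsupport _ fun h => hp ?_, trivial⟩
    simp only [h, zero_mul]

/-- A square-integrable function on the strip that is orthogonal to all test functions vanishes. -/
theorem eq_zero_of_forall_test {h : L2Strip n}
    (H : ∀ φ, IsTestFun φ → ∫ p, φ p • h p = 0) : h = 0 := by
  refine eq_of_modeR_eq fun k => ?_
  rw [map_zero]
  refine Lp.ext ?_
  have hloc : LocallyIntegrable (modeR k h : ℝ → CVec n) := locallyIntegrable_lp _
  have key := ae_eq_zero_of_integral_contDiff_smul_eq_zero hloc (fun η h1 h2 => by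
    have hη : MemLp (fun p : Strip => η p.1) 2 :=
      MemLp.comp_fst (μ := (volume : Measure ℝ)) (h1.continuous.memLp_of_hasCompactSupport h2)
        (volume : Measure Circ)
    have hh : MemLp (fun p : Strip => fourier (-k) p.2 • toC (h p)) 2 := by
      have h3 : MemLp (fun p : Strip => toC (h p)) 2 := (toCL n).comp_memLp' (Lp.memLp h)
      refine h3.of_le ((((fourier (-k)).continuous.comp
        continuous_snd).aestronglyMeasurable).smul h3.1) (ae_of_all _ fun p => ?_)
      rw [norm_smul, norm_fourier_apply, one_mul]
    have i1 := integrable_smul_L2 hη hh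
    have e0 : ∫ p : Strip, η p.1 • fourier (-k) p.2 • toC (h p) = 0 := by
      have e : ∀ p : Strip, η p.1 • fourier (-k) p.2 • toC (h p) =
          toCL n ((η p.1 * Complex.reCLM (fourier (-k) p.2)) • h p) +
          Complex.I • toCL n ((η p.1 * Complex.imCLM (fourier (-k) p.2)) • h p) := by
        intro p
        simp only [map_smul, toCL_apply]
        ext i
        simp only [PiLp.add_apply, PiLp.smul_apply, smul_eq_mul, Complex.real_smul,
          Complex.reCLM_apply, Complex.imCLM_apply]
        conv_lhs => rw [← Complex.re_add_im (fourier (-k) p.2)]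
        push_cast
        ring
      have t1 := isTestFun_mul_fourier h1 h2 (-k) Complex.reCLM
      have t2 := isTestFun_mul_fourier h1 h2 (-k) Complex.imCLM
      have j1 := integrable_smul_L2 t1.memLp (Lp.memLp h)
      have j2 := integrable_smul_L2 t2.memLp (Lp.memLp h)
      simp only [e]
      rw [integral_add ((toCL n).integrable_comp j1)
          (((toCL n).integrable_comp j2).fun_smul Complex.I),
        integral_smul, (toCL n).integral_comp_comm j1, (toCL n).integral_comp_comm j2, H _ t1,
        H _ t2]
      simp
    have e1 : ∫ x : ℝ, ∫ y : Circ, η x • fourier (-k) y • toC (h (x, y)) = 0 :=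
      (integral_prod (μ := (volume : Measure ℝ)) (ν := (volume : Measure Circ)) _ i1).symm.trans e0
    have e2 : ∫ x, η x • modeR k h x = ∫ x, (2 * Real.pi)⁻¹ •
        ∫ y : Circ, η x • fourier (-k) y • toC (h (x, y)) := by
      refine integral_congr_ae ?_
      filter_upwards [coeFn_modeR k h] with x hx
      rw [hx, modeFn, fourierCoeff, AddCircle.integral_haarAddCircle, integral_smul, smul_comm]
    rw [e2, integral_smul, e1, smul_zero])
  filter_upwards [key, Lp.coeFn_zero (CVec n) 2 (volume : Measure ℝ)] with x h1 h2
  rw [h1, h2]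
  rfl

/-- Weak derivatives on the strip are unique. -/
theorem WeakD.unique {D : (Strip → ℝ) → Strip → ℝ} {u : Strip → RVec n}
    {g h : L2Strip n} (hg : WeakD D u g) (hh : WeakD D u h) : g = h := by
  refine sub_eq_zero.1 (eq_zero_of_forall_test fun φ hφ => ?_)
  have e : (fun p => φ p • (g - h : L2Strip n) p) =ᵐ[volume] fun p => φ p • g p - φ p • h p := by
    filter_upwards [Lp.coeFn_sub g h] with p hp
    rw [hp, Pi.sub_apply, smul_sub]
  rw [integral_congr_ae e, integral_sub (integrable_smul_L2 hφ.memLp (Lp.memLp g))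
    (integrable_smul_L2 hφ.memLp (Lp.memLp h))]
  have := (hg φ hφ).symm.trans (hh φ hφ)
  rw [neg_inj] at this
  rw [this, sub_self]

/-! ### Sums of Fourier series are weakly differentiable -/

theorem HasWeakDeriv.weakD_tens {a b : L2Line n} (h : HasWeakDeriv (a : ℝ → CVec n) b) (k : ℤ) :
    WeakD partialX (tens k a : Strip → CVec n) (tens k b) := by
  refine WeakD.congr (weakD_partialX_of_slices (memLp_tensFn k (Lp.memLp a))
    (memLp_tensFn k (Lp.memLp b)) fun y => ?_) (coeFn_tens k a).symm (coeFn_tens k b).symm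
  exact h.smul (fourier k y)

theorem hasDerivAt_fourier_circ (k : ℤ) (y : Circ) :
    HasDerivAt (fun t : ℝ => fourier k (y + (t : Circ))) (Complex.I * k * fourier k y) 0 := by
  obtain ⟨s, rfl⟩ := exists_coe_eq y
  have h1 : HasDerivAt (fun t : ℝ => s + t) 1 0 := (hasDerivAt_id _).const_add _
  have h2 : HasDerivAt (fun y : ℝ => fourier k (y : Circ)) _ (s + 0) :=
    hasDerivAt_fourier (2 * Real.pi) k (s + 0)
  have h3 := h2.scomp 0 h1
  rw [one_smul, add_zero] at h3
  have e : 2 * (Real.pi : ℂ) * Complex.I * k / ((2 * Real.pi : ℝ) : ℂ) = Complex.I * k := by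
    have : (Real.pi : ℂ) ≠ 0 := Complex.ofReal_ne_zero.2 Real.pi_ne_zero
    push_cast
    field_simp
  rw [e] at h3
  exact h3

theorem weakD_partialY_tens (k : ℤ) (a : L2Line n) :
    WeakD partialY (tens k a : Strip → CVec n) (tens k ((Complex.I * (k : ℂ)) • a)) := by
  refine WeakD.congr (u := tensFn k a) (g := tensFn k ((Complex.I * (k : ℂ)) • (a : ℝ → CVec n)))
    (weakD_partialY_of_slices (memLp_tensFn k (Lp.memLp a))
    (memLp_tensFn k ((Lp.memLp a).const_smul _)) (fun x => ?_) (fun x => ?_) fun p => ?_)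
    (coeFn_tens k a).symm ?_
  · exact (fourier k).continuous.smul (continuous_const (y := a x))
  · exact (fourier k).continuous.smul (continuous_const (y := (Complex.I * (k : ℂ)) • a x))
  · have := (hasDerivAt_fourier_circ k p.2).smul_const (a p.1)
    simp only [tensFn, Pi.smul_apply]
    rw [smul_smul, mul_comm (fourier k p.2)]
    exact this
  · refine EventuallyEq.trans ?_ (coeFn_tens k _).symm
    have h1 : ∀ᵐ p : Strip, ((Complex.I * (k : ℂ)) • a : L2Line n) p.1
        = ((Complex.I * (k : ℂ)) • (a : ℝ → CVec n)) p.1 :=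
      Measure.quasiMeasurePreserving_fst.ae (Lp.coeFn_smul _ a)
    filter_upwards [h1] with p hp
    simp only [tensFn, hp]

theorem weakD_sum {D : (Strip → ℝ) → Strip → ℝ} (hD : ∀ φ, IsTestFun φ → MemLp (D φ) 2)
    {F G : ℤ → L2StripC n} (h : ∀ k, WeakD D (F k : Strip → CVec n) (G k)) (s : Finset ℤ) :
    WeakD D ((∑ k ∈ s, F k : L2StripC n) : Strip → CVec n) (∑ k ∈ s, G k : L2StripC n) := by
  classical
  induction s using Finset.induction_on with
  | empty =>
    intro φ _
    simp only [Finset.sum_empty]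
    rw [integral_eq_zero_of_ae (ae_of_all _ fun p => by simp),
      integral_eq_zero_of_ae (ae_of_all _ fun p => by simp), neg_zero]
  | insert k s hk ih =>
    rw [Finset.sum_insert hk, Finset.sum_insert hk]
    exact (WeakD.add hD (Lp.memLp _) (Lp.memLp _) (Lp.memLp _) (Lp.memLp _) (h k) ih).congr
      (Lp.coeFn_add _ _).symm (Lp.coeFn_add _ _).symm

theorem WeakD.stripRe {D : (Strip → ℝ) → Strip → ℝ} (hD : ∀ φ, IsTestFun φ → MemLp (D φ) 2)
    {F G : L2StripC n} (h : WeakD D (F : Strip → CVec n) G) :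
    WeakD D (stripRe n F : Strip → RVec n) (stripRe n G) :=
  (h.clm_comp hD (reVL n) (Lp.memLp F) (Lp.memLp G)).congr (coeFn_stripRe F).symm
    (coeFn_stripRe G).symm

theorem hasWeakDerivX_lp_iff {u g : L2Strip n} :
    HasWeakDerivX (u : Strip → RVec n) g ↔ WeakD partialX (u : Strip → RVec n) g :=
  ⟨fun h => h.2.2, fun h => ⟨locallyIntegrable_lp u, locallyIntegrable_lp g, h⟩⟩

theorem hasWeakDerivY_lp_iff {u g : L2Strip n} :
    HasWeakDerivY (u : Strip → RVec n) g ↔ WeakD partialY (u : Strip → RVec n) g :=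
  ⟨fun h => h.2.2, fun h => ⟨locallyIntegrable_lp u, locallyIntegrable_lp g, h⟩⟩

/-! ### Complex conjugation -/

/-- Complex conjugation of functions in `L²(ℝ; ℂⁿ)`. -/
def conjLp (n : ℕ) : L2Line n →L[ℝ] L2Line n := (conjVL n).compLpL 2 volume

theorem coeFn_conjLp (a : L2Line n) : conjLp n a =ᵐ[volume] fun x => conjV (a x) :=
  (conjVL n).coeFn_compLpL a

theorem HasWeakDeriv.conjLp {a b : L2Line n} (h : HasWeakDeriv (a : ℝ → CVec n) b) :
    HasWeakDeriv (conjLp n a : ℝ → CVec n) (conjLp n b) :=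
  (h.clm_comp (conjVL n)).congr (coeFn_conjLp a).symm (coeFn_conjLp b).symm

/-- Complex conjugation on `H²(ℝ; ℂⁿ)`. -/
def H2Line.conj (U : H2Line n) : H2Line n :=
  H2Line.mk' (conjLp n U.fn) (conjLp n U.d1) (conjLp n U.d2) U.hasWeakDeriv_fn.conjLp
    U.hasWeakDeriv_d1.conjLp

theorem H2Line.isConj_iff {U V : H2Line n} : U.IsConj V ↔ V = U.conj := by
  constructor
  · intro h
    refine H2Line.ext_fn (Lp.ext ?_)
    filter_upwards [h, coeFn_conjLp U.fn] with x h1 h2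
    rw [h1]
    exact h2.symm
  · rintro rfl
    exact coeFn_conjLp U.fn

theorem conjLp_smul (c : ℂ) (a : L2Line n) :
    conjLp n (c • a) = starRingEnd ℂ c • conjLp n a := by
  refine Lp.ext ?_
  filter_upwards [coeFn_conjLp (c • a), coeFn_conjLp a, Lp.coeFn_smul c a,
    Lp.coeFn_smul (starRingEnd ℂ c) (conjLp n a)] with x h1 h2 h3 h4
  rw [h1, h4, Pi.smul_apply, h2, h3, Pi.smul_apply, conjV_smul]

theorem modeR_neg_eq (k : ℤ) (u : L2Strip n) : modeR (-k) u = conjLp n (modeR k u) := by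
  refine Lp.ext ?_
  filter_upwards [modeR_neg k u, coeFn_conjLp (modeR k u)] with x h1 h2
  rw [h1, h2]

/-! ### Fourier series of real-valued functions on the strip -/

/-- The real part of the partial sum `∑_{k ∈ s} a_k(x) e^{iky}`. -/
def partialStrip (a : ℤ → L2Line n) (s : Finset ℤ) : L2Strip n :=
  stripRe n (∑ k ∈ s, tens k (a k))

/-- A square-summable sequence with `a_{-k} = \overline{a_k}` is the sequence of modes of a
real-valued function. -/
theorem exists_modeR_eq {a : ℤ → L2Line n} (ha : Summable fun k => ‖a k‖ ^ 2)
    (hc : ∀ k, a (-k) = conjLp n (a k)) : ∃ u : L2Strip n, (∀ k, modeR k u = a k) ∧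
      Tendsto (partialStrip a) atTop (𝓝 u) := by
  obtain ⟨F, hF, hm⟩ := exists_hasSum_tens ha
  refine ⟨stripRe n F, modeR_stripRe hm fun k => ?_, ((stripRe n).continuous.tendsto F).comp hF⟩
  rw [hc]
  exact coeFn_conjLp (a k)

theorem tendsto_partialStrip {a : ℤ → L2Line n} {u : L2Strip n} (h : ∀ k, modeR k u = a k) :
    Tendsto (partialStrip a) atTop (𝓝 u) := by
  obtain ⟨v, hv, ht⟩ := exists_modeR_eq (a := a) (by simpa only [h] using summable_norm_sq_modeR u)
    (fun k => by rw [← h, ← h, modeR_neg_eq])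
  rwa [eq_of_modeR_eq fun k => (h k).trans (hv k).symm]

theorem weakD_partialStrip {D : (Strip → ℝ) → Strip → ℝ} (hD : ∀ φ, IsTestFun φ → MemLp (D φ) 2)
    {a b : ℤ → L2Line n} (h : ∀ k, WeakD D (tens k (a k) : Strip → CVec n) (tens k (b k)))
    (s : Finset ℤ) : WeakD D (partialStrip a s : Strip → RVec n) (partialStrip b s) :=
  WeakD.stripRe hD (weakD_sum hD h s)

theorem weakD_of_modes {D : (Strip → ℝ) → Strip → ℝ} (hD : ∀ φ, IsTestFun φ → MemLp (D φ) 2)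
    {a b : ℤ → L2Line n} (h : ∀ k, WeakD D (tens k (a k) : Strip → CVec n) (tens k (b k)))
    {u v : L2Strip n} (hu : ∀ k, modeR k u = a k) (hv : ∀ k, modeR k v = b k) :
    WeakD D (u : Strip → RVec n) v :=
  (isClosed_weakD hD).mem_of_tendsto ((tendsto_partialStrip hu).prodMk_nhds
    (tendsto_partialStrip hv)) (Eventually.of_forall (weakD_partialStrip hD h))

/-! ### From sequences in `M` to functions in `H²(Ω)` -/

/-- `‖w‖_M²`. -/
def mNormSq (w : ℤ → H2Line n) : ℝ := ∑' k, mTerm w k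

theorem mNormSq_nonneg (w : ℤ → H2Line n) : 0 ≤ mNormSq w := tsum_nonneg fun k => mTerm_nonneg w k

theorem norm_fn_sq_le (w : ℤ → H2Line n) (k : ℤ) : ‖(w k).fn‖ ^ 2 ≤ mTerm w k := by
  have h1 := mul_le_mul_of_nonneg_right (le_max_right ((k : ℝ) ^ 4) 1) (sq_nonneg ‖(w k).fn‖)
  have h2 : 0 ≤ max ((k : ℝ) ^ 2) 1 * ‖(w k).d1‖ ^ 2 := by positivity
  unfold mTerm
  linarith [sq_nonneg ‖(w k).d2‖]

theorem max_mul_norm_fn_d1_le (w : ℤ → H2Line n) (k : ℤ) :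
    max ((k : ℝ) ^ 2) 1 * (‖(w k).fn‖ ^ 2 + ‖(w k).d1‖ ^ 2) ≤ mTerm w k := by
  have h1 := mul_le_mul_of_nonneg_right (max_sq_le_max_pow_four k) (sq_nonneg ‖(w k).fn‖)
  unfold mTerm
  linarith [sq_nonneg ‖(w k).d2‖]

theorem norm_d1_sq_le (w : ℤ → H2Line n) (k : ℤ) : ‖(w k).d1‖ ^ 2 ≤ mTerm w k := by
  have h1 := max_mul_norm_fn_d1_le w k
  have h2 := mul_le_mul_of_nonneg_right (le_max_right ((k : ℝ) ^ 2) 1)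
    (by positivity : 0 ≤ ‖(w k).fn‖ ^ 2 + ‖(w k).d1‖ ^ 2)
  linarith [sq_nonneg ‖(w k).fn‖]

theorem norm_d2_sq_le (w : ℤ → H2Line n) (k : ℤ) : ‖(w k).d2‖ ^ 2 ≤ mTerm w k := by
  unfold mTerm
  have : 0 ≤ max ((k : ℝ) ^ 4) 1 * ‖(w k).fn‖ ^ 2 := by positivity
  have : 0 ≤ max ((k : ℝ) ^ 2) 1 * ‖(w k).d1‖ ^ 2 := by positivity
  linarith

theorem norm_Ik (k : ℤ) : ‖Complex.I * (k : ℂ)‖ = |(k : ℝ)| := by simp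

theorem norm_Ik_smul_fn_sq_le (w : ℤ → H2Line n) (k : ℤ) :
    ‖(Complex.I * (k : ℂ)) • (w k).fn‖ ^ 2 ≤ mTerm w k := by
  rw [norm_smul, norm_Ik, mul_pow, sq_abs]
  have h1 := max_mul_norm_fn_d1_le w k
  have h2 := mul_le_mul_of_nonneg_right (le_max_left ((k : ℝ) ^ 2) 1) (sq_nonneg ‖(w k).fn‖)
  have h3 : 0 ≤ max ((k : ℝ) ^ 2) 1 * ‖(w k).d1‖ ^ 2 := by positivity
  linarith

theorem norm_Ik_smul_d1_sq_le (w : ℤ → H2Line n) (k : ℤ) :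
    ‖(Complex.I * (k : ℂ)) • (w k).d1‖ ^ 2 ≤ mTerm w k := by
  rw [norm_smul, norm_Ik, mul_pow, sq_abs]
  have h1 := max_mul_norm_fn_d1_le w k
  have h2 := mul_le_mul_of_nonneg_right (le_max_left ((k : ℝ) ^ 2) 1) (sq_nonneg ‖(w k).d1‖)
  have h3 : 0 ≤ max ((k : ℝ) ^ 2) 1 * ‖(w k).fn‖ ^ 2 := by positivity
  linarith

theorem norm_Ik_smul_Ik_smul_fn_sq_le (w : ℤ → H2Line n) (k : ℤ) :
    ‖(Complex.I * (k : ℂ)) • (Complex.I * (k : ℂ)) • (w k).fn‖ ^ 2 ≤ mTerm w k := by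
  rw [norm_smul, norm_smul, norm_Ik, mul_pow, mul_pow, sq_abs]
  have h2 := mul_le_mul_of_nonneg_right (le_max_left ((k : ℝ) ^ 4) 1) (sq_nonneg ‖(w k).fn‖)
  have h3 : 0 ≤ max ((k : ℝ) ^ 2) 1 * ‖(w k).d1‖ ^ 2 := by positivity
  unfold mTerm
  nlinarith [sq_nonneg ‖(w k).d2‖]

theorem MSpace.conj_eq {w : ℤ → H2Line n} (hw : w ∈ MSpace n) (k : ℤ) : w (-k) = (w k).conj :=
  H2Line.isConj_iff.1 (hw.2 k)

theorem star_Ik (k : ℤ) : starRingEnd ℂ (Complex.I * (k : ℂ)) = Complex.I * ((-k : ℤ) : ℂ) := by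
  simp

/-- `u` is the function with modes `w`, and `ux`, `uy` are its first derivatives. -/
structure IsSynth (w : ℤ → H2Line n) (u ux uy : L2Strip n) : Prop where
  mode : ∀ k, modeR k u = (w k).fn
  mode_x : ∀ k, modeR k ux = (w k).d1
  mode_y : ∀ k, modeR k uy = (Complex.I * (k : ℂ)) • (w k).fn

/-- A sequence in `M` is the sequence of modes of a function in `H²(Ω; ℝⁿ)`. -/
theorem exists_isSynth {w : ℤ → H2Line n} (hw : w ∈ MSpace n) :
    ∃ u ux uy : L2Strip n, IsSynth w u ux uy ∧ MemH2Strip u := by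
  have hs : ∀ a : ℤ → L2Line n, (∀ k, ‖a k‖ ^ 2 ≤ mTerm w k) → Summable fun k => ‖a k‖ ^ 2 :=
    fun a ha => Summable.of_nonneg_of_le (fun k => sq_nonneg _) ha hw.1
  have c0 : ∀ k, (w (-k)).fn = conjLp n (w k).fn := fun k => by rw [MSpace.conj_eq hw]; rfl
  have c1 : ∀ k, (w (-k)).d1 = conjLp n (w k).d1 := fun k => by rw [MSpace.conj_eq hw]; rfl
  have c2 : ∀ k, (w (-k)).d2 = conjLp n (w k).d2 := fun k => by rw [MSpace.conj_eq hw]; rfl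
  obtain ⟨u, hu, -⟩ := exists_modeR_eq (hs (fun k => (w k).fn) (norm_fn_sq_le w)) c0
  obtain ⟨ux, hux, -⟩ := exists_modeR_eq (hs (fun k => (w k).d1) (norm_d1_sq_le w)) c1
  obtain ⟨uxx, huxx, -⟩ := exists_modeR_eq (hs (fun k => (w k).d2) (norm_d2_sq_le w)) c2
  obtain ⟨uy, huy, -⟩ := exists_modeR_eq (hs (fun k => (Complex.I * (k : ℂ)) • (w k).fn)
    (norm_Ik_smul_fn_sq_le w)) fun k => by rw [conjLp_smul, star_Ik, c0]
  obtain ⟨uxy, huxy, -⟩ := exists_modeR_eq (hs (fun k => (Complex.I * (k : ℂ)) • (w k).d1)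
    (norm_Ik_smul_d1_sq_le w)) fun k => by rw [conjLp_smul, star_Ik, c1]
  obtain ⟨uyy, huyy, -⟩ := exists_modeR_eq
    (hs (fun k => (Complex.I * (k : ℂ)) • (Complex.I * (k : ℂ)) • (w k).fn)
    (norm_Ik_smul_Ik_smul_fn_sq_le w)) fun k => by rw [conjLp_smul, conjLp_smul, star_Ik, c0]
  have hX : ∀ φ, IsTestFun φ → MemLp (partialX φ) 2 := fun φ h => h.memLp_partialX
  have hY : ∀ φ, IsTestFun φ → MemLp (partialY φ) 2 := fun φ h => h.memLp_partialY
  refine ⟨u, ux, uy, ⟨hu, hux, huy⟩, ux, uy, uxx, uxy, uyy, ?_, ?_, ?_, ?_, ?_⟩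
  · exact hasWeakDerivX_lp_iff.2
      (weakD_of_modes hX (fun k => (w k).hasWeakDeriv_fn.weakD_tens k) hu hux)
  · exact hasWeakDerivY_lp_iff.2 (weakD_of_modes hY (fun k => weakD_partialY_tens k _) hu huy)
  · exact hasWeakDerivX_lp_iff.2
      (weakD_of_modes hX (fun k => (w k).hasWeakDeriv_d1.weakD_tens k) hux huxx)
  · exact hasWeakDerivY_lp_iff.2 (weakD_of_modes hY (fun k => weakD_partialY_tens k _) hux huxy)
  · exact hasWeakDerivY_lp_iff.2 (weakD_of_modes hY (fun k => weakD_partialY_tens k _) huy huyy)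

theorem norm_sq_le_of_modes {w : ℤ → H2Line n} (hw : Summable (mTerm w)) {u : L2Strip n}
    (h : ∀ k, ‖modeR k u‖ ^ 2 ≤ mTerm w k) : ‖u‖ ^ 2 ≤ 2 * Real.pi * mNormSq w := by
  rw [norm_sq_eq_tsum_modeR]
  exact mul_le_mul_of_nonneg_left ((summable_norm_sq_modeR u).tsum_le_tsum h hw) (by positivity)

namespace IsSynth

variable {w v : ℤ → H2Line n} {u ux uy u' ux' uy' : L2Strip n}

theorem sub (h : IsSynth w u ux uy) (h' : IsSynth v u' ux' uy') :
    IsSynth (w - v) (u - u') (ux - ux') (uy - uy') where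
  mode k := by rw [map_sub, h.mode, h'.mode]; rfl
  mode_x k := by rw [map_sub, h.mode_x, h'.mode_x]; rfl
  mode_y k := by rw [map_sub, h.mode_y, h'.mode_y, ← smul_sub]; rfl

theorem norm_sq_le (h : IsSynth w u ux uy) (hw : Summable (mTerm w)) :
    ‖u‖ ^ 2 ≤ 2 * Real.pi * mNormSq w :=
  norm_sq_le_of_modes hw fun k => by rw [h.mode]; exact norm_fn_sq_le w k

theorem norm_x_sq_le (h : IsSynth w u ux uy) (hw : Summable (mTerm w)) :
    ‖ux‖ ^ 2 ≤ 2 * Real.pi * mNormSq w :=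
  norm_sq_le_of_modes hw fun k => by rw [h.mode_x]; exact norm_d1_sq_le w k

theorem norm_y_sq_le (h : IsSynth w u ux uy) (hw : Summable (mTerm w)) :
    ‖uy‖ ^ 2 ≤ 2 * Real.pi * mNormSq w :=
  norm_sq_le_of_modes hw fun k => by rw [h.mode_y]; exact norm_Ik_smul_fn_sq_le w k

end IsSynth

/-! ### Uniform bounds -/

/-- The bound `‖u‖ + ‖u'‖` for the supremum norm of an `H²` function on the line. -/
def supBound (U : H2Line n) : ℝ := ‖U.fn‖ + ‖U.d1‖

theorem supBound_nonneg (U : H2Line n) : 0 ≤ supBound U := by unfold supBound; positivity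

theorem summable_inv_max_sq : Summable fun k : ℤ => (max ((k : ℝ) ^ 2) 1)⁻¹ := by
  have h : Summable fun k : ℤ => ((k : ℝ) ^ 2)⁻¹ := by
    simpa using Real.summable_one_div_int_pow.2 (one_lt_two)
  have h0 : Summable fun k : ℤ => if k = 0 then (1 : ℝ) else 0 :=
    summable_of_hasFiniteSupport
      ((Set.finite_singleton 0).subset fun k hk => by by_contra h; exact hk (if_neg h))
  refine (h.add h0).of_nonneg_of_le (fun k => by positivity) fun k => ?_
  by_cases hk : k = 0
  · simp [hk]
  · rw [if_neg hk, add_zero]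
    have : 0 < (k : ℝ) ^ 2 := by positivity
    exact inv_anti₀ this (le_max_left _ _)

/-- The constant `∑_k 1 / max(k², 1)` of the embedding of `M` into bounded functions. -/
def embConst : ℝ := ∑' k : ℤ, (max ((k : ℝ) ^ 2) 1)⁻¹

theorem sum_supBound_sq_le {w : ℤ → H2Line n} (hw : Summable (mTerm w)) (s : Finset ℤ) :
    (∑ k ∈ s, supBound (w k)) ^ 2 ≤ 2 * embConst * mNormSq w := by
  have h1 := Finset.sum_sq_le_sum_mul_sum_of_sq_le_mul s (r := fun k => supBound (w k))
    (f := fun k : ℤ => (max ((k : ℝ) ^ 2) 1)⁻¹) (g := fun k => 2 * mTerm w k)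
    (fun k _ => by positivity) (fun k _ => mul_nonneg two_pos.le (mTerm_nonneg w k))
    (fun k _ => by
      have hp : 0 < max ((k : ℝ) ^ 2) 1 := by positivity
      rw [inv_mul_eq_div, le_div_iff₀ hp]
      have h2 := max_mul_norm_fn_d1_le w k
      have h3 : supBound (w k) ^ 2 ≤ 2 * (‖(w k).fn‖ ^ 2 + ‖(w k).d1‖ ^ 2) := by
        unfold supBound
        nlinarith [sq_nonneg (‖(w k).fn‖ - ‖(w k).d1‖)]
      nlinarith [mul_le_mul_of_nonneg_left h3 hp.le])
  refine h1.trans ?_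
  rw [← Finset.mul_sum]
  have h2 : ∑ k ∈ s, (max ((k : ℝ) ^ 2) 1)⁻¹ ≤ embConst :=
    summable_inv_max_sq.sum_le_tsum s fun _ _ => by positivity
  have h3 : ∑ k ∈ s, mTerm w k ≤ mNormSq w := hw.sum_le_tsum s fun k _ => mTerm_nonneg w k
  have h4 : 0 ≤ ∑ k ∈ s, mTerm w k := Finset.sum_nonneg fun k _ => mTerm_nonneg w k
  have h5 : 0 ≤ ∑ k ∈ s, (max ((k : ℝ) ^ 2) 1)⁻¹ := Finset.sum_nonneg fun k _ => by positivity
  nlinarith [mul_le_mul h2 h3 h4 (h5.trans h2)]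

theorem embConst_nonneg : 0 ≤ embConst := tsum_nonneg fun k => by positivity

theorem summable_supBound {w : ℤ → H2Line n} (hw : Summable (mTerm w)) :
    Summable fun k => supBound (w k) :=
  summable_of_sum_le (c := Real.sqrt (2 * embConst * mNormSq w)) (fun _ => supBound_nonneg _)
    fun s => Real.le_sqrt_of_sq_le (sum_supBound_sq_le hw s)

theorem tsum_supBound_le {w : ℤ → H2Line n} (hw : Summable (mTerm w)) :
    ∑' k, supBound (w k) ≤ Real.sqrt (2 * embConst * mNormSq w) :=
  (summable_supBound hw).tsum_le_of_sum_le
    fun s => Real.le_sqrt_of_sq_le (sum_supBound_sq_le hw s)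

/-- Bounds almost everywhere pass to limits in `L²`, along a subsequence. -/
theorem ae_norm_le_of_tendsto {α E ι : Type*} [MeasurableSpace α] {μ : Measure α}
    [NormedAddCommGroup E] {l : Filter ι} [l.NeBot] [l.IsCountablyGenerated]
    {f : ι → Lp E 2 μ} {g : Lp E 2 μ} (hfg : Tendsto f l (𝓝 g)) {c : ℝ}
    (h : ∀ᶠ i in l, ∀ᵐ p ∂μ, ‖f i p‖ ≤ c) : ∀ᵐ p ∂μ, ‖g p‖ ≤ c := by
  obtain ⟨ns, h1, h2⟩ := (tendstoInMeasure_of_tendsto_Lp hfg).exists_seq_tendsto_ae'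
  obtain ⟨N, hN⟩ := eventually_atTop.1 (h1.eventually h)
  have h3 : ∀ᵐ p ∂μ, ∀ i : ℕ, N ≤ i → ‖f (ns i) p‖ ≤ c := by
    rw [ae_all_iff]
    intro i
    by_cases hi : N ≤ i
    · filter_upwards [hN i hi] with p hp _ using hp
    · exact ae_of_all _ fun p h => (hi h).elim
  filter_upwards [h2, h3] with p hp1 hp2
  exact le_of_tendsto hp1.norm (eventually_atTop.2 ⟨N, hp2⟩)

/-- The classical partial sum `Re ∑_{k ∈ s} w_k(x) e^{iky}`. -/
def sumFn (w : ℤ → H2Line n) (s : Finset ℤ) (p : Strip) : RVec n :=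
  reVL n (∑ k ∈ s, fourier k p.2 • (w k).rep p.1)

/-- The `x`-derivative of the classical partial sum. -/
def sumFnX (w : ℤ → H2Line n) (s : Finset ℤ) (p : Strip) : RVec n :=
  reVL n (∑ k ∈ s, fourier k p.2 • (w k).rep' p.1)

/-- The `y`-derivative of the classical partial sum. -/
def sumFnY (w : ℤ → H2Line n) (s : Finset ℤ) (p : Strip) : RVec n :=
  reVL n (∑ k ∈ s, (Complex.I * (k : ℂ) * fourier k p.2) • (w k).rep p.1)

theorem continuous_sumFn (w : ℤ → H2Line n) (s : Finset ℤ) : Continuous (sumFn w s) :=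
  (reVL n).continuous.comp (continuous_finsetSum s fun k _ =>
    ((fourier k).continuous.comp continuous_snd).smul
      ((w k).continuous_rep.comp continuous_fst))

theorem continuous_sumFnX (w : ℤ → H2Line n) (s : Finset ℤ) : Continuous (sumFnX w s) :=
  (reVL n).continuous.comp (continuous_finsetSum s fun k _ =>
    ((fourier k).continuous.comp continuous_snd).smul
      ((w k).continuous_rep'.comp continuous_fst))

theorem continuous_sumFnY (w : ℤ → H2Line n) (s : Finset ℤ) : Continuous (sumFnY w s) :=
  (reVL n).continuous.comp (continuous_finsetSum s fun k _ =>
    (continuous_const.mul ((fourier k).continuous.comp continuous_snd)).smul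
      ((w k).continuous_rep.comp continuous_fst))

theorem hasDerivAt_sumFn_x (w : ℤ → H2Line n) (s : Finset ℤ) (x : ℝ) (y : Circ) :
    HasDerivAt (fun x => sumFn w s (x, y)) (sumFnX w s (x, y)) x :=
  (reVL n).hasFDerivAt.comp_hasDerivAt x
    (HasDerivAt.fun_sum fun k _ => ((w k).hasDerivAt_rep x).const_smul (fourier k y))

theorem hasDerivAt_sumFn_y (w : ℤ → H2Line n) (s : Finset ℤ) (p : Strip) :
    HasDerivAt (fun t : ℝ => sumFn w s (p.1, p.2 + (t : Circ))) (sumFnY w s p) 0 :=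
  (reVL n).hasFDerivAt.comp_hasDerivAt 0
    (HasDerivAt.fun_sum fun k _ => (hasDerivAt_fourier_circ k p.2).smul_const ((w k).rep p.1))

theorem ae_coeFn_partialStrip (a : ℤ → L2Line n) (b : ℤ → ℝ → CVec n)
    (h : ∀ k, (a k : ℝ → CVec n) =ᵐ[volume] b k) (s : Finset ℤ) :
    partialStrip a s =ᵐ[volume] fun p => reVL n (∑ k ∈ s, fourier k p.2 • b k p.1) := by
  have h1 : ∀ᵐ p : Strip, ∀ k, tens k (a k) p = fourier k p.2 • b k p.1 := by
    rw [ae_all_iff]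
    intro k
    have h2 : ∀ᵐ p : Strip, a k p.1 = b k p.1 := Measure.quasiMeasurePreserving_fst.ae (h k)
    filter_upwards [coeFn_tens k (a k), h2] with p hp1 hp2
    rw [hp1, tensFn, hp2]
  filter_upwards [h1, coeFn_stripRe (∑ k ∈ s, tens k (a k)),
    Lp.coeFn_finsetSum s fun k => tens k (a k)] with p hp1 hp2 hp3
  rw [partialStrip, hp2, hp3, Finset.sum_apply]
  simp only [hp1]
  rfl

theorem ae_partialStrip_fn (w : ℤ → H2Line n) (s : Finset ℤ) :
    partialStrip (fun k => (w k).fn) s =ᵐ[volume] sumFn w s :=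
  ae_coeFn_partialStrip _ (fun k => (w k).rep) (fun k => (w k).fn_ae_eq) s

theorem ae_partialStrip_d1 (w : ℤ → H2Line n) (s : Finset ℤ) :
    partialStrip (fun k => (w k).d1) s =ᵐ[volume] sumFnX w s :=
  ae_coeFn_partialStrip _ (fun k => (w k).rep') (fun k => (w k).d1_ae_eq) s

theorem ae_partialStrip_y (w : ℤ → H2Line n) (s : Finset ℤ) :
    partialStrip (fun k => (Complex.I * (k : ℂ)) • (w k).fn) s =ᵐ[volume] sumFnY w s := by
  refine (ae_coeFn_partialStrip _ (fun k x => (Complex.I * (k : ℂ)) • (w k).rep x)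
    (fun k => ?_) s).trans (ae_of_all _ fun p => ?_)
  · filter_upwards [Lp.coeFn_smul (Complex.I * (k : ℂ)) (w k).fn, (w k).fn_ae_eq] with x h1 h2
    rw [h1, Pi.smul_apply, h2]
  · simp only [sumFnY, smul_smul, mul_comm]

theorem norm_sum_le_supBound (w : ℤ → H2Line n) (s : Finset ℤ) (p : Strip) :
    ‖∑ k ∈ s, fourier k p.2 • (w k).rep p.1‖ ≤ ∑ k ∈ s, supBound (w k) :=
  norm_sum_le_of_le s fun k _ => by
    rw [norm_smul, norm_fourier_apply, one_mul]
    exact (w k).norm_rep_le p.1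

theorem norm_sumFn_le (w : ℤ → H2Line n) (s : Finset ℤ) (p : Strip) :
    ‖sumFn w s p‖ ≤ ∑ k ∈ s, supBound (w k) :=
  (norm_reV_le _).trans (norm_sum_le_supBound w s p)

theorem norm_sumFn_sub_le (w : ℤ → H2Line n) {s t : Finset ℤ} (hst : s ⊆ t) (p : Strip) :
    ‖sumFn w t p - sumFn w s p‖ ≤ ∑ k ∈ t, supBound (w k) - ∑ k ∈ s, supBound (w k) := by
  rw [sumFn, sumFn, ← map_sub, ← Finset.sum_sdiff hst, ← Finset.sum_sdiff hst, add_sub_cancel_right,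
    add_sub_cancel_right]
  exact (norm_reV_le _).trans (norm_sum_le_supBound w _ p)

namespace IsSynth

variable {w : ℤ → H2Line n} {u ux uy : L2Strip n}

/-- The Sobolev embedding: functions with modes in `M` are bounded. -/
theorem ae_norm_le (h : IsSynth w u ux uy) (hw : Summable (mTerm w)) :
    ∀ᵐ p, ‖u p‖ ≤ ∑' k, supBound (w k) :=
  ae_norm_le_of_tendsto (tendsto_partialStrip h.mode) (Eventually.of_forall fun s => by
    filter_upwards [ae_partialStrip_fn w s] with p hp
    rw [hp]
    exact (norm_sumFn_le w s p).trans
      ((summable_supBound hw).sum_le_tsum s fun _ _ => supBound_nonneg _))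

/-- Partial sums converge uniformly. -/
theorem ae_norm_sub_le (h : IsSynth w u ux uy) (hw : Summable (mTerm w)) (s : Finset ℤ) :
    ∀ᵐ p, ‖partialStrip (fun k => (w k).fn) s p - u p‖ ≤
      ∑' k, supBound (w k) - ∑ k ∈ s, supBound (w k) := by
  have h1 : Tendsto (fun t => partialStrip (fun k => (w k).fn) t
      - partialStrip (fun k => (w k).fn) s) atTop
      (𝓝 (u - partialStrip (fun k => (w k).fn) s)) := (tendsto_partialStrip h.mode).sub_const _
  have h2 := ae_norm_le_of_tendsto (c := ∑' k, supBound (w k) - ∑ k ∈ s, supBound (w k)) h1 (by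
    filter_upwards [eventually_ge_atTop s] with t ht
    filter_upwards [ae_partialStrip_fn w s, ae_partialStrip_fn w t,
      Lp.coeFn_sub (partialStrip (fun k => (w k).fn) t) (partialStrip (fun k => (w k).fn) s)]
      with p h1 h2 h3
    rw [h3, Pi.sub_apply, h1, h2]
    refine (norm_sumFn_sub_le w ht p).trans (sub_le_sub_right ?_ _)
    exact (summable_supBound hw).sum_le_tsum t fun _ _ => supBound_nonneg _)
  filter_upwards [h2, Lp.coeFn_sub u (partialStrip (fun k => (w k).fn) s)] with p hp1 hp2
  rw [hp2, Pi.sub_apply, norm_sub_rev] at hp1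
  exact hp1

end IsSynth

/-! ### Pointwise estimates for Taylor remainders -/

/-- The Taylor remainder `f(v + U) - f(U) - Df(U) v`. -/
def taylorRem (f : RVec n → RVec n) (U v : RVec n) : RVec n := f (v + U) - f U - fderiv ℝ f U v

/-- The derivative of the Taylor remainder `f(v + U) - f(U) - Df(U) v` along a curve on which `U`
has derivative `W` and `v` has derivative `q`. -/
def taylorRemDeriv (f : RVec n → RVec n) (U W v q : RVec n) : RVec n :=
  (fderiv ℝ f (v + U) - fderiv ℝ f U) q +
    (fderiv ℝ f (v + U) W - fderiv ℝ f U W - fderiv ℝ (fderiv ℝ f) U W v)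

/-- On the balls of radius `ρ` around the points of norm at most `C`, the derivative `Df` is
`L`-Lipschitz and is, up to an `η`-Lipschitz error, given by its linearization at the centre. -/
structure TaylorBound (f : RVec n → RVec n) (C ρ L η : ℝ) : Prop where
  nonneg : 0 ≤ L
  nonneg' : 0 ≤ η
  rho_nonneg : 0 ≤ ρ
  lip : ∀ U v v' : RVec n, ‖U‖ ≤ C → ‖v‖ ≤ ρ → ‖v'‖ ≤ ρ →
    ‖fderiv ℝ f (v + U) - fderiv ℝ f (v' + U)‖ ≤ L * ‖v - v'‖
  second : ∀ U v v' : RVec n, ‖U‖ ≤ C → ‖v‖ ≤ ρ → ‖v'‖ ≤ ρ →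
    ‖fderiv ℝ f (v + U) - fderiv ℝ f (v' + U) - fderiv ℝ (fderiv ℝ f) U (v - v')‖ ≤ η * ‖v - v'‖

/-- Both bounds follow from the mean value inequality for `Df`. -/
theorem taylorBound_of {f : RVec n → RVec n} (hf : ContDiff ℝ 2 f) {C ρ L η : ℝ} (hρ : 0 ≤ ρ)
    (hL : 0 ≤ L) (hη : 0 ≤ η) (h1 : ∀ z, ‖z‖ ≤ C + ρ → ‖fderiv ℝ (fderiv ℝ f) z‖ ≤ L)
    (h2 : ∀ U z, ‖U‖ ≤ C → ‖z - U‖ ≤ ρ →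
      ‖fderiv ℝ (fderiv ℝ f) z - fderiv ℝ (fderiv ℝ f) U‖ ≤ η) : TaylorBound f C ρ L η := by
  have k1 : Differentiable ℝ (fderiv ℝ f) :=
    (hf.fderiv_right (m := 1) (by norm_num)).differentiable (by norm_num)
  have hmem : ∀ U v : RVec n, ‖v‖ ≤ ρ → v + U ∈ Metric.closedBall U ρ := fun U v hv => by
    rw [Metric.mem_closedBall, dist_eq_norm, add_sub_cancel_right]; exact hv
  refine ⟨hL, hη, hρ, fun U v v' hU hv hv' => ?_, fun U v v' hU hv hv' => ?_⟩
  · have := (convex_closedBall U ρ).norm_image_sub_le_of_norm_fderiv_le (𝕜 := ℝ)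
      (f := fderiv ℝ f) (C := L)
      (fun z _ => k1 z) (fun z hz => h1 z ?_) (hmem U v' hv') (hmem U v hv)
    · rwa [add_sub_add_right_eq_sub] at this
    · rw [Metric.mem_closedBall, dist_eq_norm] at hz
      have := norm_add_le U (z - U)
      rw [add_sub_cancel] at this
      linarith
  · have := (convex_closedBall U ρ).norm_image_sub_le_of_norm_fderiv_le' (𝕜 := ℝ)
      (f := fderiv ℝ f) (φ := fderiv ℝ (fderiv ℝ f) U) (C := η)
      (fun z _ => k1 z) (fun z hz => h2 U z hU ?_) (hmem U v' hv') (hmem U v hv)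
    · rwa [add_sub_add_right_eq_sub] at this
    · rwa [Metric.mem_closedBall, dist_eq_norm] at hz

theorem exists_fderiv2_bound {f : RVec n → RVec n} (hf : ContDiff ℝ 2 f) (C : ℝ) :
    ∃ L : ℝ, 0 ≤ L ∧ ∀ z, ‖z‖ ≤ C → ‖fderiv ℝ (fderiv ℝ f) z‖ ≤ L :=
  exists_bound_comp (E := RVec n →L[ℝ] RVec n →L[ℝ] RVec n)
    ((hf.fderiv_right (m := 1) (by norm_num)).continuous_fderiv (by norm_num)) C

theorem exists_taylorBound {f : RVec n → RVec n} (hf : ContDiff ℝ 2 f) (C : ℝ) {ρ : ℝ}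
    (hρ : 0 ≤ ρ) : ∃ L η : ℝ, TaylorBound f C ρ L η := by
  obtain ⟨L, hL, h⟩ := exists_fderiv2_bound hf (C + ρ)
  refine ⟨L, L + L, taylorBound_of hf hρ hL (by positivity) h fun U z hU hz => ?_⟩
  have h0 := norm_add_le U (z - U)
  rw [add_sub_cancel] at h0
  have h1 := h z (by linarith)
  have h2 := h U (by linarith)
  have h3 := norm_sub_le (fderiv ℝ (fderiv ℝ f) z) (fderiv ℝ (fderiv ℝ f) U)
  linarith

/-- On small balls, the error of the linearization of `Df` has a small Lipschitz constant. -/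
theorem exists_taylorBound_small {f : RVec n → RVec n} (hf : ContDiff ℝ 2 f) (C : ℝ) :
    ∃ L : ℝ, 0 ≤ L ∧ ∀ η > 0, ∀ ρ₀ > 0, ∃ ρ > 0, ρ ≤ ρ₀ ∧ TaylorBound f C ρ L η := by
  obtain ⟨L, hL, h⟩ := exists_fderiv2_bound hf (C + 1)
  refine ⟨L, hL, fun η hη ρ₀ hρ₀ => ?_⟩
  have hc : Continuous (fderiv ℝ (fderiv ℝ f)) :=
    (hf.fderiv_right (m := 1) (by norm_num)).continuous_fderiv (by norm_num)
  have hco : ContinuousOn (fderiv ℝ (fderiv ℝ f)) (Metric.closedBall 0 (C + 1)) := hc.continuousOn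
  have huc := (isCompact_closedBall (0 : RVec n) (C + 1)).uniformContinuousOn_of_continuous
    (β := RVec n →L[ℝ] RVec n →L[ℝ] RVec n) hco
  obtain ⟨δ, hδ, hδ'⟩ := Metric.uniformContinuousOn_iff
    (β := RVec n →L[ℝ] RVec n →L[ℝ] RVec n).1 huc η hη
  refine ⟨min (min (δ / 2) 1) ρ₀, by positivity, min_le_right _ _, ?_⟩
  have m1 : min (min (δ / 2) 1) ρ₀ ≤ δ / 2 := (min_le_left _ _).trans (min_le_left _ _)
  have m2 : min (min (δ / 2) 1) ρ₀ ≤ 1 := (min_le_left _ _).trans (min_le_right _ _)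
  refine taylorBound_of hf (by positivity) hL hη.le (fun z hz => h z (by linarith))
    fun U z hU hz => ?_
  have hz' : ‖z‖ ≤ C + 1 := by
    have := norm_add_le U (z - U)
    rw [add_sub_cancel] at this
    linarith
  have := hδ' z (mem_closedBall_zero_iff.2 hz') U (mem_closedBall_zero_iff.2 (by linarith))
    (by rw [dist_eq_norm]; linarith)
  have he := dist_eq_norm (fderiv ℝ (fderiv ℝ f) z) (fderiv ℝ (fderiv ℝ f) U)
  exact he ▸ this.le

theorem fderiv2_symm {f : RVec n → RVec n} (hf : ContDiff ℝ 2 f) (U v w : RVec n) :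
    fderiv ℝ (fderiv ℝ f) U v w = fderiv ℝ (fderiv ℝ f) U w v :=
  (hf.contDiffAt.isSymmSndFDerivAt (by simp)).eq v w

namespace TaylorBound

variable {f : RVec n → RVec n} {C ρ L η : ℝ}

theorem norm_taylorRem_sub_le (h : TaylorBound f C ρ L η) (hf : ContDiff ℝ 2 f) {U v v' : RVec n}
    (hU : ‖U‖ ≤ C) (hv : ‖v‖ ≤ ρ) (hv' : ‖v'‖ ≤ ρ) :
    ‖taylorRem f U v - taylorRem f U v'‖ ≤ L * ρ * ‖v - v'‖ := by
  have hd : Differentiable ℝ f := hf.differentiable (by norm_num)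
  have hmem : ∀ v : RVec n, ‖v‖ ≤ ρ → v + U ∈ Metric.closedBall U ρ := fun v hv => by
    rw [Metric.mem_closedBall, dist_eq_norm, add_sub_cancel_right]; exact hv
  have := (convex_closedBall U ρ).norm_image_sub_le_of_norm_fderiv_le' (𝕜 := ℝ)
    (f := f) (φ := fderiv ℝ f U) (C := L * ρ) (fun z _ => hd z) (fun z hz => ?_)
    (hmem v' hv') (hmem v hv)
  · rw [add_sub_add_right_eq_sub] at this
    refine le_trans (le_of_eq ?_) this
    rw [taylorRem, taylorRem, map_sub]
    congr 1
    abel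
  · rw [Metric.mem_closedBall, dist_eq_norm] at hz
    have h1 := h.lip U (z - U) 0 hU hz (by simpa using h.rho_nonneg)
    rw [sub_add_cancel, zero_add, sub_zero] at h1
    exact h1.trans (mul_le_mul_of_nonneg_left hz h.nonneg)

theorem norm_taylorRemDeriv_sub_le (h : TaylorBound f C ρ L η) (hf : ContDiff ℝ 2 f)
    {U W v v' q q' : RVec n} (hU : ‖U‖ ≤ C) (hW : ‖W‖ ≤ C) (hv : ‖v‖ ≤ ρ) (hv' : ‖v'‖ ≤ ρ) :
    ‖taylorRemDeriv f U W v q - taylorRemDeriv f U W v' q'‖ ≤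
      L * ‖v - v'‖ * ‖q‖ + L * ρ * ‖q - q'‖ + η * C * ‖v - v'‖ := by
  -- The symmetry of `D²f` turns `D²f(U) W v` into `D²f(U) v W`, which matches `TaylorBound.second`.
  have e : taylorRemDeriv f U W v q - taylorRemDeriv f U W v' q' =
      (fderiv ℝ f (v + U) - fderiv ℝ f (v' + U)) q
      + (fderiv ℝ f (v' + U) - fderiv ℝ f (0 + U)) (q - q')
      + (fderiv ℝ f (v + U) - fderiv ℝ f (v' + U) - fderiv ℝ (fderiv ℝ f) U (v - v')) W := by
    simp only [taylorRemDeriv, _root_.sub_apply, map_sub, zero_add]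
    rw [fderiv2_symm hf U W v, fderiv2_symm hf U W v']
    abel
  have h1 := h.lip U v v' hU hv hv'
  have h2 := h.lip U v' 0 hU hv' (by simpa using h.rho_nonneg)
  rw [sub_zero] at h2
  have h3 := h.second U v v' hU hv hv'
  rw [e]
  refine norm_add₃_le.trans (add_le_add (add_le_add ?_ ?_) ?_)
  · exact (ContinuousLinearMap.le_opNorm _ _).trans
      (mul_le_mul_of_nonneg_right h1 (norm_nonneg _))
  · refine (ContinuousLinearMap.le_opNorm _ _).trans
      (mul_le_mul_of_nonneg_right (h2.trans ?_) (norm_nonneg _))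
    exact mul_le_mul_of_nonneg_left hv' h.nonneg
  · refine (ContinuousLinearMap.le_opNorm _ _).trans ?_
    have := mul_le_mul h3 hW (norm_nonneg _) (mul_nonneg h.nonneg' (norm_nonneg _))
    linarith

end TaylorBound

theorem taylorRem_zero (f : RVec n → RVec n) (U : RVec n) : taylorRem f U 0 = 0 := by
  simp [taylorRem]

theorem taylorRemDeriv_zero (f : RVec n → RVec n) (U W : RVec n) :
    taylorRemDeriv f U W 0 0 = 0 := by
  simp [taylorRemDeriv]

theorem continuous_taylorRem {f : RVec n → RVec n} (hf : ContDiff ℝ 2 f) :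
    Continuous fun t : RVec n × RVec n => taylorRem f t.1 t.2 := by
  have c0 := hf.continuous
  have c1 : Continuous (fderiv ℝ f) := hf.continuous_fderiv (by norm_num)
  unfold taylorRem
  fun_prop

theorem continuous_taylorRemDeriv {f : RVec n → RVec n} (hf : ContDiff ℝ 2 f) :
    Continuous fun t : (RVec n × RVec n) × (RVec n × RVec n) =>
      taylorRemDeriv f t.1.1 t.1.2 t.2.1 t.2.2 := by
  have c1 : Continuous (fderiv ℝ f) := hf.continuous_fderiv (by norm_num)
  have c2 : Continuous (fderiv ℝ (fderiv ℝ f)) :=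
    (hf.fderiv_right (m := 1) (by norm_num)).continuous_fderiv (by norm_num)
  unfold taylorRemDeriv
  fun_prop

section Composition

variable {X : Type*} {f : RVec n → RVec n} {U W v q : X → RVec n}

theorem continuous_taylorRem_comp [TopologicalSpace X] (hf : ContDiff ℝ 2 f) (hU : Continuous U)
    (hv : Continuous v) : Continuous fun x => taylorRem f (U x) (v x) := by
  have h := (continuous_taylorRem hf).comp (hU.prodMk hv)
  simpa only [Function.comp_def] using h

theorem continuous_taylorRemDeriv_comp [TopologicalSpace X] (hf : ContDiff ℝ 2 f)
    (hU : Continuous U) (hW : Continuous W) (hv : Continuous v) (hq : Continuous q) :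
    Continuous fun x => taylorRemDeriv f (U x) (W x) (v x) (q x) := by
  have h := (continuous_taylorRemDeriv hf).comp ((hU.prodMk hW).prodMk (hv.prodMk hq))
  simpa only [Function.comp_def] using h

theorem aestronglyMeasurable_taylorRem_comp [MeasurableSpace X] {μ : Measure X}
    (hf : ContDiff ℝ 2 f) (hU : AEStronglyMeasurable U μ) (hv : AEStronglyMeasurable v μ) :
    AEStronglyMeasurable (fun x => taylorRem f (U x) (v x)) μ := by
  have h := (continuous_taylorRem hf).comp_aestronglyMeasurable (hU.prodMk hv)
  simpa only [Function.comp_def] using h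

theorem aestronglyMeasurable_taylorRemDeriv_comp [MeasurableSpace X] {μ : Measure X}
    (hf : ContDiff ℝ 2 f) (hU : AEStronglyMeasurable U μ) (hW : AEStronglyMeasurable W μ)
    (hv : AEStronglyMeasurable v μ) (hq : AEStronglyMeasurable q μ) :
    AEStronglyMeasurable (fun x => taylorRemDeriv f (U x) (W x) (v x) (q x)) μ := by
  have h := (continuous_taylorRemDeriv hf).comp_aestronglyMeasurable
    ((hU.prodMk hW).prodMk (hv.prodMk hq))
  simpa only [Function.comp_def] using h

end Composition

/-- The chain rule for the Taylor remainder. -/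
theorem hasDerivAt_taylorRem {f : RVec n → RVec n} (hf : ContDiff ℝ 2 f) {U v : ℝ → RVec n}
    {W q : RVec n} {x : ℝ} (hU : HasDerivAt U W x) (hv : HasDerivAt v q x) :
    HasDerivAt (fun s => taylorRem f (U s) (v s)) (taylorRemDeriv f (U x) W (v x) q) x := by
  have d0 : Differentiable ℝ f := hf.differentiable (by norm_num)
  have d1 : Differentiable ℝ (fderiv ℝ f) :=
    (hf.fderiv_right (m := 1) (by norm_num)).differentiable (by norm_num)
  have h1 := (d0 (v x + U x)).hasFDerivAt.comp_hasDerivAt x (hv.add hU)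
  have h2 := (d0 (U x)).hasFDerivAt.comp_hasDerivAt x hU
  have h3 := ((d1 (U x)).hasFDerivAt.comp_hasDerivAt x hU).clm_apply hv
  convert! (h1.sub h2).sub h3 using 1
  simp only [taylorRemDeriv, _root_.sub_apply, map_add, Function.comp_apply]
  abel

/-! ### The nonlinearity in `L²(Ω)` -/

/-- Minkowski's inequality, for a function dominated pointwise by three others. -/
theorem norm_le_of_ae_le_add {α E : Type*} [MeasurableSpace α] {μ : Measure α}
    [NormedAddCommGroup E] {g x y z : Lp E 2 μ} {a b c : ℝ} (ha : 0 ≤ a) (hb : 0 ≤ b) (hc : 0 ≤ c)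
    (h : ∀ᵐ p ∂μ, ‖g p‖ ≤ a * ‖x p‖ + b * ‖y p‖ + c * ‖z p‖) :
    ‖g‖ ≤ a * ‖x‖ + b * ‖y‖ + c * ‖z‖ := by
  let N : Lp E 2 μ → Lp ℝ 2 μ := fun w => (Lp.memLp w).norm.toLp _
  have hN : ∀ w, ‖N w‖ = ‖w‖ := fun w => by
    rw [Lp.norm_toLp, Lp.norm_def, eLpNorm_norm]
  have h1 : ‖g‖ ≤ ‖a • N x + b • N y + c • N z‖ := by
    refine Lp.norm_le_norm_of_ae_le ?_
    filter_upwards [h, Lp.coeFn_add (a • N x + b • N y) (c • N z), Lp.coeFn_add (a • N x) (b • N y),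
      Lp.coeFn_smul a (N x), Lp.coeFn_smul b (N y), Lp.coeFn_smul c (N z),
      (Lp.memLp x).norm.coeFn_toLp, (Lp.memLp y).norm.coeFn_toLp, (Lp.memLp z).norm.coeFn_toLp]
      with p h0 h1 h2 h3 h4 h5 h6 h7 h8
    rw [h1, Pi.add_apply, h2, Pi.add_apply, h3, h4, h5, Pi.smul_apply, Pi.smul_apply, Pi.smul_apply,
      h6, h7, h8]
    exact h0.trans (le_abs_self _)
  refine h1.trans (norm_add₃_le.trans (le_of_eq ?_))
  rw [norm_smul, norm_smul, norm_smul, hN, hN, hN, Real.norm_of_nonneg ha, Real.norm_of_nonneg hb,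
    Real.norm_of_nonneg hc]

section Nemytskii

variable {f : RVec n → RVec n} {U W : ℝ → RVec n} {C ρ L η : ℝ}

/-- The derivative of the Taylor remainder, as a function on the strip. -/
def remDerivFn (f : RVec n → RVec n) (U W : ℝ → RVec n) (v q : Strip → RVec n) : Strip → RVec n :=
  fun p => taylorRemDeriv f (U p.1) (W p.1) (v p) (q p)

theorem memLp_taylorRem (h : TaylorBound f C ρ L η) (hf : ContDiff ℝ 2 f) (hU : Continuous U)
    (hUC : ∀ x, ‖U x‖ ≤ C) {v : Strip → RVec n} (hv : MemLp v 2) (hvρ : ∀ᵐ p, ‖v p‖ ≤ ρ) :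
    MemLp (fun p : Strip => taylorRem f (U p.1) (v p)) 2 := by
  have hU1 : Continuous fun p : Strip => U p.1 := hU.comp continuous_fst
  refine hv.of_le_mul (c := L * ρ)
    (aestronglyMeasurable_taylorRem_comp hf hU1.aestronglyMeasurable hv.1) ?_
  filter_upwards [hvρ] with p hp
  have := h.norm_taylorRem_sub_le hf (hUC p.1) hp (v' := 0) (by simpa using h.rho_nonneg)
  rwa [taylorRem_zero, sub_zero, sub_zero] at this

theorem memLp_remDerivFn (h : TaylorBound f C ρ L η) (hf : ContDiff ℝ 2 f) (hU : Continuous U)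
    (hUC : ∀ x, ‖U x‖ ≤ C) (hW : Continuous W) (hWC : ∀ x, ‖W x‖ ≤ C) {v q : Strip → RVec n}
    (hv : MemLp v 2) (hq : MemLp q 2) (hvρ : ∀ᵐ p, ‖v p‖ ≤ ρ) :
    MemLp (remDerivFn f U W v q) 2 := by
  have hb : MemLp (fun p => (L * ρ + L * ρ) * ‖q p‖ + η * C * ‖v p‖) 2 :=
    (hq.norm.const_mul _).add (hv.norm.const_mul _)
  have hU1 : Continuous fun p : Strip => U p.1 := hU.comp continuous_fst
  have hW1 : Continuous fun p : Strip => W p.1 := hW.comp continuous_fst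
  refine hb.mono (aestronglyMeasurable_taylorRemDeriv_comp hf hU1.aestronglyMeasurable
    hW1.aestronglyMeasurable hv.1 hq.1) ?_
  filter_upwards [hvρ] with p hp
  have := h.norm_taylorRemDeriv_sub_le hf (hUC p.1) (hWC p.1) hp (v' := 0) (q := q p) (q' := 0)
    (by simpa using h.rho_nonneg)
  rw [taylorRemDeriv_zero, sub_zero, sub_zero, sub_zero] at this
  have h2 := mul_le_mul_of_nonneg_right (mul_le_mul_of_nonneg_left hp h.nonneg) (norm_nonneg (q p))
  refine le_trans ?_ (le_abs_self _)
  rw [remDerivFn]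
  linarith

/-- Lipschitz estimate in `L²` for the derivative of the Taylor remainder. -/
theorem norm_remDeriv_sub_le (h : TaylorBound f C ρ L η) (hf : ContDiff ℝ 2 f)
    (hUC : ∀ x, ‖U x‖ ≤ C) (hWC : ∀ x, ‖W x‖ ≤ C) {v q v' q' G G' : L2Strip n}
    (hvρ : ∀ᵐ p, ‖v p‖ ≤ ρ) (hvρ' : ∀ᵐ p, ‖v' p‖ ≤ ρ) {d : ℝ} (hd0 : 0 ≤ d)
    (hd : ∀ᵐ p, ‖v p - v' p‖ ≤ d) (hG : G =ᵐ[volume] remDerivFn f U W v q)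
    (hG' : G' =ᵐ[volume] remDerivFn f U W v' q') :
    ‖G - G'‖ ≤ L * d * ‖q‖ + L * ρ * ‖q - q'‖ + η * C * ‖v - v'‖ := by
  have hC : 0 ≤ C := (norm_nonneg _).trans (hUC 0)
  refine norm_le_of_ae_le_add (mul_nonneg h.nonneg hd0) (mul_nonneg h.nonneg h.rho_nonneg)
    (mul_nonneg h.nonneg' hC) ?_
  filter_upwards [hvρ, hvρ', hd, hG, hG', Lp.coeFn_sub G G', Lp.coeFn_sub q q', Lp.coeFn_sub v v']
    with p h1 h2 h3 h4 h5 h6 h7 h8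
  rw [h6, h7, h8, Pi.sub_apply, Pi.sub_apply, Pi.sub_apply, h4, h5]
  refine (h.norm_taylorRemDeriv_sub_le hf (hUC p.1) (hWC p.1) h1 h2).trans ?_
  have := mul_le_mul_of_nonneg_right (mul_le_mul_of_nonneg_left h3 h.nonneg) (norm_nonneg (q p))
  linarith

theorem norm_rem_sub_le (h : TaylorBound f C ρ L η) (hf : ContDiff ℝ 2 f)
    (hUC : ∀ x, ‖U x‖ ≤ C) {v v' G G' : L2Strip n}
    (hvρ : ∀ᵐ p, ‖v p‖ ≤ ρ) (hvρ' : ∀ᵐ p, ‖v' p‖ ≤ ρ)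
    (hG : G =ᵐ[volume] fun p => taylorRem f (U p.1) (v p))
    (hG' : G' =ᵐ[volume] fun p => taylorRem f (U p.1) (v' p)) :
    ‖G - G'‖ ≤ L * ρ * ‖v - v'‖ := by
  refine Lp.norm_le_mul_norm_of_ae_le_mul ?_
  filter_upwards [hvρ, hvρ', hG, hG', Lp.coeFn_sub G G', Lp.coeFn_sub v v'] with p h1 h2 h4 h5 h6 h8
  rw [h6, h8, Pi.sub_apply, Pi.sub_apply, h4, h5]
  exact h.norm_taylorRem_sub_le hf (hUC p.1) h1 h2

/-- The chain rule for the Taylor remainder passes to limits of functions that converge uniformly,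
with derivatives converging in `L²`. -/
theorem weakD_taylorRem_of_tendsto {D : (Strip → ℝ) → Strip → ℝ}
    (hD : ∀ φ, IsTestFun φ → MemLp (D φ) 2) (h : TaylorBound f C ρ L η) (hf : ContDiff ℝ 2 f)
    (hU : Continuous U) (hUC : ∀ x, ‖U x‖ ≤ C) (hW : Continuous W) (hWC : ∀ x, ‖W x‖ ≤ C)
    {ι : Type*} {l : Filter ι} [l.NeBot] {v q : ι → L2Strip n} {u g : L2Strip n} {d : ι → ℝ}
    (hv : Tendsto v l (𝓝 u)) (hq : Tendsto q l (𝓝 g)) (hd : Tendsto d l (𝓝 0))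
    (hvρ : ∀ i, ∀ᵐ p, ‖v i p‖ ≤ ρ) (huρ : ∀ᵐ p, ‖u p‖ ≤ ρ) (hd0 : ∀ i, 0 ≤ d i)
    (hvd : ∀ i, ∀ᵐ p, ‖v i p - u p‖ ≤ d i)
    (hw : ∀ i, WeakD D (fun p => taylorRem f (U p.1) (v i p)) (remDerivFn f U W (v i) (q i))) :
    WeakD D (fun p => taylorRem f (U p.1) (u p)) (remDerivFn f U W u g) := by
  have m1 := fun i => memLp_taylorRem h hf hU hUC (Lp.memLp (v i)) (hvρ i)
  have m2 := fun i => memLp_remDerivFn h hf hU hUC hW hWC (Lp.memLp (v i)) (Lp.memLp (q i)) (hvρ i)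
  have m3 := memLp_taylorRem h hf hU hUC (Lp.memLp u) huρ
  have m4 := memLp_remDerivFn h hf hU hUC hW hWC (Lp.memLp u) (Lp.memLp g) huρ
  have nv : Tendsto (fun i => ‖v i - u‖) l (𝓝 0) := tendsto_iff_norm_sub_tendsto_zero.1 hv
  have nq : Tendsto (fun i => ‖q i - g‖) l (𝓝 0) := tendsto_iff_norm_sub_tendsto_zero.1 hq
  have t1 : Tendsto (fun i => (m1 i).toLp _) l (𝓝 (m3.toLp _)) := by
    rw [tendsto_iff_norm_sub_tendsto_zero]
    refine squeeze_zero (fun _ => norm_nonneg _) (fun i => norm_rem_sub_le h hf hUC (hvρ i) huρ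
      (m1 i).coeFn_toLp m3.coeFn_toLp) ?_
    simpa using nv.const_mul (L * ρ)
  have t2 : Tendsto (fun i => (m2 i).toLp _) l (𝓝 (m4.toLp _)) := by
    rw [tendsto_iff_norm_sub_tendsto_zero]
    refine squeeze_zero (fun _ => norm_nonneg _) (fun i => norm_remDeriv_sub_le h hf hUC hWC (hvρ i)
      huρ (hd0 i) (hvd i) (m2 i).coeFn_toLp m4.coeFn_toLp) ?_
    have := (((hd.const_mul L).mul hq.norm).add (nq.const_mul (L * ρ))).add (nv.const_mul (η * C))
    simpa using this
  have := (isClosed_weakD (E := RVec n) hD).mem_of_tendsto (t1.prodMk_nhds t2)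
    (Eventually.of_forall fun i => (hw i).congr (m1 i).coeFn_toLp.symm (m2 i).coeFn_toLp.symm)
  exact WeakD.congr this m3.coeFn_toLp m4.coeFn_toLp

variable {w : ℤ → H2Line n} {u ux uy : L2Strip n}

/-- The uniform error bound for the partial sums of the Fourier series tends to zero. -/
theorem IsSynth.tendsto_bound (hw : Summable (mTerm w)) :
    Tendsto (fun s : Finset ℤ => ∑' k, supBound (w k) - ∑ k ∈ s, supBound (w k)) atTop (𝓝 0) := by
  have := (summable_supBound hw).hasSum.const_sub (∑' k, supBound (w k))
  rwa [sub_self] at this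

theorem ae_norm_partialStrip_le (hw : Summable (mTerm w)) (s : Finset ℤ) :
    ∀ᵐ p, ‖partialStrip (fun k => (w k).fn) s p‖ ≤ ∑' k, supBound (w k) := by
  filter_upwards [ae_partialStrip_fn w s] with p hp
  rw [hp]
  exact (norm_sumFn_le w s p).trans
    ((summable_supBound hw).sum_le_tsum s fun _ _ => supBound_nonneg _)

/-- Chain rule in `x` for the Taylor remainder of a function in `H²(Ω)`. -/
theorem IsSynth.weakD_x (hs : IsSynth w u ux uy) (hw : Summable (mTerm w)) (hf : ContDiff ℝ 2 f)
    (hU : ∀ x, HasDerivAt U (W x) x) (hUC : ∀ x, ‖U x‖ ≤ C) (hW : Continuous W)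
    (hWC : ∀ x, ‖W x‖ ≤ C) (h : TaylorBound f C (∑' k, supBound (w k)) L η) :
    WeakD partialX (fun p => taylorRem f (U p.1) (u p)) (remDerivFn f U W u ux) := by
  have hUc : Continuous U := continuous_iff_continuousAt.2 fun x => (hU x).continuousAt
  refine weakD_taylorRem_of_tendsto (fun φ hφ => hφ.memLp_partialX) h hf hUc hUC hW hWC
    (tendsto_partialStrip hs.mode) (tendsto_partialStrip hs.mode_x)
    (IsSynth.tendsto_bound hw) (ae_norm_partialStrip_le hw) (hs.ae_norm_le hw)
    (fun s => sub_nonneg.2 ((summable_supBound hw).sum_le_tsum s fun _ _ => supBound_nonneg _))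
    (hs.ae_norm_sub_le hw) fun s => ?_
  have e1 := ae_partialStrip_fn w s
  have e2 := ae_partialStrip_d1 w s
  have a1 : (fun p : Strip => taylorRem f (U p.1) (sumFn w s p)) =ᵐ[volume]
      fun p => taylorRem f (U p.1) (partialStrip (fun k => (w k).fn) s p) := by
    filter_upwards [e1] with p hp
    rw [hp]
  have a2 : remDerivFn f U W (sumFn w s) (sumFnX w s) =ᵐ[volume]
      remDerivFn f U W (partialStrip (fun k => (w k).fn) s)
        (partialStrip (fun k => (w k).d1) s) := by
    filter_upwards [e1, e2] with p h1 h2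
    simp only [remDerivFn, h1, h2]
  refine WeakD.congr (weakD_partialX_of_slices ?_ ?_ fun y => ?_) a1 a2
  · exact (memLp_congr_ae a1).2
      (memLp_taylorRem h hf hUc hUC (Lp.memLp _) (ae_norm_partialStrip_le hw s))
  · exact (memLp_congr_ae a2).2 (memLp_remDerivFn h hf hUc hUC hW hWC (Lp.memLp _) (Lp.memLp _)
      (ae_norm_partialStrip_le hw s))
  · refine hasWeakDeriv_of_hasDerivAt
      (fun x => hasDerivAt_taylorRem hf (hU x) (hasDerivAt_sumFn_x w s x y)) ?_
    have hy : Continuous fun x : ℝ => ((x, y) : Strip) := continuous_id.prodMk continuous_const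
    exact continuous_taylorRemDeriv_comp hf hUc hW ((continuous_sumFn w s).comp hy)
      ((continuous_sumFnX w s).comp hy)

/-- Chain rule in `y` for the Taylor remainder of a function in `H²(Ω)`. -/
theorem IsSynth.weakD_y (hs : IsSynth w u ux uy) (hw : Summable (mTerm w)) (hf : ContDiff ℝ 2 f)
    (hUc : Continuous U) (hUC : ∀ x, ‖U x‖ ≤ C)
    (h : TaylorBound f C (∑' k, supBound (w k)) L η) :
    WeakD partialY (fun p => taylorRem f (U p.1) (u p)) (remDerivFn f U 0 u uy) := by
  have hW : Continuous (0 : ℝ → RVec n) := continuous_zero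
  have hWC : ∀ x, ‖(0 : ℝ → RVec n) x‖ ≤ C := fun x => by
    simpa using (norm_nonneg _).trans (hUC 0)
  refine weakD_taylorRem_of_tendsto (fun φ hφ => hφ.memLp_partialY) h hf hUc hUC hW hWC
    (tendsto_partialStrip hs.mode) (tendsto_partialStrip hs.mode_y)
    (IsSynth.tendsto_bound hw) (ae_norm_partialStrip_le hw) (hs.ae_norm_le hw)
    (fun s => sub_nonneg.2 ((summable_supBound hw).sum_le_tsum s fun _ _ => supBound_nonneg _))
    (hs.ae_norm_sub_le hw) fun s => ?_
  have e1 := ae_partialStrip_fn w s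
  have e2 := ae_partialStrip_y w s
  have a1 : (fun p : Strip => taylorRem f (U p.1) (sumFn w s p)) =ᵐ[volume]
      fun p => taylorRem f (U p.1) (partialStrip (fun k => (w k).fn) s p) := by
    filter_upwards [e1] with p hp
    rw [hp]
  have a2 : remDerivFn f U 0 (sumFn w s) (sumFnY w s) =ᵐ[volume]
      remDerivFn f U 0 (partialStrip (fun k => (w k).fn) s)
        (partialStrip (fun k => (Complex.I * (k : ℂ)) • (w k).fn) s) := by
    filter_upwards [e1, e2] with p h1 h2
    simp only [remDerivFn, h1, h2]
  have hx : ∀ x : ℝ, Continuous fun y : Circ => ((x, y) : Strip) := fun x =>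
    continuous_const.prodMk continuous_id
  refine WeakD.congr (weakD_partialY_of_slices ?_ ?_ (fun x => ?_) (fun x => ?_) fun p => ?_) a1 a2
  · exact (memLp_congr_ae a1).2
      (memLp_taylorRem h hf hUc hUC (Lp.memLp _) (ae_norm_partialStrip_le hw s))
  · exact (memLp_congr_ae a2).2 (memLp_remDerivFn h hf hUc hUC hW hWC (Lp.memLp _) (Lp.memLp _)
      (ae_norm_partialStrip_le hw s))
  · exact continuous_taylorRem_comp hf (U := fun _ => U x) continuous_const
      ((continuous_sumFn w s).comp (hx x))
  · exact continuous_taylorRemDeriv_comp hf (U := fun _ => U x) (W := fun _ => 0)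
      continuous_const continuous_const
      ((continuous_sumFn w s).comp (hx x)) ((continuous_sumFnY w s).comp (hx x))
  · have := hasDerivAt_taylorRem hf (hasDerivAt_const (0 : ℝ) (U p.1)) (hasDerivAt_sumFn_y w s p)
    simpa only [remDerivFn, AddCircle.coe_zero, add_zero, Pi.zero_apply, Prod.mk.eta] using this

end Nemytskii

/-! ### The nonlinearity on `M` -/

/-- A function whose modes lie in `M` is weakly differentiable. -/
theorem IsSynth.of_hasModes {w : ℤ → H2Line n} (hw : w ∈ MSpace n) {u : L2Strip n}
    (hu : HasModes u w) : ∃ ux uy, IsSynth w u ux uy := by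
  obtain ⟨v, ux, uy, hs, -⟩ := exists_isSynth hw
  have : v = u := eq_of_modeR_eq fun k => (hs.mode k).trans (modeFn_ae_eq_iff.1 (hu k)).symm
  exact ⟨ux, uy, this ▸ hs⟩

/-- The nonlinearity `𝒩[u]` of a function with modes in `M`, given by the chain rule. -/
theorem IsSynth.exists_isNonlin_iff {w : ℤ → H2Line n} {u ux uy : L2Strip n}
    (hs : IsSynth w u ux uy) (hw : Summable (mTerm w)) {f₁ f₂ : RVec n → RVec n}
    (hf₁ : ContDiff ℝ 2 f₁) (hf₂ : ContDiff ℝ 2 f₂) {ubar : ℝ → RVec n} {C : ℝ}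
    (hub : ContDiff ℝ 2 ubar) (hU : ∀ x, ‖ubar x‖ ≤ C) (hW : ∀ x, ‖deriv ubar x‖ ≤ C) :
    ∃ G₁ G₂ : L2Strip n, G₁ =ᵐ[volume] remDerivFn f₁ ubar (deriv ubar) u ux ∧
      G₂ =ᵐ[volume] remDerivFn f₂ ubar 0 u uy ∧
      ∀ F, IsNonlin f₁ f₂ ubar u F ↔ F = -G₁ - G₂ := by
  have hρ : 0 ≤ ∑' k, supBound (w k) := tsum_nonneg fun k => supBound_nonneg _
  obtain ⟨L₁, η₁, h₁⟩ := exists_taylorBound hf₁ C hρ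
  obtain ⟨L₂, η₂, h₂⟩ := exists_taylorBound hf₂ C hρ
  have hC : 0 ≤ C := (norm_nonneg _).trans (hU 0)
  have cW : Continuous (deriv ubar) := hub.continuous_deriv (by norm_num)
  have hd : ∀ x, HasDerivAt ubar (deriv ubar x) x := fun x =>
    (hub.differentiable (by norm_num) x).hasDerivAt
  have hb := hs.ae_norm_le hw
  have m₁ := memLp_remDerivFn h₁ hf₁ hub.continuous hU cW hW (Lp.memLp u) (Lp.memLp ux) hb
  have m₂ := memLp_remDerivFn h₂ hf₂ hub.continuous hU (W := 0) continuous_zero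
    (fun x => by simpa using hC) (Lp.memLp u) (Lp.memLp uy) hb
  have r₁ : MemLp (remainderFn f₁ ubar u) 2 :=
    memLp_taylorRem h₁ hf₁ hub.continuous hU (Lp.memLp u) hb
  have r₂ : MemLp (remainderFn f₂ ubar u) 2 :=
    memLp_taylorRem h₂ hf₂ hub.continuous hU (Lp.memLp u) hb
  have d₁ : WeakD partialX (remainderFn f₁ ubar u) (m₁.toLp _) :=
    WeakD.congr (hs.weakD_x hw hf₁ hd hU cW hW h₁) EventuallyEq.rfl m₁.coeFn_toLp.symm
  have d₂ : WeakD partialY (remainderFn f₂ ubar u) (m₂.toLp _) :=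
    WeakD.congr (hs.weakD_y hw hf₂ hub.continuous hU h₂) EventuallyEq.rfl m₂.coeFn_toLp.symm
  refine ⟨m₁.toLp _, m₂.toLp _, m₁.coeFn_toLp, m₂.coeFn_toLp, fun F => ⟨?_, ?_⟩⟩
  · rintro ⟨G₁, G₂, hG₁, hG₂, rfl⟩
    rw [WeakD.unique hG₁.2.2 d₁, WeakD.unique hG₂.2.2 d₂]
  · rintro rfl
    exact ⟨_, _, ⟨r₁.locallyIntegrable (by norm_num), locallyIntegrable_lp _, d₁⟩,
      ⟨r₂.locallyIntegrable (by norm_num), locallyIntegrable_lp _, d₂⟩, rfl⟩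

/-- The Lipschitz estimate for one component of the nonlinearity. -/
theorem TaylorBound.norm_sub_le_of_isSynth {f : RVec n → RVec n} {U W : ℝ → RVec n}
    {C ρ L η : ℝ} (h : TaylorBound f C ρ L η) (hf : ContDiff ℝ 2 f)
    (hUC : ∀ x, ‖U x‖ ≤ C) (hWC : ∀ x, ‖W x‖ ≤ C) {w v : ℤ → H2Line n}
    {u ux uy u' ux' uy' : L2Strip n} (hs : IsSynth w u ux uy) (hs' : IsSynth v u' ux' uy')
    (hw : w ∈ MSpace n) (hv : v ∈ MSpace n)
    (hwρ : 2 * embConst * mNormSq w ≤ ρ ^ 2) (hvρ : 2 * embConst * mNormSq v ≤ ρ ^ 2)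
    {q q' G G' : L2Strip n} (hq : ‖q‖ ^ 2 ≤ 2 * Real.pi * mNormSq w)
    (hqq : ‖q - q'‖ ^ 2 ≤ 2 * Real.pi * mNormSq (w - v))
    (hG : G =ᵐ[volume] remDerivFn f U W u q) (hG' : G' =ᵐ[volume] remDerivFn f U W u' q') :
    ‖G - G'‖ ≤ (2 * (L * ρ * √(2 * Real.pi)) + η * C * √(2 * Real.pi)) * √(mNormSq (w - v)) := by
  have hC : 0 ≤ C := (norm_nonneg _).trans (hUC 0)
  have hρ := h.rho_nonneg
  have hz : w - v ∈ MSpace n := sub_mem hw hv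
  have hb : ∀ {z : ℤ → H2Line n} {a ax ay : L2Strip n}, IsSynth z a ax ay → Summable (mTerm z) →
      2 * embConst * mNormSq z ≤ ρ ^ 2 → ∀ᵐ p, ‖a p‖ ≤ ρ := fun {z a ax ay} h1 h2 h3 => by
    filter_upwards [h1.ae_norm_le h2] with p hp
    exact hp.trans ((tsum_supBound_le h2).trans (Real.sqrt_le_iff.2 ⟨hρ, h3⟩))
  have hd : ∀ᵐ p, ‖u p - u' p‖ ≤ √(2 * embConst * mNormSq (w - v)) := by
    filter_upwards [(hs.sub hs').ae_norm_le hz.1, Lp.coeFn_sub u u'] with p h1 h2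
    rw [h2, Pi.sub_apply] at h1
    exact h1.trans (tsum_supBound_le hz.1)
  refine (norm_remDeriv_sub_le h hf hUC hWC (hb hs hw.1 hwρ) (hb hs' hv.1 hvρ)
    (Real.sqrt_nonneg _) hd hG hG').trans ?_
  have e1 : ‖q‖ ≤ √(2 * Real.pi) * √(mNormSq w) := by
    rw [← Real.sqrt_mul (by positivity)]; exact Real.le_sqrt_of_sq_le hq
  have e2 : ‖q - q'‖ ≤ √(2 * Real.pi) * √(mNormSq (w - v)) := by
    rw [← Real.sqrt_mul (by positivity)]; exact Real.le_sqrt_of_sq_le hqq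
  have e3 : ‖u - u'‖ ≤ √(2 * Real.pi) * √(mNormSq (w - v)) := by
    rw [← Real.sqrt_mul (by positivity)]
    exact Real.le_sqrt_of_sq_le ((hs.sub hs').norm_sq_le hz.1)
  have hE : 0 ≤ 2 * embConst := mul_nonneg two_pos.le embConst_nonneg
  have e4 : √(2 * embConst) * √(mNormSq w) ≤ ρ := by
    rw [← Real.sqrt_mul hE]; exact Real.sqrt_le_iff.2 ⟨hρ, hwρ⟩
  rw [Real.sqrt_mul hE]
  have t1 : √(2 * embConst) * √(mNormSq (w - v)) * ‖q‖
      ≤ ρ * √(2 * Real.pi) * √(mNormSq (w - v)) := by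
    calc _ ≤ √(2 * embConst) * √(mNormSq (w - v)) * (√(2 * Real.pi) * √(mNormSq w)) :=
          mul_le_mul_of_nonneg_left e1 (by positivity)
      _ = (√(2 * embConst) * √(mNormSq w)) * (√(2 * Real.pi) * √(mNormSq (w - v))) := by ring
      _ ≤ ρ * (√(2 * Real.pi) * √(mNormSq (w - v))) :=
          mul_le_mul_of_nonneg_right e4 (by positivity)
      _ = _ := by ring
  have t1' := mul_le_mul_of_nonneg_left t1 h.nonneg
  have t2 := mul_le_mul_of_nonneg_left e2 (mul_nonneg h.nonneg hρ)
  have t3 := mul_le_mul_of_nonneg_left e3 (mul_nonneg h.nonneg' hC)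
  calc _ ≤ L * (ρ * √(2 * Real.pi) * √(mNormSq (w - v)))
        + L * ρ * (√(2 * Real.pi) * √(mNormSq (w - v)))
        + η * C * (√(2 * Real.pi) * √(mNormSq (w - v))) := by linarith
    _ = _ := by ring

/-- The constant of `TaylorBound.norm_sub_le_of_isSynth` can be made arbitrarily small. -/
theorem exists_taylorBound_lt {f : RVec n → RVec n} (hf : ContDiff ℝ 2 f) {C : ℝ} (hC : 0 ≤ C)
    {ε : ℝ} (hε : 0 < ε) : ∃ ρ > 0, ∃ L η : ℝ, TaylorBound f C ρ L η ∧
      2 * (L * ρ * √(2 * Real.pi)) + η * C * √(2 * Real.pi) ≤ ε := by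
  obtain ⟨L, hL, h⟩ := exists_taylorBound_small hf C
  set s := √(2 * Real.pi)
  have hs : 0 ≤ s := Real.sqrt_nonneg _
  have hLs : 0 ≤ L * s := mul_nonneg hL hs
  have hCs : 0 ≤ C * s := mul_nonneg hC hs
  obtain ⟨ρ, hρ, hρ', hT⟩ := h (ε / (2 * (C * s + 1))) (by positivity)
    (ε / (4 * (L * s + 1))) (by positivity)
  refine ⟨ρ, hρ, L, _, hT, ?_⟩
  have e1 : L * ρ * s ≤ ε / 4 := by
    have : L * s * ρ ≤ L * s * (ε / (4 * (L * s + 1))) := mul_le_mul_of_nonneg_left hρ' hLs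
    have h2 : L * s * (ε / (4 * (L * s + 1))) ≤ ε / 4 := by
      rw [mul_div_assoc', div_le_div_iff₀ (by positivity) (by norm_num)]
      nlinarith
    linarith
  have e2 : ε / (2 * (C * s + 1)) * C * s ≤ ε / 2 := by
    rw [mul_assoc, div_mul_eq_mul_div, div_le_div_iff₀ (by positivity) (by norm_num)]
    nlinarith
  linarith

theorem IsNonlin.zero {f₁ f₂ : RVec n → RVec n} {ubar : ℝ → RVec n} :
    IsNonlin f₁ f₂ ubar 0 0 := by
  have h : ∀ f : RVec n → RVec n, remainderFn f ubar 0 =ᵐ[volume] (0 : L2Strip n) := fun f =>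
    ae_of_all _ fun p => by simp [remainderFn]
  have hw : ∀ D : (Strip → ℝ) → Strip → ℝ, WeakD D (0 : L2Strip n) (0 : L2Strip n) := fun D => by
    refine WeakD.congr (u := 0) (g := 0) (fun φ _ => by simp)
      (Lp.coeFn_zero _ _ _).symm (Lp.coeFn_zero _ _ _).symm
  have hl := fun f => (locallyIntegrable_lp (0 : L2Strip n)).congr (h f).symm
  exact ⟨0, 0, ⟨hl f₁, locallyIntegrable_lp _, (hw _).congr (h f₁).symm EventuallyEq.rfl⟩,
    ⟨hl f₂, locallyIntegrable_lp _, (hw _).congr (h f₂).symm EventuallyEq.rfl⟩, by simp⟩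

/-- On small balls of `M`, the nonlinearity is Lipschitz with values in `L²(Ω)`, with a small
constant. -/
theorem exists_nonlin_lipschitz {f₁ f₂ : RVec n → RVec n} (hf₁ : ContDiff ℝ 2 f₁)
    (hf₂ : ContDiff ℝ 2 f₂) {ubar : ℝ → RVec n} {C : ℝ} (hub : ContDiff ℝ 2 ubar)
    (hU : ∀ x, ‖ubar x‖ ≤ C) (hW : ∀ x, ‖deriv ubar x‖ ≤ C) {ε : ℝ} (hε : 0 < ε) :
    ∃ r > 0, ∀ w ∈ MSpace n, ∀ v ∈ MSpace n, mNormSq w ≤ r → mNormSq v ≤ r →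
      ∀ u u' F F' : L2Strip n, HasModes u w → HasModes u' v → IsNonlin f₁ f₂ ubar u F →
        IsNonlin f₁ f₂ ubar u' F' → ‖F - F'‖ ≤ ε * √(mNormSq (w - v)) := by
  have hC : 0 ≤ C := (norm_nonneg _).trans (hU 0)
  obtain ⟨ρ₁, p₁, L₁, η₁, h₁, b₁⟩ := exists_taylorBound_lt hf₁ hC (half_pos hε)
  obtain ⟨ρ₂, p₂, L₂, η₂, h₂, b₂⟩ := exists_taylorBound_lt hf₂ hC (half_pos hε)
  have hE := embConst_nonneg
  have hr : ∀ {ρ m : ℝ}, m ≤ ρ ^ 2 / (2 * embConst + 1) → 2 * embConst * m ≤ ρ ^ 2 :=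
    fun {ρ m} hm => by
      have h1 := mul_le_mul_of_nonneg_left hm (by positivity : 0 ≤ 2 * embConst)
      have h2 : 2 * embConst * (ρ ^ 2 / (2 * embConst + 1)) ≤ ρ ^ 2 := by
        rw [mul_div_assoc', div_le_iff₀ (by positivity)]
        nlinarith [sq_nonneg ρ]
      linarith
  refine ⟨min (ρ₁ ^ 2 / (2 * embConst + 1)) (ρ₂ ^ 2 / (2 * embConst + 1)), by positivity, ?_⟩
  intro w hw v hv hwr hvr u u' F F' hu hu' hF hF'
  obtain ⟨ux, uy, hs⟩ := IsSynth.of_hasModes hw hu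
  obtain ⟨ux', uy', hs'⟩ := IsSynth.of_hasModes hv hu'
  obtain ⟨G₁, G₂, g₁, g₂, hG⟩ := hs.exists_isNonlin_iff hw.1 hf₁ hf₂ hub hU hW
  obtain ⟨G₁', G₂', g₁', g₂', hG'⟩ := hs'.exists_isNonlin_iff hv.1 hf₁ hf₂ hub hU hW
  rw [(hG F).1 hF, (hG' F').1 hF']
  have hz : w - v ∈ MSpace n := sub_mem hw hv
  have k₁ := h₁.norm_sub_le_of_isSynth hf₁ hU hW hs hs' hw hv (hr (hwr.trans (min_le_left _ _)))
    (hr (hvr.trans (min_le_left _ _))) (hs.norm_x_sq_le hw.1)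
    ((hs.sub hs').norm_x_sq_le hz.1) g₁ g₁'
  have k₂ := h₂.norm_sub_le_of_isSynth hf₂ hU (W := 0) (fun x => by simpa using hC) hs hs' hw hv
    (hr (hwr.trans (min_le_right _ _))) (hr (hvr.trans (min_le_right _ _))) (hs.norm_y_sq_le hw.1)
    ((hs.sub hs').norm_y_sq_le hz.1) g₂ g₂'
  have hm : 0 ≤ √(mNormSq (w - v)) := Real.sqrt_nonneg _
  have c₁ := mul_le_mul_of_nonneg_right b₁ hm
  have c₂ := mul_le_mul_of_nonneg_right b₂ hm
  have e : -G₁ - G₂ - (-G₁' - G₂') = -((G₁ - G₁') + (G₂ - G₂')) := by abel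
  rw [e, norm_neg]
  refine (norm_add_le _ _).trans ?_
  linarith

/-! ### Inverting the linear part on the transverse modes -/

theorem mulOp_conjLp (M : C(ℝ, RVec n →L[ℝ] RVec n)) {a : ℝ} (ha : ∀ x, ‖M x‖ ≤ a)
    (u : L2Line n) : mulOp M ha (conjLp n u) = conjLp n (mulOp M ha u) := by
  refine Lp.ext ?_
  filter_upwards [coeFn_mulOp M ha (conjLp n u), coeFn_mulOp M ha u, coeFn_conjLp u,
    coeFn_conjLp (mulOp M ha u)] with x h1 h2 h3 h4
  rw [h1, h4, h2, h3, conjV_complexAct]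

theorem IsTransverse.neg {kstar k : ℤ} (h : IsTransverse kstar k) : IsTransverse kstar (-k) := by
  obtain ⟨h0, h1, h2⟩ := h
  exact ⟨by omega, by omega, by omega⟩

namespace IsCoefBound

variable {A A' B : C(ℝ, RVec n →L[ℝ] RVec n)} {a : ℝ} {kstar : ℤ}

/-- The coefficients being real, complex conjugation exchanges `ℒ_k` and `ℒ_{-k}`. -/
theorem op_neg_conj (hc : IsCoefBound A A' B a) (k : ℤ) (U : H2Line n) :
    hc.op (-k) U.conj = conjLp n (hc.op k U) := by
  have e0 : U.conj.fn = conjLp n U.fn := rfl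
  have e1 : U.conj.d1 = conjLp n U.d1 := rfl
  have e2 : U.conj.d2 = conjLp n U.d2 := rfl
  rw [op_apply, op_apply, lower_apply, lower_apply, e0, e1, e2, mulOp_conjLp, mulOp_conjLp,
    mulOp_conjLp, map_add, map_add, map_add, map_sub, conjLp_smul, conjLp_smul, star_Ik]
  simp

/-- The bound for `ℒ_k⁻¹`, summed over the transverse modes. -/
theorem summable_mTerm_and_mNormSq_le (hc : IsCoefBound A A' B a) {C : ℝ}
    (hC : ∀ k ∈ {k | IsTransverse kstar k}, ∀ U, modeNormSq k U ≤ C * ‖hc.op k U‖ ^ 2)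
    (hC0 : 0 ≤ C) {w : ℤ → H2Line n} {F : L2Strip n} (h0 : ∀ k, ¬ IsTransverse kstar k → w k = 0)
    (hw : ∀ k, IsTransverse kstar k → hc.op k (w k) = modeR k F) :
    Summable (mTerm w) ∧ mNormSq w ≤ C / (2 * Real.pi) * ‖F‖ ^ 2 := by
  have h1 : ∀ k, mTerm w k ≤ C * ‖modeR k F‖ ^ 2 := fun k => by
    by_cases hk : IsTransverse kstar k
    · rw [← hw k hk, mTerm_eq]
      exact hC k hk _
    · rw [mTerm_eq, h0 k hk]
      have : modeNormSq k (0 : H2Line n) ≤ 0 := by simpa using modeNormSq_le k (0 : H2Line n)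
      exact this.trans (by positivity)
  have h2 : Summable fun k => C * ‖modeR k F‖ ^ 2 := (summable_norm_sq_modeR F).mul_left C
  have h3 : Summable (mTerm w) := Summable.of_nonneg_of_le (mTerm_nonneg w) h1 h2
  refine ⟨h3, (h3.tsum_le_tsum h1 h2).trans (le_of_eq ?_)⟩
  rw [tsum_mul_left, norm_sq_eq_tsum_modeR]
  have := Real.pi_pos
  field_simp

/-- `F ↦ (ℒ_k⁻¹ Π_k F)_k` maps `L²(Ω; ℝⁿ)` to `M_{(0, ±k*)}`. -/
theorem exists_solve (hc : IsCoefBound A A' B a)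
    (hbij : ∀ k, IsTransverse kstar k → Function.Bijective (hc.op k)) {C : ℝ}
    (hC : ∀ k ∈ {k | IsTransverse kstar k}, ∀ U, modeNormSq k U ≤ C * ‖hc.op k U‖ ^ 2)
    (hC0 : 0 ≤ C) (F : L2Strip n) :
    ∃ w : MTrans n kstar, ∀ k, IsTransverse kstar k → hc.op k (w.1 k) = modeR k F := by
  have h : ∀ k, ∃ U : H2Line n, (IsTransverse kstar k → hc.op k U = modeR k F) ∧
      (¬ IsTransverse kstar k → U = 0) := fun k => by
    by_cases hk : IsTransverse kstar k
    · obtain ⟨U, hU⟩ := (hbij k hk).2 (modeR k F)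
      exact ⟨U, fun _ => hU, fun h => (h hk).elim⟩
    · exact ⟨0, fun h => (hk h).elim, fun _ => rfl⟩
  choose w hw h0 using h
  refine ⟨⟨w, ⟨(hc.summable_mTerm_and_mNormSq_le hC hC0 h0 hw).1, fun k => ?_⟩, h0⟩, hw⟩
  rw [H2Line.isConj_iff]
  by_cases hk : IsTransverse kstar k
  · refine (hbij (-k) hk.neg).1 ?_
    rw [hw _ hk.neg, op_neg_conj, hw _ hk, modeR_neg_eq]
  · have hk' : ¬ IsTransverse kstar (-k) := fun h => hk (by simpa using h.neg)
    rw [h0 _ hk', h0 _ hk]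
    refine H2Line.ext_fn ?_
    exact (map_zero (conjLp n)).symm

end IsCoefBound

theorem MTrans.ext_of_transverse {kstar : ℤ} {w v : MTrans n kstar}
    (h : ∀ k, IsTransverse kstar k → w.1 k = v.1 k) : w = v := by
  refine Subtype.ext (funext fun k => ?_)
  by_cases hk : IsTransverse kstar k
  · exact h k hk
  · rw [w.2.2 k hk, v.2.2 k hk]

theorem mNorm_nonneg {kstar : ℤ} (w : MTrans n kstar) : 0 ≤ mNorm w := Real.sqrt_nonneg _

theorem mNorm_sq {kstar : ℤ} (w : MTrans n kstar) : mNorm w ^ 2 = mNormSq w.1 :=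
  Real.sq_sqrt (mNormSq_nonneg _)

theorem eq_zero_of_mNorm_le_zero {kstar : ℤ} {w : MTrans n kstar} (h : mNorm w ≤ 0) : w = 0 := by
  have h1 : mNormSq w.1 = 0 := by
    rw [← mNorm_sq, le_antisymm h (mNorm_nonneg w)]; norm_num
  refine MTrans.ext_of_transverse fun k _ => H2Line.ext_fn ?_
  have h2 := (norm_fn_sq_le w.1 k).trans (w.2.1.1.le_tsum k fun j _ => mTerm_nonneg _ j)
  have h3 : ‖(w.1 k).fn‖ = 0 := pow_eq_zero_iff two_ne_zero |>.1
    (le_antisymm (h2.trans h1.le) (sq_nonneg _))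
  exact norm_eq_zero.1 h3

/-! ### Adjoining the modes `0, ±k*` -/

section Assemble

variable {kstar : ℤ} {u₀ um up : H2Line n}

theorem assemble_of_transverse {k : ℤ} (hk : IsTransverse kstar k) (w : MTrans n kstar) :
    assemble u₀ um up w k = w.1 k := by
  rw [assemble, if_neg hk.1, if_neg hk.2.1, if_neg hk.2.2]

theorem assemble_of_not_transverse {k : ℤ} (hk : ¬ IsTransverse kstar k) (w v : MTrans n kstar) :
    assemble u₀ um up w k = assemble u₀ um up v k := by
  unfold IsTransverse at hk
  unfold assemble
  split_ifs <;> first | rfl | tauto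

theorem assemble_sub (w v : MTrans n kstar) :
    assemble u₀ um up w - assemble u₀ um up v = (w - v : MTrans n kstar).1 := by
  funext k
  rw [Pi.sub_apply]
  by_cases hk : IsTransverse kstar k
  · rw [assemble_of_transverse hk, assemble_of_transverse hk]; rfl
  · rw [assemble_of_not_transverse hk w v, sub_self, (w - v).2.2 k hk]

theorem mTerm_of_eq_zero {w : ℤ → H2Line n} {k : ℤ} (h : w k = 0) : mTerm w k = 0 :=
  le_antisymm (by rw [mTerm_eq, h]; simpa using modeNormSq_le k (0 : H2Line n)) (mTerm_nonneg w k)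

theorem mTerm_assemble (w : MTrans n kstar) (k : ℤ) :
    mTerm (assemble u₀ um up w) k = mTerm (assemble u₀ um up (0 : MTrans n kstar)) k
      + mTerm w.1 k := by
  by_cases hk : IsTransverse kstar k
  · rw [mTerm_of_eq_zero (w := assemble u₀ um up (0 : MTrans n kstar)) (k := k)
      (by rw [assemble_of_transverse hk]; rfl), zero_add, mTerm_eq, mTerm_eq,
      assemble_of_transverse hk]
  · rw [mTerm_of_eq_zero (w.2.2 k hk), add_zero, mTerm_eq, mTerm_eq,
      assemble_of_not_transverse hk w 0]

theorem mTerm_assemble_zero {k : ℤ} (hk : k ∉ ({0, kstar, -kstar} : Finset ℤ)) :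
    mTerm (assemble u₀ um up (0 : MTrans n kstar)) k = 0 := by
  simp only [Finset.mem_insert, Finset.mem_singleton, not_or] at hk
  exact mTerm_of_eq_zero (by rw [assemble_of_transverse hk]; rfl)

theorem mNormSq_assemble_zero_le (hk : kstar ≠ 0) :
    mNormSq (assemble u₀ um up (0 : MTrans n kstar)) ≤
      max ((kstar : ℝ) ^ 4) 1 * (‖u₀‖ ^ 2 + ‖up‖ ^ 2 + ‖um‖ ^ 2) := by
  rw [mNormSq, tsum_eq_sum fun k hk => mTerm_assemble_zero hk, Finset.sum_insert (by simp; omega),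
    Finset.sum_insert (by simp; omega), Finset.sum_singleton, mTerm_eq, mTerm_eq, mTerm_eq]
  have e0 : assemble u₀ um up (0 : MTrans n kstar) 0 = u₀ := by simp [assemble]
  have e1 : assemble u₀ um up (0 : MTrans n kstar) kstar = up := by simp [assemble, hk]
  have e2 : assemble u₀ um up (0 : MTrans n kstar) (-kstar) = um := by
    have : -kstar ≠ kstar := by omega
    simp [assemble, hk, this]
  rw [e0, e1, e2]
  have h0 : modeNormSq 0 u₀ ≤ ‖u₀‖ ^ 2 := by
    have := modeNormSq_le 0 u₀
    rwa [Int.cast_zero, zero_pow four_ne_zero, max_eq_right zero_le_one, one_mul] at this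
  have h1 := modeNormSq_le kstar up
  have h2 := modeNormSq_le (-kstar) um
  have h3 := mul_le_mul_of_nonneg_right (le_max_right ((kstar : ℝ) ^ 4) 1) (sq_nonneg ‖u₀‖)
  have e3 : ((-kstar : ℤ) : ℝ) ^ 4 = (kstar : ℝ) ^ 4 := by push_cast; ring
  rw [e3] at h2
  linarith

theorem assemble_mem (hk : kstar ≠ 0) (h0 : u₀.IsConj u₀) (hp : up.IsConj um)
    (w : MTrans n kstar) : assemble u₀ um up w ∈ MSpace n := by
  have hs : Summable (mTerm (assemble u₀ um up w)) := by
    rw [funext (mTerm_assemble w)]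
    exact (summable_of_ne_finset_zero fun k hk => mTerm_assemble_zero hk).add w.2.1.1
  have hm : um.IsConj up := by
    filter_upwards [hp] with x hx
    rw [hx, conjV_conjV]
  refine ⟨hs, fun k => ?_⟩
  by_cases hk1 : IsTransverse kstar k
  · rw [assemble_of_transverse hk1, assemble_of_transverse hk1.neg]
    exact w.2.1.2 k
  · have : k = 0 ∨ k = kstar ∨ k = -kstar := by
      unfold IsTransverse at hk1; tauto
    have hne : -kstar ≠ kstar := by omega
    rcases this with rfl | rfl | rfl
    · simpa [assemble] using h0
    · simpa [assemble, hk, hne] using hp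
    · simpa [assemble, hk, hne] using hm

theorem mNormSq_assemble_le (hk : kstar ≠ 0) (w : MTrans n kstar) :
    mNormSq (assemble u₀ um up w) ≤
      max ((kstar : ℝ) ^ 4) 1 * (‖u₀‖ ^ 2 + ‖up‖ ^ 2 + ‖um‖ ^ 2) + mNorm w ^ 2 := by
  rw [mNorm_sq]
  refine le_trans (le_of_eq ?_) (add_le_add_left (mNormSq_assemble_zero_le hk) _)
  rw [mNormSq, funext (mTerm_assemble w)]
  exact (summable_of_ne_finset_zero fun k hk => mTerm_assemble_zero hk).tsum_add w.2.1.1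

end Assemble

/-! ### The contraction -/

/-- If `S` is bounded and `N` has a small Lipschitz constant on a ball, `S ∘ N` has a fixed point in
this ball. The contraction principle is applied to `N ∘ S` on a ball of `E`, so that the
completeness of `M` is not needed. -/
theorem exists_fixedPoint {kstar : ℤ} {E : Type*} [NormedAddCommGroup E] [CompleteSpace E]
    {S : E → MTrans n kstar} {N : MTrans n kstar → E} {K ε R : ℝ} (hK : 0 < K) (hε : 0 ≤ ε)
    (hKε : K * ε ≤ 1 / 2) (hR : 0 ≤ R) (hS : ∀ F, mNorm (S F) ≤ K * ‖F‖)
    (hS' : ∀ F G, mNorm (S F - S G) ≤ K * ‖F - G‖)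
    (hN : ∀ w, mNorm w ≤ R → K * ‖N w‖ ≤ R)
    (hN' : ∀ w v, mNorm w ≤ R → mNorm v ≤ R → ‖N w - N v‖ ≤ ε * mNorm (w - v)) :
    ∃ w, mNorm w ≤ R ∧ S (N w) = w := by
  have hball : ∀ F ∈ Metric.closedBall (0 : E) (R / K), mNorm (S F) ≤ R := fun F hF => by
    rw [mem_closedBall_zero_iff, le_div_iff₀ hK] at hF
    exact (hS F).trans (by linarith)
  have hmaps : Set.MapsTo (fun F => N (S F)) (Metric.closedBall (0 : E) (R / K))
      (Metric.closedBall (0 : E) (R / K)) := fun F hF => by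
    rw [mem_closedBall_zero_iff, le_div_iff₀ hK]
    have := hN _ (hball F hF)
    linarith
  have hcontr : ContractingWith (1 / 2) (hmaps.restrict _ _ _) := by
    refine ⟨by rw [div_lt_one (by norm_num)]; norm_num, LipschitzWith.of_dist_le_mul fun F G => ?_⟩
    rw [Subtype.dist_eq, Subtype.dist_eq, dist_eq_norm, dist_eq_norm]
    refine (hN' _ _ (hball _ F.2) (hball _ G.2)).trans ?_
    refine (mul_le_mul_of_nonneg_left (hS' _ _) hε).trans ?_
    have := mul_le_mul_of_nonneg_right hKε (norm_nonneg ((F : E) - G))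
    refine le_trans (le_of_eq ?_) (this.trans (le_of_eq ?_))
    · ring
    · simp
  obtain ⟨F, hF, hfix, -⟩ := hcontr.exists_fixedPoint' (x := (0 : E))
    Metric.isClosed_closedBall.isComplete hmaps (Metric.mem_closedBall_self (by positivity))
    (edist_ne_top _ _)
  exact ⟨S F, hball F hF, congrArg S hfix⟩

end

/-! ### The transverse modes -/

theorem theorem3p4 (n : ℕ) (f₁ f₂ : RVec n → RVec n) (hf₁ : ContDiff ℝ 2 f₁)
    (hf₂ : ContDiff ℝ 2 f₂) (c : ℝ) (ubar : ℝ → RVec n) (hubar : IsShockProfile f₁ c ubar)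
    (kstar : ℤ) (hkstar : kstar ≠ 0)
    (hinv : ∀ k : ℤ, IsTransverse kstar k → LkInvertible f₁ f₂ c ubar k) :
    ∃ R₀ > (0 : ℝ), ∃ θ : ℝ, 0 ≤ θ ∧ θ < 1 ∧ ∀ R : ℝ, 0 < R → R ≤ R₀ → ∃ δ > (0 : ℝ),
      ∀ u₀ um up : H2Line n, u₀.IsConj u₀ → up.IsConj um →
        ‖u₀‖ ^ 2 + ‖up‖ ^ 2 + ‖um‖ ^ 2 ≤ δ →
        ∃ T : MTrans n kstar → MTrans n kstar,
          (∀ w w' : MTrans n kstar, IsTImage f₁ f₂ c ubar kstar u₀ um up w w' ↔ w' = T w) ∧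
          (∀ w : MTrans n kstar, mNorm w ≤ R → mNorm (T w) ≤ R) ∧
          (∀ v w : MTrans n kstar, mNorm v ≤ R → mNorm w ≤ R →
            mNorm (T w - T v) ≤ θ * mNorm (w - v)) ∧
          ∃ w : MTrans n kstar, mNorm w ≤ R ∧ T w = w ∧
            ∃ u : L2Strip n,
              (MemH2Strip u ∧ SolvesTransverse f₁ f₂ c ubar kstar u ∧
                modeFn 0 u =ᵐ[volume] u₀.fn ∧ modeFn kstar u =ᵐ[volume] up.fn ∧
                modeFn (-kstar) u =ᵐ[volume] um.fn ∧ HasTransverseModes u w) ∧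
              ∀ (u' : L2Strip n) (w' : MTrans n kstar),
                MemH2Strip u' → SolvesTransverse f₁ f₂ c ubar kstar u' →
                modeFn 0 u' =ᵐ[volume] u₀.fn → modeFn kstar u' =ᵐ[volume] up.fn →
                modeFn (-kstar) u' =ᵐ[volume] um.fn → HasTransverseModes u' w' →
                mNorm w' ≤ R → u' = u ∧ w' = w := by
  obtain ⟨A, A', B, a, hc, hA, hB⟩ := hubar.exists_coefBound hf₁ hf₂
  obtain ⟨M, -, hM, hM'⟩ := hubar.exists_bound hf₁
  have hbij : ∀ k, IsTransverse kstar k → Function.Bijective (hc.op k) := fun k hk =>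
    hc.op_bijective hA hB (hinv k hk)
  obtain ⟨C, hC0, hC⟩ := hc.exists_uniform_bound {k | IsTransverse kstar k} hbij
  choose S hS using hc.exists_solve hbij hC hC0
  -- `K` bounds `S = (ℒ_k⁻¹ Π_k)_k` from `L²(Ω)` to `M`; it is made positive to divide by it.
  set K : ℝ := √(C / (2 * Real.pi)) + 1 with hKdef
  have hK : 0 < K := by positivity
  have hbound : ∀ (w : MTrans n kstar) (F : L2Strip n),
      (∀ k, IsTransverse kstar k → hc.op k (w.1 k) = modeR k F) → mNorm w ≤ K * ‖F‖ := by
    intro w F h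
    have h1 := (hc.summable_mTerm_and_mNormSq_le hC hC0 w.2.2 h).2
    have h2 : mNorm w ≤ √(C / (2 * Real.pi)) * ‖F‖ := by
      rw [← Real.sqrt_sq (norm_nonneg F), ← Real.sqrt_mul (by positivity)]
      exact Real.sqrt_le_sqrt h1
    exact h2.trans (mul_le_mul_of_nonneg_right (by linarith) (norm_nonneg F))
  have hSdiff : ∀ F G, mNorm (S F - S G) ≤ K * ‖F - G‖ := fun F G => by
    refine hbound _ _ fun k hk => ?_
    rw [map_sub, ← hS F k hk, ← hS G k hk, ← map_sub]
    rfl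
  obtain ⟨r, hr, hlip⟩ := exists_nonlin_lipschitz hf₁ hf₂ hubar.contDiff hM hM'
    (ε := 1 / (2 * K)) (by positivity)
  have hKε : K * (1 / (2 * K)) = 1 / 2 := by field_simp
  -- With `D · δ ≤ R²`, the modes `0, ±k*` contribute at most `R²` to the squared norm of
  -- `u₀ ⊕ u_{±k*} ⊕ w`, which is then at most `2R² ≤ r`.
  refine ⟨√(r / 2), by positivity, 1 / 2, by norm_num, by norm_num, fun R hR hRr => ?_⟩
  have hRr' : 2 * R ^ 2 ≤ r := by
    have := (Real.le_sqrt hR.le (by positivity)).1 hRr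
    linarith
  set D : ℝ := max ((kstar : ℝ) ^ 4) 1
  have hD : 0 < D := by positivity
  refine ⟨R ^ 2 / D, by positivity, fun u₀ um up h0 hp hδ => ?_⟩
  rw [le_div_iff₀ hD] at hδ
  have hmem := fun w : MTrans n kstar => assemble_mem (w := w) hkstar h0 hp
  have hsmall : ∀ w : MTrans n kstar, mNorm w ≤ R →
      mNormSq (assemble u₀ um up w) ≤ 2 * R ^ 2 := fun w hw => by
    have h1 := mNormSq_assemble_le (u₀ := u₀) (um := um) (up := up) hkstar w
    have h2 := pow_le_pow_left₀ (mNorm_nonneg w) hw 2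
    linarith
  -- `syn w` is the function with modes `u₀ ⊕ u_{±k*} ⊕ w`, and `N w` is its image under `𝒩`.
  have hex : ∀ w : MTrans n kstar, ∃ u F : L2Strip n, MemH2Strip u ∧
      HasModes u (assemble u₀ um up w) ∧ ∀ G, IsNonlin f₁ f₂ ubar u G ↔ G = F := fun w => by
    obtain ⟨u, ux, uy, hs, hu⟩ := exists_isSynth (hmem w)
    obtain ⟨G₁, G₂, -, -, hG⟩ := hs.exists_isNonlin_iff (hmem w).1 hf₁ hf₂ hubar.contDiff hM hM'
    exact ⟨u, _, hu, fun k => modeFn_ae_eq_iff.2 (hs.mode k), hG⟩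
  choose syn N hsyn hmodes hN using hex
  have hsyn_unique : ∀ (w : MTrans n kstar) (u : L2Strip n),
      HasModes u (assemble u₀ um up w) → u = syn w := fun w u hu => eq_of_modeR_eq fun k =>
    (modeFn_ae_eq_iff.1 (hu k)).trans (modeFn_ae_eq_iff.1 (hmodes w k)).symm
  have hT : ∀ w w' : MTrans n kstar,
      IsTImage f₁ f₂ c ubar kstar u₀ um up w w' ↔ w' = S (N w) := by
    intro w w'
    constructor
    · rintro ⟨u, F, -, hu, hF, h⟩
      rw [hsyn_unique w u hu, hN] at hF
      subst hF
      refine MTrans.ext_of_transverse fun k hk => (hbij k hk).1 ?_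
      rw [hS _ k hk]
      exact (modeFn_ae_eq_iff.1 ((hc.isLk_iff hA hB k _ _).1 (h k hk))).symm
    · rintro rfl
      refine ⟨syn w, N w, hsyn w, hmodes w, (hN w _).2 rfl, fun k hk => ?_⟩
      rw [hc.isLk_iff hA hB, modeFn_ae_eq_iff, hS _ k hk]
  have hNdiff : ∀ w v : MTrans n kstar, mNorm w ≤ R → mNorm v ≤ R →
      ‖N w - N v‖ ≤ 1 / (2 * K) * mNorm (w - v) := fun w v hw hv => by
    have := hlip _ (hmem w) _ (hmem v) ((hsmall w hw).trans hRr') ((hsmall v hv).trans hRr')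
      _ _ _ _ (hmodes w) (hmodes v) ((hN w _).2 rfl) ((hN v _).2 rfl)
    rwa [assemble_sub] at this
  have hNball : ∀ w : MTrans n kstar, mNorm w ≤ R → K * ‖N w‖ ≤ R := fun w hw => by
    -- As `𝒩[0] = 0`, the Lipschitz estimate bounds `𝒩` itself.
    have hz : HasModes (0 : L2Strip n) 0 := fun k => modeFn_ae_eq_iff.2 (map_zero _)
    have h1 := hlip _ (hmem w) 0 (zero_mem _) ((hsmall w hw).trans hRr')
      (by simp [mNormSq, mTerm_of_eq_zero, hr.le]) _ _ _ _ (hmodes w) hz ((hN w _).2 rfl)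
      IsNonlin.zero
    rw [sub_zero, sub_zero] at h1
    have h2 : √(mNormSq (assemble u₀ um up w)) ≤ 2 * R :=
      Real.sqrt_le_iff.2 ⟨by positivity, (hsmall w hw).trans (by nlinarith)⟩
    calc K * ‖N w‖ ≤ K * (1 / (2 * K) * (2 * R)) :=
          mul_le_mul_of_nonneg_left (h1.trans (mul_le_mul_of_nonneg_left h2 (by positivity))) hK.le
      _ = R := by field_simp
  have hTdiff : ∀ v w : MTrans n kstar, mNorm v ≤ R → mNorm w ≤ R →
      mNorm (S (N w) - S (N v)) ≤ 1 / 2 * mNorm (w - v) := fun v w hv hw => by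
    refine (hSdiff _ _).trans ((mul_le_mul_of_nonneg_left (hNdiff w v hw hv) hK.le).trans
      (le_of_eq ?_))
    rw [← mul_assoc, hKε]
  obtain ⟨w, hwR, hw⟩ := exists_fixedPoint (S := S) (N := N) hK (by positivity) hKε.le hR.le
    (fun F => hbound _ _ (hS F)) hSdiff hNball hNdiff
  refine ⟨fun w => S (N w), hT, fun w hw => (hbound _ _ (hS _)).trans (hNball w hw), hTdiff,
    w, hwR, hw, syn w, ⟨hsyn w, ⟨N w, (hN w _).2 rfl, fun k hk => ⟨w.1 k, ?_, ?_⟩⟩, ?_, ?_, ?_,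
      fun k hk => ?_⟩, ?_⟩
  · have := hmodes w k
    rwa [assemble_of_transverse hk] at this
  · rw [hc.isLk_iff hA hB, modeFn_ae_eq_iff, ← hS _ k hk, hw]
  · simpa [assemble] using hmodes w 0
  · simpa [assemble, hkstar] using hmodes w kstar
  · have hne : -kstar ≠ kstar := by omega
    simpa [assemble, hkstar, hne] using hmodes w (-kstar)
  · have := hmodes w k
    rwa [assemble_of_transverse hk] at this
  · rintro u' w' - ⟨F, hF, hsol⟩ e0 ep em hw' hwR'
    have hu' : HasModes u' (assemble u₀ um up w') := fun k => by
      by_cases hk : IsTransverse kstar k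
      · rw [assemble_of_transverse hk]; exact hw' k hk
      · unfold assemble
        split_ifs with k0 k1 k2
        · rw [k0]; exact e0
        · rw [k1]; exact ep
        · rw [k2]; exact em
        · exact (hk ⟨k0, k1, k2⟩).elim
    have hu : u' = syn w' := hsyn_unique w' u' hu'
    rw [hu, hN] at hF
    subst hF
    have hfix : w' = S (N w') := MTrans.ext_of_transverse fun k hk => (hbij k hk).1 <| by
      obtain ⟨U, hU, hLU⟩ := hsol k hk
      have hUw : U = w'.1 k := H2Line.ext_fn (Lp.ext (hU.symm.trans (hw' k hk)))
      rw [hc.isLk_iff hA hB, modeFn_ae_eq_iff, hUw] at hLU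
      rw [hS _ k hk, hLU]
    have hle := hTdiff w w' hwR hwR'
    rw [hw, ← hfix] at hle
    have hww : w' = w := sub_eq_zero.1
      (eq_zero_of_mNorm_le_zero (by linarith [mNorm_nonneg (w' - w)]))
    exact ⟨by rw [hu, hww], hww⟩
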